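/- **Setting.** There are arms $1,\dots,K$, a parameter set $\Theta$ (arbitrary), known mean reward functions $\mu_1,\dots,\mu_K:\Theta\to\mathbb R$ (arbitrary) and an unknown true parameter $\theta^*\in\Theta$. The successive rewards of arm $k$ are i.i.d. with mean $\mu_k(\theta^*)$ and are sub-Gaussian with known variance proxy $\sigma^2>0$, i.e. $\mathbb E\, e^{s(R_k-\mathbb E R_k)}\le e^{\sigma^2s^2/2}$ for all $s\in\mathbb R$; rewards of different arms are independent. Let $k^*$ be an optimal arm, $\mu_{k^*}(\theta^*)=\max_\ell\mu_\ell(\theta^*)$, and $\Delta_k=\mu_{k^*}(\theta^*)-\mu_k(\theta^*)$. Arm $k$ is sub-optimal if $\Delta_k>0$, and competitive if for every $\epsilon>0$ there is $\theta\in\Theta$ with $|\mu_{k^*}(\theta^*)-\mu_{k^*}(\theta)|<\epsilon$ and $\mu_k(\theta)=\max_\ell\mu_\ell(\theta)$. **Algorithms.** Let $n_k(t)$ be the number of pulls of arm $k$ in the first $t$ rounds and $\hat\mu_k(t)$ the empirical mean of its rewards. In round $t+1$ ($t\ge 0$), put $$\hat\Theta_t=\Big\{\theta\in\Theta:\ |\mu_k(\theta)-\hat\mu_k(t)|<\sqrt{2\alpha\sigma^2\log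 t/n_k(t)}\ \text{ for all } k\Big\},$$ and let $\mathcal C_t$ be the set of arms $k$ with $\mu_k(\theta)=\max_\ell\mu_\ell(\theta)$ for some $\theta\in\hat\Theta_t$, or the set of all arms if $\hat\Theta_t=\emptyset$. UCB-C pulls an arm of $\mathcal C_t$ that maximizes $\hat\mu_k(t)+\sqrt{2\alpha\sigma^2\log t/n_k(t)}$. TS-C draws independent samples $S_{k,t}\sim\mathcal N(\hat\mu_k(t),\beta\sigma^2/n_k(t))$ and pulls an arm of $\mathcal C_t$ that maximizes $S_{k,t}$. For an arm with $n_k(t)=0$ the confidence radius, the UCB index and the sample are $+\infty$. Ties are broken by an arbitrary fixed rule. **Theorem.** Let $\alpha>2$ and let $k$ be a competitive sub-optimal arm. Under UCB-C, for every $T$, $$\mathbb E[n_k(T)]\le \frac{8\alpha\sigma^2\log T}{\Delta_k^2}+\frac{2\alpha}{\alpha-2}+\sum_{t=1}^{T}2Kt^{1-\alpha},$$ and $\mathbb E[n_k(T)]=O(\log T)$ as $T\to\infty$. Under TS-C with $\beta>1$, for every $T$, $$\mathbb E[n_k(T)]\le \frac{9\beta\sigma^2\log T}{2\Delta_k^2}+3+e^{11\beta\sigma^2}+2\sum_{t=1}^{T}\Big(\frac1{t\Delta_k^2}\Big)^{2\beta}+\sum_{t=1}^{T}2Kt^{1-\alpha},$$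 and $\mathbb E[n_k(T)]=O(\log T)$ as $T\to\infty$. (For $T=0$ the term $\log T$ is read as $0$.) -/

import Mathlib

open MeasureTheory ProbabilityTheory Filter Asymptotics
open scoped NNReal

noncomputable section

namespace StructuredBandit

/-- The arm `k` attains the largest mean reward at the parameter `θ`. -/
def IsBestAt {K : ℕ} {Θ : Type*} (μ : Fin K → Θ → ℝ) (k : Fin K) (θ : Θ) : Prop :=
  ∀ l, μ l θ ≤ μ k θ

/-- The sub-optimality gap of the arm `k`, where `kstar` is the optimal arm and `θstar` the true
parameter. -/
def gap {K : ℕ} {Θ : Type*} (μ : Fin K → Θ → ℝ) (θstar : Θ) (kstar k : Fin K) : ℝ :=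
  μ kstar θstar - μ k θstar

/-- The arm `k` is competitive: for every `ε > 0` it is a best arm at some parameter `θ` at which
the mean reward of the optimal arm `kstar` is within `ε` of its true value. -/
def IsCompetitive {K : ℕ} {Θ : Type*} (μ : Fin K → Θ → ℝ) (θstar : Θ) (kstar k : Fin K) : Prop :=
  ∀ ε : ℝ, 0 < ε → ∃ θ : Θ, |μ kstar θstar - μ kstar θ| < ε ∧ IsBestAt μ k θ

/-- Empirical mean of the arm `k` after `n k` pulls, when `x k m` is the reward of its
`m`-th pull (counted from `0`). -/
def empMean {K : ℕ} (x : Fin K → ℕ → ℝ) (n : Fin K → ℕ) (k : Fin K) : ℝ :=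
  (∑ m ∈ Finset.range (n k), x k m) / (n k : ℝ)

/-- The confidence radius `√(2 α σ² log t / n)` of an arm pulled `n` times in the first `t`
rounds; it is `+∞` for an arm that has not been pulled. -/
def confRadius (α σ : ℝ) (t n : ℕ) : EReal :=
  if n = 0 then ⊤ else ((√(2 * α * σ ^ 2 * Real.log t / n) : ℝ) : EReal)

/-- The confidence set after `t` rounds, given the numbers of pulls `n` and the empirical
means `m`. -/
def confSet {K : ℕ} {Θ : Type*} (μ : Fin K → Θ → ℝ) (α σ : ℝ) (t : ℕ) (n : Fin K → ℕ)
    (m : Fin K → ℝ) : Set Θ :=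
  {θ | ∀ k, ((|μ k θ - m k| : ℝ) : EReal) < confRadius α σ t (n k)}

open Classical in
/-- The set of arms that are competitive with respect to the confidence set; all arms if the
confidence set is empty. -/
def competitiveSet {K : ℕ} {Θ : Type*} (μ : Fin K → Θ → ℝ) (α σ : ℝ) (t : ℕ) (n : Fin K → ℕ)
    (m : Fin K → ℝ) : Finset (Fin K) :=
  if confSet μ α σ t n m = ∅ then Finset.univ
  else Finset.univ.filter fun k => ∃ θ ∈ confSet μ α σ t n m, IsBestAt μ k θ

open Classical in
/-- The maximizers of the index `I` over the set of arms `C`. -/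
def argmaxOn {K : ℕ} (C : Finset (Fin K)) (I : Fin K → EReal) : Finset (Fin K) :=
  C.filter fun k => ∀ l ∈ C, I l ≤ I k

/-- The UCB index `m k + √(2 α σ² log t / n k)`. -/
def ucbIndex {K : ℕ} (α σ : ℝ) (t : ℕ) (n : Fin K → ℕ) (m : Fin K → ℝ) (k : Fin K) : EReal :=
  (m k : EReal) + confRadius α σ t (n k)

/-- The Thompson sample `m k + √(β σ² / n k) * g t k`, which has law `N(m k, β σ² / n k)` when
`g t k` is standard normal; it is `+∞` for an arm that has not been pulled. -/
def tsSample {K : ℕ} (β σ : ℝ) (g : ℕ → Fin K → ℝ) (t : ℕ) (n : Fin K → ℕ) (m : Fin K → ℝ)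
    (k : Fin K) : EReal :=
  if n k = 0 then ⊤ else ((m k + √(β * σ ^ 2 / n k) * g t k : ℝ) : EReal)

/-- A rule that breaks ties: in each round it selects one element of any non-empty set of arms. -/
def IsTieBreaking {K : ℕ} (τ : ℕ → Finset (Fin K) → Fin K) : Prop :=
  ∀ t s, s.Nonempty → τ t s ∈ s

/-- The arm pulled in round `t + 1`: a maximizer of the index over the competitive set. -/
def nextArm {K : ℕ} {Θ : Type*} (μ : Fin K → Θ → ℝ) (α σ : ℝ) (τ : ℕ → Finset (Fin K) → Fin K)
    (I : ℕ → (Fin K → ℕ) → (Fin K → ℝ) → Fin K → EReal) (x : Fin K → ℕ → ℝ) (t : ℕ)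
    (n : Fin K → ℕ) : Fin K :=
  τ t (argmaxOn (competitiveSet μ α σ t n (empMean x n)) (I t n (empMean x n)))

/-- `pulls μ α σ τ I x T k` is the number of pulls of the arm `k` in the first `T` rounds, when the
competitive arms are ranked by the index `I` and the `m`-th pull of the arm `l` is rewarded
by `x l m`. -/
def pulls {K : ℕ} {Θ : Type*} (μ : Fin K → Θ → ℝ) (α σ : ℝ) (τ : ℕ → Finset (Fin K) → Fin K)
    (I : ℕ → (Fin K → ℕ) → (Fin K → ℝ) → Fin K → EReal) (x : Fin K → ℕ → ℝ) :
    ℕ → Fin K → ℕ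
  | 0 => fun _ => 0
  | t + 1 => fun k =>
      pulls μ α σ τ I x t k + if nextArm μ α σ τ I x t (pulls μ α σ τ I x t) = k then 1 else 0

/-- Number of pulls under UCB-C. -/
def ucbcPulls {K : ℕ} {Θ : Type*} (μ : Fin K → Θ → ℝ) (α σ : ℝ)
    (τ : ℕ → Finset (Fin K) → Fin K) (x : Fin K → ℕ → ℝ) : ℕ → Fin K → ℕ :=
  pulls μ α σ τ (ucbIndex α σ) x

/-- Number of pulls under TS-C, driven by the noise `g`. -/
def tscPulls {K : ℕ} {Θ : Type*} (μ : Fin K → Θ → ℝ) (α β σ : ℝ)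
    (τ : ℕ → Finset (Fin K) → Fin K) (x : Fin K → ℕ → ℝ) (g : ℕ → Fin K → ℝ) : ℕ → Fin K → ℕ :=
  pulls μ α σ τ (tsSample β σ g) x

/-- The rewards `X k m` of the successive pulls of the arms are independent, and those of the
arm `k` have law `ν k`. -/
structure IsRewardTable {K : ℕ} {Ω : Type*} [MeasurableSpace Ω] (P : Measure Ω)
    (ν : Fin K → Measure ℝ) (X : Fin K → ℕ → Ω → ℝ) : Prop where
  measurable : ∀ k m, Measurable (X k m)
  map_eq : ∀ k m, P.map (X k m) = ν k
  indep : iIndepFun (fun p : Fin K × ℕ => X p.1 p.2) P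

/-- The variables `G t k` are independent standard normal, and independent of the rewards. -/
structure IsSamplingNoise {K : ℕ} {Ω : Type*} [MeasurableSpace Ω] (P : Measure Ω)
    (X : Fin K → ℕ → Ω → ℝ) (G : ℕ → Fin K → Ω → ℝ) : Prop where
  measurable : ∀ t k, Measurable (G t k)
  map_eq : ∀ t k, P.map (G t k) = gaussianReal 0 1
  indep : iIndepFun (fun q : ℕ × Fin K => G q.1 q.2) P
  indep_rewards : IndepFun (fun ω (p : Fin K × ℕ) => X p.1 p.2 ω)
    (fun ω (q : ℕ × Fin K) => G q.1 q.2 ω) P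

end StructuredBandit

end

/-!
UCB-C: as long as the true parameter lies in the confidence set, the optimal arm is in the
competitive set, so pulling `k` means that the index of `k` beats the optimal mean, which forces
`n_k < 8 α σ² log t / Δ²`. A union bound over the arms and their numbers of pulls makes the
complementary event of round `t` have probability at most `2 K t ^ (1 - α)`.

TS-C: on the same event fix a level `y = μ* - a Δ` and let `p` be the probability, given the
past, that the Gaussian sample of the optimal arm exceeds `y`. Since the samples of a round are
independent, pulling `k` with all samples below `y` is at most `(1 - p) / p` times as likely as
pulling the optimal arm. Charging these pulls to the pulls of the optimal arm bounds their number by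
the sum over `j` of the expected odds `(1 - p) / p` after `j` pulls of the optimal arm. The odds
function is dominated by a mixture of exponentials, whose expectation the sub-Gaussian hypothesis
controls because `β ≥ 1`, and the resulting series converges. The remaining pulls of `k` need either
few pulls, an overestimated empirical mean, or a Gaussian sample far above its mean; for these, a
chain of levels `y` interpolates between the factor `1` and the factor `1 / T`. Altogether, with
`κ = β σ² / Δ²`, the cost is `4.5 κ log T + 2.3 + A κ + B κ ^ (3 / 2)`, whose lower order terms are
absorbed by `e ^ (11 β σ²)`, by the first two terms of the sum over `(1 / (t Δ²)) ^ (2 β)`, and by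
the term `2 K ≥ 4` of round `1`.
-/

namespace StructuredBandit

section Series

lemma sum_range_le_add_of_hasDerivAt_le_neg {f g g' : ℝ → ℝ} (hf : AntitoneOn f (Set.Ici 1))
    (hg : ∀ x, 1 ≤ x → HasDerivAt g (g' x) x) (hg' : ∀ x, 1 ≤ x → g' x ≤ -f x)
    (hg0 : ∀ x, 1 ≤ x → 0 ≤ g x) (hf1 : 0 ≤ f 1) (n : ℕ) :
    ∑ i ∈ Finset.range n, f (i + 1) ≤ f 1 + g 1 := by
  have step : ∀ x : ℝ, 1 ≤ x → f (x + 1) ≤ g x - g (x + 1) := by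
    intro x hx
    obtain ⟨c, ⟨hxc, hcx⟩, hce⟩ := exists_hasDerivAt_eq_slope g g' (lt_add_one x)
      (fun y hy => (hg y (hx.trans hy.1)).continuousAt.continuousWithinAt)
      (fun y hy => hg y (hx.trans hy.1.le))
    rw [add_sub_cancel_left, div_one] at hce
    have hfc : f (x + 1) ≤ f c :=
      hf (Set.mem_Ici.2 (hx.trans hxc.le)) (Set.mem_Ici.2 (by linarith)) hcx.le
    linarith [hg' c (hx.trans hxc.le)]
  have telescope : ∀ n : ℕ, ∑ i ∈ Finset.range (n + 1), f (i + 1) ≤ f 1 + g 1 - g (n + 1) := by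
    intro n
    induction n with
    | zero => simp
    | succ n ih =>
      rw [Finset.sum_range_succ]
      push_cast
      linarith [step (n + 1) (by linarith [n.cast_nonneg (α := ℝ)])]
  cases n with
  | zero => simpa using add_nonneg hf1 (hg0 1 le_rfl)
  | succ n => linarith [telescope n, hg0 (n + 1) (by linarith [n.cast_nonneg (α := ℝ)])]

lemma hasDerivAt_exp_neg_sqrt {δ x : ℝ} (hx : 0 < x) :
    HasDerivAt (fun x => Real.exp (-(δ * √x))) (-(δ / (2 * √x)) * Real.exp (-(δ * √x))) x := by
  refine HasDerivAt.congr_deriv (f' := Real.exp (-(δ * √x)) * -(δ * (1 / (2 * √x))))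
    (((Real.hasDerivAt_sqrt hx.ne').const_mul δ).neg).exp ?_
  ring

lemma sum_exp_neg_sqrt_div_sqrt_le {δ : ℝ} (hδ : 0 < δ) (n : ℕ) :
    ∑ i ∈ Finset.range n, Real.exp (-(δ * √((i : ℝ) + 1))) / √((i : ℝ) + 1)
      ≤ Real.exp (-δ) * (1 + 2 / δ) := by
  refine (sum_range_le_add_of_hasDerivAt_le_neg (f := fun x => Real.exp (-(δ * √x)) / √x)
    (g := fun x => 2 / δ * Real.exp (-(δ * √x)))
    (g' := fun x => 2 / δ * (-(δ / (2 * √x)) * Real.exp (-(δ * √x)))) ?_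
    (fun x hx => (hasDerivAt_exp_neg_sqrt (by linarith)).const_mul _) (fun x hx => le_of_eq ?_)
    (fun x _ => by positivity) (by positivity) n).trans (le_of_eq ?_)
  · intro x (hx : 1 ≤ x) y _ hxy
    have : 0 < √x := Real.sqrt_pos.2 (by linarith)
    dsimp only
    gcongr
  · have : 0 < √x := Real.sqrt_pos.2 (by linarith)
    field_simp
  · simp only [Real.sqrt_one, mul_one, div_one]
    ring

lemma one_div_add_one_le_log {u : ℝ} (hu : 0 < u) : 1 / (u + 1) ≤ Real.log (1 + 1 / u) := by
  refine le_trans (le_of_eq ?_) (Real.one_sub_inv_le_log_of_pos (show 0 < 1 + 1 / u by positivity))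
  field_simp
  ring

lemma hasDerivAt_log_one_add_one_div_mul_sqrt {δ x : ℝ} (hδ : 0 < δ) (hx : 0 < x) :
    HasDerivAt (fun x => Real.log (1 + 1 / (δ * √x)))
      (-(1 / (2 * x * (δ * √x + 1)))) x := by
  have hsq : 0 < √x := Real.sqrt_pos.2 hx
  have hderiv := ((((Real.hasDerivAt_sqrt hx.ne').const_mul δ).inv (by positivity)).const_add 1).log
    (by simp only [Pi.inv_apply]; positivity)
  refine (hderiv.congr_deriv ?_).congr_of_eventuallyEq (Eventually.of_forall fun y => ?_)
  · simp only [Pi.inv_apply]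
    have hxs : x = √x ^ 2 := (Real.sq_sqrt hx.le).symm
    generalize √x = s at *
    subst hxs
    field_simp
  · simp only [one_div]
    rfl

lemma sum_exp_neg_sqrt_div_le {δ : ℝ} (hδ : 0 < δ) (n : ℕ) :
    ∑ i ∈ Finset.range n, Real.exp (-(δ * √((i : ℝ) + 1))) / ((i : ℝ) + 1)
      ≤ Real.exp (-δ) * (1 + 2 * Real.log (1 + 1 / δ)) := by
  have hlog : ∀ x : ℝ, 1 ≤ x → 1 / (δ * √x + 1) ≤ Real.log (1 + 1 / (δ * √x)) := fun x hx =>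
    one_div_add_one_le_log (mul_pos hδ (Real.sqrt_pos.2 (by linarith)))
  refine (sum_range_le_add_of_hasDerivAt_le_neg (f := fun x => Real.exp (-(δ * √x)) / x)
    (g := fun x => 2 * (Real.exp (-(δ * √x)) * Real.log (1 + 1 / (δ * √x))))
    (g' := fun x => 2 * (-(δ / (2 * √x)) * Real.exp (-(δ * √x)) * Real.log (1 + 1 / (δ * √x))
      + Real.exp (-(δ * √x)) * -(1 / (2 * x * (δ * √x + 1)))))
    ?_ (fun x hx => ?_) (fun x hx => ?_) (fun x hx => ?_) (by positivity) n).trans (le_of_eq ?_)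
  · intro x (hx : 1 ≤ x) y _ hxy
    have : 0 < x := by linarith
    dsimp only
    gcongr
  · exact ((hasDerivAt_exp_neg_sqrt (by linarith)).mul
      (hasDerivAt_log_one_add_one_div_mul_sqrt hδ (by linarith))).const_mul 2
  · have hx0 : 0 < x := by linarith
    have hsq : 0 < √x := Real.sqrt_pos.2 hx0
    calc 2 * (-(δ / (2 * √x)) * Real.exp (-(δ * √x)) * Real.log (1 + 1 / (δ * √x))
          + Real.exp (-(δ * √x)) * -(1 / (2 * x * (δ * √x + 1))))
        = -(Real.exp (-(δ * √x)) *
          (δ / √x * Real.log (1 + 1 / (δ * √x)) + 1 / (x * (δ * √x + 1)))) := by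
          field_simp
          ring
      _ ≤ -(Real.exp (-(δ * √x)) *
          (δ / √x * (1 / (δ * √x + 1)) + 1 / (x * (δ * √x + 1)))) := by
          gcongr
          exact hlog x hx
      _ = -(Real.exp (-(δ * √x)) / x) := by
          have hxs : x = √x ^ 2 := (Real.sq_sqrt hx0.le).symm
          generalize √x = s at *
          subst hxs
          field_simp
  · have : 0 ≤ Real.log (1 + 1 / (δ * √x)) :=
      (by positivity : 0 ≤ 1 / (δ * √x + 1)).trans (hlog x hx)
    positivity
  · simp only [Real.sqrt_one, mul_one, div_one]
    ring

end Series

section Gaussian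

/-- Upper tail of the standard normal law: the probability that a normalized Thompson sample
exceeds `z`. -/
noncomputable def gaussTail (z : ℝ) : ENNReal := gaussianReal 0 1 (Set.Ioi z)

/-- Distribution function of the standard normal law. -/
noncomputable def gaussCdf (z : ℝ) : ENNReal := gaussianReal 0 1 (Set.Iic z)

/-- The odds that a standard normal variable does not exceed `z`: the likelihood ratio in the
comparison of two arms in Thompson sampling. -/
noncomputable def gaussOdds (z : ℝ) : ENNReal := gaussCdf z / gaussTail z

lemma gaussTail_pos (z : ℝ) : 0 < gaussTail z := by
  refine pos_iff_ne_zero.2 fun h => ?_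
  have := gaussianReal_absolutelyContinuous' 0 (v := 1) one_ne_zero h
  simp at this

lemma gaussTail_ne_top (z : ℝ) : gaussTail z ≠ ⊤ := measure_ne_top _ _

lemma gaussTail_antitone : Antitone gaussTail := fun _ _ h => measure_mono (Set.Ioi_subset_Ioi h)

lemma gaussCdf_mono : Monotone gaussCdf := fun _ _ h => measure_mono (Set.Iic_subset_Iic.2 h)

lemma gaussOdds_mono : Monotone gaussOdds := fun _ _ h =>
  ENNReal.div_le_div (gaussCdf_mono h) (gaussTail_antitone h)

lemma gaussOdds_mul_gaussTail (z : ℝ) : gaussOdds z * gaussTail z = gaussCdf z :=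
  ENNReal.div_mul_cancel (gaussTail_pos z).ne' (gaussTail_ne_top z)

lemma measure_Ioi_inter_Iic_le {E : Type*} [LinearOrder E] [TopologicalSpace E]
    [OrderClosedTopology E] [MeasurableSpace E] [OpensMeasurableSpace E] (P : Measure E)
    [IsProbabilityMeasure P] (a b : E) :
    P (Set.Ioi a ∩ Set.Iic b) ≤ P (Set.Ioi a) * P (Set.Iic b) := by
  rw [Set.Ioi_inter_Iic]
  rcases le_total b a with hba | hba
  · simp [Set.Ioc_eq_empty_of_le hba]
  have hsum : P (Set.Iic a) + P (Set.Ioi a) = 1 := by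
    simpa only [Set.compl_Iic] using prob_add_prob_compl (μ := P) (measurableSet_Iic (a := a))
  refine (ENNReal.add_le_add_iff_left (measure_ne_top P (Set.Iic a))).1 ?_
  calc P (Set.Iic a) + P (Set.Ioc a b) = P (Set.Iic b) := by
        rw [← measure_union (Set.Iic_disjoint_Ioc le_rfl) measurableSet_Ioc,
          Set.Iic_union_Ioc_eq_Iic hba]
    _ = P (Set.Iic a) * P (Set.Iic b) + P (Set.Ioi a) * P (Set.Iic b) := by
        rw [← add_mul, hsum, one_mul]
    _ ≤ P (Set.Iic a) + P (Set.Ioi a) * P (Set.Iic b) := by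
        gcongr
        exact mul_le_of_le_one_right' prob_le_one

/-- The unnormalized Gaussian density `e^{-t²/2}`; the factor `1 / √(2π)` is left out, as it
cancels in the odds. -/
noncomputable def gaussWeight (t : ℝ) : ℝ := Real.exp (-(t ^ 2 / 2))

/-- The unnormalized upper Gaussian tail, so that `gaussTail z = upperGauss z / √(2π)`. -/
noncomputable def upperGauss (z : ℝ) : ℝ := ∫ t in Set.Ioi z, gaussWeight t

/-- The unnormalized lower Gaussian tail, so that `gaussCdf z = lowerGauss z / √(2π)`. -/
noncomputable def lowerGauss (z : ℝ) : ℝ := ∫ t in Set.Iic z, gaussWeight t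

lemma gaussWeight_pos (t : ℝ) : 0 < gaussWeight t := Real.exp_pos _

lemma gaussWeight_neg (t : ℝ) : gaussWeight (-t) = gaussWeight t := by simp [gaussWeight]

lemma continuous_gaussWeight : Continuous gaussWeight := by unfold gaussWeight; fun_prop

lemma gaussWeight_eq (t : ℝ) : gaussWeight t = Real.exp (-(1 / 2) * t ^ 2) := by
  unfold gaussWeight; congr 1; ring

lemma integrable_gaussWeight : Integrable gaussWeight := by
  rw [funext gaussWeight_eq]
  exact integrable_exp_neg_mul_sq (by norm_num)

lemma integral_gaussWeight : ∫ t, gaussWeight t = √(2 * Real.pi) := by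
  rw [funext gaussWeight_eq, integral_gaussian]
  congr 1
  field_simp

lemma lowerGauss_add_upperGauss (z : ℝ) : lowerGauss z + upperGauss z = √(2 * Real.pi) := by
  rw [← integral_gaussWeight]
  exact intervalIntegral.integral_Iic_add_Ioi integrable_gaussWeight.integrableOn
    integrable_gaussWeight.integrableOn

lemma lowerGauss_neg (z : ℝ) : lowerGauss (-z) = upperGauss z := by
  unfold lowerGauss upperGauss
  have hreflect := integral_comp_neg_Iic (-z) gaussWeight
  simp only [gaussWeight_neg, neg_neg] at hreflect
  exact hreflect

lemma upperGauss_zero : upperGauss 0 = √(2 * Real.pi) / 2 := by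
  have hadd := lowerGauss_add_upperGauss 0
  have hneg := lowerGauss_neg 0
  rw [neg_zero] at hneg
  linarith

lemma lowerGauss_eq_add_intervalIntegral (z : ℝ) :
    lowerGauss z = √(2 * Real.pi) / 2 + ∫ t in (0 : ℝ)..z, gaussWeight t := by
  have hsub := intervalIntegral.integral_Iic_sub_Iic (a := 0) (b := z)
    integrable_gaussWeight.integrableOn integrable_gaussWeight.integrableOn
  have hadd := lowerGauss_add_upperGauss 0
  have hzero := upperGauss_zero
  change lowerGauss z - lowerGauss 0 = _ at hsub
  linarith

lemma hasDerivAt_lowerGauss (z : ℝ) : HasDerivAt lowerGauss (gaussWeight z) z := by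
  rw [funext lowerGauss_eq_add_intervalIntegral]
  exact (intervalIntegral.integral_hasDerivAt_right
    (continuous_gaussWeight.intervalIntegrable _ _)
    (continuous_gaussWeight.stronglyMeasurableAtFilter _ _)
    continuous_gaussWeight.continuousAt).const_add _

lemma upperGauss_eq_sub (z : ℝ) : upperGauss z = √(2 * Real.pi) - lowerGauss z := by
  linarith [lowerGauss_add_upperGauss z]

lemma hasDerivAt_upperGauss (z : ℝ) : HasDerivAt upperGauss (-gaussWeight z) z := by
  rw [funext upperGauss_eq_sub]
  exact (hasDerivAt_lowerGauss z).const_sub _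

lemma lowerGauss_pos (z : ℝ) : 0 < lowerGauss z := by
  have hnonneg : 0 ≤ lowerGauss (z - 1) := integral_nonneg fun t => (gaussWeight_pos t).le
  have hmono : StrictMono lowerGauss :=
    strictMono_of_hasDerivAt_pos hasDerivAt_lowerGauss gaussWeight_pos
  exact hnonneg.trans_lt (hmono (by linarith))

lemma upperGauss_pos (z : ℝ) : 0 < upperGauss z := by rw [← lowerGauss_neg]; exact lowerGauss_pos _

lemma upperGauss_antitone : Antitone upperGauss :=
  antitone_of_hasDerivAt_nonpos hasDerivAt_upperGauss fun z => neg_nonpos.2 (gaussWeight_pos z).le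

lemma hasDerivAt_gaussWeight (z : ℝ) : HasDerivAt gaussWeight (-z * gaussWeight z) z := by
  have hexponent : HasDerivAt (fun t : ℝ => -(t ^ 2 / 2)) (-z) z := by
    refine ((hasDerivAt_pow 2 z).div_const 2).neg.congr_deriv ?_
    norm_num
  refine hexponent.exp.congr_deriv ?_
  unfold gaussWeight
  ring

lemma tendsto_gaussWeight : Tendsto gaussWeight atTop (nhds 0) := by
  unfold gaussWeight
  refine Real.tendsto_exp_neg_atTop_nhds_zero.comp ?_
  exact (tendsto_pow_atTop two_ne_zero).atTop_div_const two_pos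

lemma tendsto_upperGauss : Tendsto upperGauss atTop (nhds 0) := by
  have hlim := intervalIntegral_tendsto_integral_Ioi (f := gaussWeight) 0
    integrable_gaussWeight.integrableOn tendsto_id
  have heq : ∀ z, upperGauss z = upperGauss 0 - ∫ t in (0 : ℝ)..z, gaussWeight t := fun z => by
    rw [upperGauss_eq_sub, lowerGauss_eq_add_intervalIntegral, upperGauss_zero]; ring
  have : upperGauss = fun z => upperGauss 0 - ∫ t in (0 : ℝ)..z, gaussWeight t := funext heq
  rw [this]
  have hlim_sub := hlim.const_sub (upperGauss 0)
  rw [show upperGauss 0 - ∫ t in Set.Ioi 0, gaussWeight t = 0 from sub_self _] at hlim_sub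
  exact hlim_sub

lemma hasDerivAt_upperGauss_sub_mul {b : ℝ → ℝ} {b' t : ℝ} (hb : HasDerivAt b b' t) :
    HasDerivAt (fun t => upperGauss t - gaussWeight t * b t)
      (-gaussWeight t * (1 + (b' - t * b t))) t :=
  ((hasDerivAt_upperGauss t).sub ((hasDerivAt_gaussWeight t).mul hb)).congr_deriv (by ring)

lemma tendsto_upperGauss_sub_mul {b : ℝ → ℝ}
    (hlim : Tendsto (fun t => gaussWeight t * b t) atTop (nhds 0)) :
    Tendsto (fun t => upperGauss t - gaussWeight t * b t) atTop (nhds 0) := by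
  simpa only [sub_zero] using tendsto_upperGauss.sub hlim

lemma upperGauss_le_of_hasDerivAt {b b' : ℝ → ℝ} {z : ℝ}
    (hb : ∀ t, z ≤ t → HasDerivAt b (b' t) t) (h : ∀ t, z ≤ t → b' t - t * b t ≤ -1)
    (hlim : Tendsto (fun t => gaussWeight t * b t) atTop (nhds 0)) :
    upperGauss z ≤ gaussWeight z * b z := by
  have hmono : MonotoneOn (fun t => upperGauss t - gaussWeight t * b t) (Set.Ici z) := by
    refine monotoneOn_of_hasDerivWithinAt_nonneg (convex_Ici z)
      (fun t ht => (hasDerivAt_upperGauss_sub_mul (hb t ht)).continuousAt.continuousWithinAt)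
      (fun t ht => (hasDerivAt_upperGauss_sub_mul (hb t (interior_subset ht))).hasDerivWithinAt)
      fun t ht => ?_
    exact mul_nonneg_of_nonpos_of_nonpos (neg_nonpos.2 (gaussWeight_pos t).le)
      (by linarith [h t (interior_subset ht)])
  exact sub_nonpos.1 (ge_of_tendsto (tendsto_upperGauss_sub_mul hlim)
    (eventually_atTop.2 ⟨z, fun t ht => hmono Set.self_mem_Ici ht ht⟩))

lemma le_upperGauss_of_hasDerivAt {b b' : ℝ → ℝ} {z : ℝ}
    (hb : ∀ t, z ≤ t → HasDerivAt b (b' t) t) (h : ∀ t, z ≤ t → -1 ≤ b' t - t * b t)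
    (hlim : Tendsto (fun t => gaussWeight t * b t) atTop (nhds 0)) :
    gaussWeight z * b z ≤ upperGauss z := by
  have hanti : AntitoneOn (fun t => upperGauss t - gaussWeight t * b t) (Set.Ici z) := by
    refine antitoneOn_of_hasDerivWithinAt_nonpos (convex_Ici z)
      (fun t ht => (hasDerivAt_upperGauss_sub_mul (hb t ht)).continuousAt.continuousWithinAt)
      (fun t ht => (hasDerivAt_upperGauss_sub_mul (hb t (interior_subset ht))).hasDerivWithinAt)
      fun t ht => ?_
    exact mul_nonpos_of_nonpos_of_nonneg (neg_nonpos.2 (gaussWeight_pos t).le)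
      (by linarith [h t (interior_subset ht)])
  exact sub_nonneg.1 (le_of_tendsto (tendsto_upperGauss_sub_mul hlim)
    (eventually_atTop.2 ⟨z, fun t ht => hanti Set.self_mem_Ici ht ht⟩))

lemma tendsto_gaussWeight_mul {b : ℝ → ℝ} (h : ∀ t, 1 ≤ t → 0 ≤ b t ∧ b t ≤ 1) :
    Tendsto (fun t => gaussWeight t * b t) atTop (nhds 0) := by
  refine squeeze_zero' ?_ ?_ tendsto_gaussWeight
  · filter_upwards [eventually_ge_atTop 1] with t ht using
      mul_nonneg (gaussWeight_pos t).le (h t ht).1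
  · filter_upwards [eventually_ge_atTop 1] with t ht using
      mul_le_of_le_one_right (gaussWeight_pos t).le (h t ht).2

/- The rational factors here and in `le_upperGauss` are consecutive convergents of Laplace's
continued fraction for the Mills ratio. -/
lemma upperGauss_le {z : ℝ} (hz : 0 < z) :
    upperGauss z ≤ gaussWeight z * ((z ^ 2 + 2) / (z ^ 3 + 3 * z)) := by
  refine upperGauss_le_of_hasDerivAt (b := fun t => (t ^ 2 + 2) / (t ^ 3 + 3 * t))
    (b' := fun t => (2 * t * (t ^ 3 + 3 * t) - (t ^ 2 + 2) * (3 * t ^ 2 + 3)) / (t ^ 3 + 3 * t) ^ 2)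
    (fun t ht => ?_) (fun t ht => ?_) (tendsto_gaussWeight_mul fun t ht => ⟨by positivity, ?_⟩)
  · have ht0 : 0 < t := hz.trans_le ht
    have hnum : HasDerivAt (fun t : ℝ => t ^ 2 + 2) (2 * t) t := by
      simpa using (hasDerivAt_pow 2 t).add_const 2
    have hden : HasDerivAt (fun t : ℝ => t ^ 3 + 3 * t) (3 * t ^ 2 + 3) t := by
      exact ((hasDerivAt_pow 3 t).add ((hasDerivAt_id t).const_mul 3)).congr_deriv (by norm_num)
    exact hnum.div hden (by positivity)
  · have ht0 : 0 < t := hz.trans_le ht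
    have : 0 < t ^ 3 + 3 * t := by positivity
    rw [mul_div_assoc', ← sub_nonneg]
    have : -1 - ((2 * t * (t ^ 3 + 3 * t) - (t ^ 2 + 2) * (3 * t ^ 2 + 3)) / (t ^ 3 + 3 * t) ^ 2
        - t * (t ^ 2 + 2) / (t ^ 3 + 3 * t)) = 6 / (t ^ 3 + 3 * t) ^ 2 := by
      field_simp
      ring
    rw [this]
    positivity
  · rw [div_le_one (by positivity)]
    nlinarith [mul_nonneg (sub_nonneg.2 ht) (sq_nonneg t)]

lemma le_upperGauss {z : ℝ} (hz : 0 < z) :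
    gaussWeight z * ((z ^ 3 + 5 * z) / (z ^ 4 + 6 * z ^ 2 + 3)) ≤ upperGauss z := by
  refine le_upperGauss_of_hasDerivAt (b := fun t => (t ^ 3 + 5 * t) / (t ^ 4 + 6 * t ^ 2 + 3))
    (b' := fun t => ((3 * t ^ 2 + 5) * (t ^ 4 + 6 * t ^ 2 + 3)
      - (t ^ 3 + 5 * t) * (4 * t ^ 3 + 12 * t)) / (t ^ 4 + 6 * t ^ 2 + 3) ^ 2)
    (fun t ht => ?_) (fun t ht => ?_) (tendsto_gaussWeight_mul fun t ht => ⟨by positivity, ?_⟩)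
  · have ht0 : 0 < t := hz.trans_le ht
    have hnum : HasDerivAt (fun t : ℝ => t ^ 3 + 5 * t) (3 * t ^ 2 + 5) t := by
      exact ((hasDerivAt_pow 3 t).add ((hasDerivAt_id t).const_mul 5)).congr_deriv (by norm_num)
    have hden : HasDerivAt (fun t : ℝ => t ^ 4 + 6 * t ^ 2 + 3) (4 * t ^ 3 + 12 * t) t := by
      refine (((hasDerivAt_pow 4 t).add
        ((hasDerivAt_pow 2 t).const_mul 6)).add_const 3).congr_deriv ?_
      norm_num
      ring
    exact hnum.div hden (by positivity)
  · have ht0 : 0 < t := hz.trans_le ht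
    have : 0 < t ^ 4 + 6 * t ^ 2 + 3 := by positivity
    rw [mul_div_assoc', ← sub_nonneg]
    have : ((3 * t ^ 2 + 5) * (t ^ 4 + 6 * t ^ 2 + 3)
      - (t ^ 3 + 5 * t) * (4 * t ^ 3 + 12 * t)) / (t ^ 4 + 6 * t ^ 2 + 3) ^ 2
        - t * (t ^ 3 + 5 * t) / (t ^ 4 + 6 * t ^ 2 + 3) - -1
        = 24 / (t ^ 4 + 6 * t ^ 2 + 3) ^ 2 := by
      field_simp
      ring
    rw [this]
    positivity
  · rw [div_le_one (by positivity)]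
    nlinarith [mul_nonneg (sub_nonneg.2 ht) (pow_nonneg (zero_le_one.trans ht) 3),
      sq_nonneg (t - 1), sq_nonneg t]

lemma mul_upperGauss_le (z : ℝ) : z * upperGauss z ≤ gaussWeight z := by
  rcases le_or_gt z 0 with hz | hz
  · exact (mul_nonpos_of_nonpos_of_nonneg hz (upperGauss_pos z).le).trans (gaussWeight_pos z).le
  · have hbound := upperGauss_le hz
    calc z * upperGauss z ≤ z * (gaussWeight z * ((z ^ 2 + 2) / (z ^ 3 + 3 * z))) := by gcongr
      _ = gaussWeight z * ((z ^ 2 + 2) / (z ^ 2 + 3)) := by field_simp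
      _ ≤ gaussWeight z := mul_le_of_le_one_right (gaussWeight_pos z).le
          ((div_le_one (by positivity)).2 (by linarith))

lemma hasDerivAt_gaussWeight_div_upperGauss_sq (z : ℝ) :
    HasDerivAt (fun z => gaussWeight z / upperGauss z ^ 2)
      (gaussWeight z * (2 * gaussWeight z - z * upperGauss z) / upperGauss z ^ 3) z := by
  have := upperGauss_pos z
  refine ((hasDerivAt_gaussWeight z).div ((hasDerivAt_upperGauss z).pow 2)
    (pow_ne_zero 2 this.ne')).congr_deriv ?_
  simp only [Pi.pow_apply]
  field_simp
  ring

lemma convexOn_inv_upperGauss : ConvexOn ℝ Set.univ fun z => (upperGauss z)⁻¹ := by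
  have hd : ∀ z, HasDerivAt (fun z => (upperGauss z)⁻¹) (gaussWeight z / upperGauss z ^ 2) z :=
    fun z => ((hasDerivAt_upperGauss z).inv (upperGauss_pos z).ne').congr_deriv (by rw [neg_neg])
  refine Monotone.convexOn_univ_of_deriv (fun z => (hd z).differentiableAt) ?_
  rw [funext fun z => (hd z).deriv]
  refine monotone_of_hasDerivAt_nonneg hasDerivAt_gaussWeight_div_upperGauss_sq fun z => ?_
  have : 0 ≤ 2 * gaussWeight z - z * upperGauss z := by
    linarith [mul_upperGauss_le z, gaussWeight_pos z]
  have := gaussWeight_pos z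
  have := upperGauss_pos z
  positivity

lemma convexOn_lowerGauss_div_upperGauss :
    ConvexOn ℝ Set.univ fun z => lowerGauss z / upperGauss z := by
  have hodds : (fun z => lowerGauss z / upperGauss z)
      = fun z => √(2 * Real.pi) * (upperGauss z)⁻¹ + (-1) := funext fun z => by
    have := (upperGauss_pos z).ne'
    rw [← lowerGauss_add_upperGauss z]
    field_simp
    ring
  rw [hodds]
  exact (convexOn_inv_upperGauss.smul (Real.sqrt_nonneg _)).add_const _

lemma gaussianReal_zero_one_apply (s : Set ℝ) :
    gaussianReal 0 1 s = ENNReal.ofReal ((∫ t in s, gaussWeight t) / √(2 * Real.pi)) := by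
  rw [gaussianReal_apply_eq_integral _ one_ne_zero, ← integral_div]
  congr 1
  refine integral_congr_ae (Eventually.of_forall fun t => ?_)
  simp only [gaussianPDFReal, gaussWeight, NNReal.coe_one, mul_one, sub_zero]
  rw [neg_div, div_eq_inv_mul]
  ring

lemma gaussTail_eq_ofReal (z : ℝ) :
    gaussTail z = ENNReal.ofReal (upperGauss z / √(2 * Real.pi)) :=
  gaussianReal_zero_one_apply _

lemma gaussCdf_eq_ofReal (z : ℝ) :
    gaussCdf z = ENNReal.ofReal (lowerGauss z / √(2 * Real.pi)) :=
  gaussianReal_zero_one_apply _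

lemma gaussOdds_eq_ofReal (z : ℝ) :
    gaussOdds z = ENNReal.ofReal (lowerGauss z / upperGauss z) := by
  have : 0 < √(2 * Real.pi) := by positivity
  have := upperGauss_pos z
  rw [gaussOdds, gaussTail_eq_ofReal, gaussCdf_eq_ofReal,
    ← ENNReal.ofReal_div_of_pos (by positivity)]
  congr 1
  field_simp

end Gaussian

section Majorant

/-- A mixture of exponentials that dominates the odds function `gaussOdds`. Its expectation at an
empirical mean is controlled by the sub-Gaussian bound, exponential by exponential; the density
`s + 5 / 4` is the simplest one for which the domination holds on the whole line. -/
noncomputable def oddsMajorant (z : ℝ) : ENNReal :=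
  ∫⁻ s in Set.Ioi (1 : ℝ), ENNReal.ofReal ((s + 5 / 4) * Real.exp (s * z - s ^ 2 / 2))

/-- Closed form of `oddsMajorant`. -/
noncomputable def oddsMajorantReal (z : ℝ) : ℝ :=
  Real.exp (z - 1 / 2) + (z + 5 / 4) * (Real.exp (z ^ 2 / 2) * lowerGauss (z - 1))

/-- Closed form of the derivative of `oddsMajorant`. -/
noncomputable def oddsMajorantDeriv (z : ℝ) : ℝ :=
  (z + 9 / 4) * Real.exp (z - 1 / 2)
    + (1 + z ^ 2 + 5 / 4 * z) * (Real.exp (z ^ 2 / 2) * lowerGauss (z - 1))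

lemma exp_mul_sub_sq_div_two (s z : ℝ) :
    Real.exp (s * z - s ^ 2 / 2) = Real.exp (z ^ 2 / 2) * gaussWeight (s - z) := by
  rw [gaussWeight, ← Real.exp_add]; congr 1; ring

lemma hasDerivAt_exp_mul_sub_sq_div_two (s z : ℝ) :
    HasDerivAt (fun s => Real.exp (s * z - s ^ 2 / 2))
      ((z - s) * Real.exp (s * z - s ^ 2 / 2)) s := by
  have hexponent : HasDerivAt (fun s : ℝ => s * z - s ^ 2 / 2) (z - s) s :=
    (((hasDerivAt_id s).mul_const z).sub ((hasDerivAt_pow 2 s).div_const 2)).congr_deriv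
      (by norm_num)
  exact hexponent.exp.congr_deriv (mul_comm _ _)

lemma hasDerivAt_upperGauss_sub (s z : ℝ) :
    HasDerivAt (fun s => Real.exp (z ^ 2 / 2) * upperGauss (s - z))
      (-Real.exp (s * z - s ^ 2 / 2)) s := by
  have hderiv := ((hasDerivAt_upperGauss (s - z)).comp s ((hasDerivAt_id s).sub_const z)).const_mul
    (Real.exp (z ^ 2 / 2))
  refine hderiv.congr_deriv ?_
  rw [exp_mul_sub_sq_div_two]
  ring

lemma tendsto_add_mul_exp_mul_sub_sq_div_two (z A : ℝ) :
    Tendsto (fun s => (s + A) * Real.exp (s * z - s ^ 2 / 2)) atTop (nhds 0) := by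
  have hlin := tendsto_rpow_mul_exp_neg_mul_atTop_nhds_zero 1 1 one_pos
  have hconst := tendsto_rpow_mul_exp_neg_mul_atTop_nhds_zero 0 1 one_pos
  have hsum := hlin.add (hconst.const_mul |A|)
  simp only [mul_zero, add_zero, Real.rpow_one, Real.rpow_zero, one_mul, neg_mul] at hsum
  refine squeeze_zero_norm' ?_ hsum
  filter_upwards [eventually_ge_atTop (max 0 (2 * z + 2))] with s hs
  have hs0 : 0 ≤ s := (le_max_left _ _).trans hs
  have hs1 : 2 * z + 2 ≤ s := (le_max_right _ _).trans hs
  rw [norm_mul, Real.norm_of_nonneg (Real.exp_nonneg _), ← add_mul]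
  refine mul_le_mul ?_ (Real.exp_le_exp.2 (by nlinarith)) (Real.exp_nonneg _)
    (by positivity)
  exact (norm_add_le _ _).trans (by rw [Real.norm_of_nonneg hs0, Real.norm_eq_abs])

lemma tendsto_upperGauss_sub (z : ℝ) :
    Tendsto (fun s => Real.exp (z ^ 2 / 2) * upperGauss (s - z)) atTop (nhds 0) := by
  have hlim := (tendsto_upperGauss.comp (tendsto_atTop_add_const_right _ (-z) tendsto_id)).const_mul
    (Real.exp (z ^ 2 / 2))
  rw [mul_zero] at hlim
  exact hlim

lemma integral_oddsMajorantReal (z : ℝ) :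
    IntegrableOn (fun s => (s + 5 / 4) * Real.exp (s * z - s ^ 2 / 2)) (Set.Ioi 1) ∧
    ∫ s in Set.Ioi (1 : ℝ), (s + 5 / 4) * Real.exp (s * z - s ^ 2 / 2)
      = oddsMajorantReal z := by
  set g : ℝ → ℝ := fun s => -(Real.exp (s * z - s ^ 2 / 2)
    + (z + 5 / 4) * (Real.exp (z ^ 2 / 2) * upperGauss (s - z))) with hg
  have hd : ∀ s ∈ Set.Ici (1 : ℝ), HasDerivAt g ((s + 5 / 4) * Real.exp (s * z - s ^ 2 / 2)) s :=
    fun s _ => by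
      refine ((hasDerivAt_exp_mul_sub_sq_div_two s z).add
        ((hasDerivAt_upperGauss_sub s z).const_mul (z + 5 / 4))).neg.congr_deriv ?_
      ring
  have hpos : ∀ s ∈ Set.Ioi (1 : ℝ), 0 ≤ (s + 5 / 4) * Real.exp (s * z - s ^ 2 / 2) :=
    fun s hs => by
      have : (1 : ℝ) < s := hs
      positivity
  have hlim : Tendsto g atTop (nhds 0) := by
    have hexp : Tendsto (fun s => Real.exp (s * z - s ^ 2 / 2)) atTop (nhds 0) := by
      have := (tendsto_add_mul_exp_mul_sub_sq_div_two z 1).sub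
        (tendsto_add_mul_exp_mul_sub_sq_div_two z 0)
      rw [sub_zero] at this
      refine this.congr fun s => ?_
      ring
    have := (hexp.add ((tendsto_upperGauss_sub z).const_mul (z + 5 / 4))).neg
    simp only [mul_zero, add_zero, neg_zero] at this
    exact this
  refine ⟨integrableOn_Ioi_deriv_of_nonneg' hd hpos hlim, ?_⟩
  rw [integral_Ioi_of_hasDerivAt_of_nonneg' hd hpos hlim]
  simp only [hg, oddsMajorantReal]
  rw [← lowerGauss_neg (1 - z), neg_sub]
  ring_nf

lemma integral_oddsMajorantDeriv (z : ℝ) :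
    IntegrableOn (fun s => s * ((s + 5 / 4) * Real.exp (s * z - s ^ 2 / 2))) (Set.Ioi 1) ∧
    ∫ s in Set.Ioi (1 : ℝ), s * ((s + 5 / 4) * Real.exp (s * z - s ^ 2 / 2))
      = oddsMajorantDeriv z := by
  set g : ℝ → ℝ := fun s => -((s + (z + 5 / 4)) * Real.exp (s * z - s ^ 2 / 2)
    + (1 + z ^ 2 + 5 / 4 * z) * (Real.exp (z ^ 2 / 2) * upperGauss (s - z))) with hg
  have hd : ∀ s ∈ Set.Ici (1 : ℝ),
      HasDerivAt g (s * ((s + 5 / 4) * Real.exp (s * z - s ^ 2 / 2))) s := fun s _ => by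
    refine ((((hasDerivAt_id s).add_const (z + 5 / 4)).mul
      (hasDerivAt_exp_mul_sub_sq_div_two s z)).add
      ((hasDerivAt_upperGauss_sub s z).const_mul (1 + z ^ 2 + 5 / 4 * z))).neg.congr_deriv ?_
    simp only [id]
    ring
  have hpos : ∀ s ∈ Set.Ioi (1 : ℝ), 0 ≤ s * ((s + 5 / 4) * Real.exp (s * z - s ^ 2 / 2)) :=
    fun s hs => by
      have : (1 : ℝ) < s := hs
      positivity
  have hlim : Tendsto g atTop (nhds 0) := by
    have := ((tendsto_add_mul_exp_mul_sub_sq_div_two z (z + 5 / 4)).add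
      ((tendsto_upperGauss_sub z).const_mul (1 + z ^ 2 + 5 / 4 * z))).neg
    simp only [mul_zero, add_zero, neg_zero] at this
    exact this
  refine ⟨integrableOn_Ioi_deriv_of_nonneg' hd hpos hlim, ?_⟩
  rw [integral_Ioi_of_hasDerivAt_of_nonneg' hd hpos hlim]
  simp only [hg, oddsMajorantDeriv]
  rw [← lowerGauss_neg (1 - z), neg_sub]
  ring_nf

lemma oddsMajorant_eq_ofReal (z : ℝ) : oddsMajorant z = ENNReal.ofReal (oddsMajorantReal z) := by
  obtain ⟨hmajor, hmajor_eq⟩ := integral_oddsMajorantReal z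
  rw [oddsMajorant, ← hmajor_eq, ofReal_integral_eq_lintegral_ofReal hmajor]
  refine (ae_restrict_iff' measurableSet_Ioi).2 (Eventually.of_forall fun s hs => ?_)
  have : (1 : ℝ) < s := hs
  simp only [Pi.zero_apply]
  positivity

lemma oddsMajorantReal_tangent_le (m z : ℝ) :
    oddsMajorantReal m + oddsMajorantDeriv m * (z - m) ≤ oddsMajorantReal z := by
  obtain ⟨hm, hm_eq⟩ := integral_oddsMajorantReal m
  obtain ⟨hm', hm'_eq⟩ := integral_oddsMajorantDeriv m
  obtain ⟨hz, hz_eq⟩ := integral_oddsMajorantReal z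
  rw [← hm_eq, ← hm'_eq, ← hz_eq, ← integral_mul_const, ← integral_add hm (hm'.mul_const _)]
  refine setIntegral_mono_on (hm.add (hm'.mul_const _)) hz measurableSet_Ioi fun s hs => ?_
  have hs1 : (1 : ℝ) < s := hs
  have hexp : Real.exp (s * z - s ^ 2 / 2)
      = Real.exp (s * m - s ^ 2 / 2) * Real.exp (s * (z - m)) := by
    rw [← Real.exp_add]; congr 1; ring
  have hweight : 0 ≤ (s + 5 / 4) * Real.exp (s * m - s ^ 2 / 2) := by positivity
  rw [hexp]
  linarith [mul_le_mul_of_nonneg_left (Real.add_one_le_exp (s * (z - m))) hweight]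

/-- A tangent of the majorant that lies above the odds function at both ends of an interval lies
above it in between, since the odds function is convex. -/
lemma odds_le_oddsMajorantReal_of_tangent {u v m : ℝ}
    (hu : lowerGauss u / upperGauss u ≤ oddsMajorantReal m + oddsMajorantDeriv m * (u - m))
    (hv : lowerGauss v / upperGauss v ≤ oddsMajorantReal m + oddsMajorantDeriv m * (v - m))
    {z : ℝ} (hz : z ∈ Set.Icc u v) :
    lowerGauss z / upperGauss z ≤ oddsMajorantReal z := by
  refine le_trans ?_ (oddsMajorantReal_tangent_le m z)
  have haffine : ConcaveOn ℝ Set.univ fun z =>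
      oddsMajorantReal m + oddsMajorantDeriv m * (z - m) :=
    ⟨convex_univ, fun x _ y _ a b _ _ hab => le_of_eq (by
      simp only [smul_eq_mul]
      linear_combination (oddsMajorantReal m - oddsMajorantDeriv m * m) * hab)⟩
  have hmax := (convexOn_lowerGauss_div_upperGauss.sub haffine).le_max_of_mem_Icc
    (Set.mem_univ u) (Set.mem_univ v) hz
  exact sub_nonpos.1 (hmax.trans (max_le (sub_nonpos.2 hu) (sub_nonpos.2 hv)))

end Majorant

section Numerics

/-- Partial sums of the power series of `e^{-u}`. For `0 ≤ u` they lie alternately below and above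
the limit, which gives rational bounds for exponentials. -/
noncomputable def expPartial (n : ℕ) (u : ℝ) : ℝ :=
  ∑ k ∈ Finset.range n, (-u) ^ k / (k.factorial : ℝ)

/-- Partial sums of the power series of the integral of `gaussWeight` over `[0, y]`. For `0 ≤ y`
they lie alternately below and above the limit, which gives rational bounds for `lowerGauss`. -/
noncomputable def gaussWeightIntegralPartial (n : ℕ) (y : ℝ) : ℝ :=
  ∑ k ∈ Finset.range n, (-1) ^ k * y ^ (2 * k + 1) / (2 ^ k * (k.factorial : ℝ) * (2 * k + 1))

lemma hasDerivAt_neg_pow_div_factorial (n : ℕ) (u : ℝ) :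
    HasDerivAt (fun u : ℝ => (-u) ^ (n + 1) / ((n + 1).factorial : ℝ))
      (-((-u) ^ n / (n.factorial : ℝ))) u := by
  refine (((hasDerivAt_neg u).pow (n + 1)).div_const _).congr_deriv ?_
  rw [Nat.factorial_succ]
  push_cast
  have : (n.factorial : ℝ) ≠ 0 := by positivity
  have : (n : ℝ) + 1 ≠ 0 := by positivity
  field_simp

lemma hasDerivAt_expPartial_succ (n : ℕ) (u : ℝ) :
    HasDerivAt (expPartial (n + 1)) (-expPartial n u) u := by
  have hsum := (HasDerivAt.fun_sum (u := Finset.range n) fun k _ =>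
    hasDerivAt_neg_pow_div_factorial k u).add_const 1
  rw [Finset.sum_neg_distrib] at hsum
  refine hsum.congr_of_eventuallyEq (Eventually.of_forall fun v => ?_)
  simp [expPartial, Finset.sum_range_succ']

lemma alternating_expPartial (n : ℕ) {u : ℝ} (hu : 0 ≤ u) :
    0 ≤ (-1) ^ n * (Real.exp (-u) - expPartial n u) := by
  induction n generalizing u with
  | zero => simpa [expPartial] using Real.exp_nonneg (-u)
  | succ n ih =>
    have hd : ∀ u, HasDerivAt (fun u => (-1) ^ (n + 1) * (Real.exp (-u) - expPartial (n + 1) u))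
        ((-1) ^ n * (Real.exp (-u) - expPartial n u)) u := fun u => by
      refine (((hasDerivAt_neg u).exp.sub (hasDerivAt_expPartial_succ n u)).const_mul
        ((-1) ^ (n + 1))).congr_deriv ?_
      rw [pow_succ]
      ring
    have hm := monotoneOn_of_hasDerivWithinAt_nonneg (convex_Ici (0 : ℝ))
      (fun t _ => (hd t).continuousAt.continuousWithinAt)
      (fun t _ => (hd t).hasDerivWithinAt) (fun t ht => ih (interior_subset ht))
    have h0u := hm Set.self_mem_Ici hu hu
    refine le_trans (le_of_eq ?_) h0u
    simp [expPartial, Finset.sum_range_succ']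

lemma hasDerivAt_gaussWeightIntegralPartial (n : ℕ) (y : ℝ) :
    HasDerivAt (gaussWeightIntegralPartial n) (expPartial n (y ^ 2 / 2)) y := by
  unfold gaussWeightIntegralPartial expPartial
  refine HasDerivAt.fun_sum fun k _ => ?_
  refine (((hasDerivAt_pow (2 * k + 1) y).const_mul ((-1) ^ k)).div_const _).congr_deriv ?_
  have hodd : (2 : ℝ) * k + 1 ≠ 0 := by positivity
  have hfact : (k.factorial : ℝ) ≠ 0 := by positivity
  rw [neg_pow (y ^ 2 / 2), div_pow, ← pow_mul, show 2 * k + 1 - 1 = 2 * k from rfl]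
  push_cast
  field_simp

lemma alternating_gaussWeightIntegralPartial (n : ℕ) {y : ℝ} (hy : 0 ≤ y) :
    0 ≤ (-1) ^ n * (lowerGauss y - √(2 * Real.pi) / 2 - gaussWeightIntegralPartial n y) := by
  have hd : ∀ y, HasDerivAt
      (fun y => (-1) ^ n * (lowerGauss y - √(2 * Real.pi) / 2 - gaussWeightIntegralPartial n y))
      ((-1) ^ n * (Real.exp (-(y ^ 2 / 2)) - expPartial n (y ^ 2 / 2))) y := fun y =>
    (((hasDerivAt_lowerGauss y).sub_const _).sub
      (hasDerivAt_gaussWeightIntegralPartial n y)).const_mul _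
  have hm := monotoneOn_of_hasDerivWithinAt_nonneg (convex_Ici (0 : ℝ))
    (fun t _ => (hd t).continuousAt.continuousWithinAt)
    (fun t _ => (hd t).hasDerivWithinAt)
    (fun t _ => alternating_expPartial n (by positivity))
  have h0y := hm Set.self_mem_Ici hy hy
  refine le_trans (le_of_eq ?_) h0y
  have : gaussWeightIntegralPartial n 0 = 0 := by simp [gaussWeightIntegralPartial]
  simp only [this, lowerGauss_eq_add_intervalIntegral 0]
  simp

lemma exp_neg_le_expPartial {u : ℝ} (hu : 0 ≤ u) : Real.exp (-u) ≤ expPartial 9 u := by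
  linarith [alternating_expPartial 9 hu]

lemma expPartial_le_exp_neg {u : ℝ} (hu : 0 ≤ u) : expPartial 10 u ≤ Real.exp (-u) := by
  linarith [alternating_expPartial 10 hu]

lemma exp_le_of_one_le_mul_expPartial {u c : ℝ} (hu : 0 ≤ u) (hc : 0 ≤ c)
    (h : 1 ≤ c * expPartial 10 u) : Real.exp u ≤ c := by
  have hmul : 1 ≤ c * Real.exp (-u) :=
    h.trans (mul_le_mul_of_nonneg_left (expPartial_le_exp_neg hu) hc)
  rwa [Real.exp_neg, ← div_eq_mul_inv, one_le_div (Real.exp_pos u)] at hmul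

lemma exp_mem_Icc_of_nonpos {x l h : ℝ} (hx : x ≤ 0) (hl : l ≤ expPartial 10 (-x))
    (hh : expPartial 9 (-x) ≤ h) : Real.exp x ∈ Set.Icc l h := by
  rw [← neg_neg x, Real.exp_neg (-x), ← Real.exp_neg]
  exact ⟨hl.trans (expPartial_le_exp_neg (by linarith)),
    (exp_neg_le_expPartial (by linarith)).trans hh⟩

lemma exp_mem_Icc_of_nonneg {x l h : ℝ} (hx : 0 ≤ x) (hl : l * expPartial 9 x ≤ 1) (hl0 : 0 ≤ l)
    (hh : 1 ≤ h * expPartial 10 x) (hh0 : 0 ≤ h) : Real.exp x ∈ Set.Icc l h := by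
  refine ⟨?_, exp_le_of_one_le_mul_expPartial hx hh0 hh⟩
  have hmul : l * Real.exp (-x) ≤ 1 :=
    (mul_le_mul_of_nonneg_left (exp_neg_le_expPartial hx) hl0).trans hl
  rwa [Real.exp_neg, ← div_eq_mul_inv, div_le_one (Real.exp_pos x)] at hmul

lemma lt_sqrt_two_mul_pi : 2.50662 < √(2 * Real.pi) :=
  Real.lt_sqrt_of_sq_lt (by linarith [Real.pi_gt_d6])

lemma sqrt_two_mul_pi_lt : √(2 * Real.pi) < 2.50663 := by
  rw [Real.sqrt_lt' (by norm_num)]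
  linarith [Real.pi_lt_d6]

lemma lowerGauss_mem_Icc_of_nonneg {y l h : ℝ} (hy : 0 ≤ y)
    (hl : l ≤ 1.25331 + gaussWeightIntegralPartial 10 y)
    (hh : 1.253315 + gaussWeightIntegralPartial 11 y ≤ h) : lowerGauss y ∈ Set.Icc l h := by
  constructor
  · linarith [alternating_gaussWeightIntegralPartial 10 hy, lt_sqrt_two_mul_pi]
  · linarith [alternating_gaussWeightIntegralPartial 11 hy, sqrt_two_mul_pi_lt]

lemma lowerGauss_mem_Icc_of_nonpos {y l h : ℝ} (hy : y ≤ 0)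
    (hl : l ≤ 1.25331 - gaussWeightIntegralPartial 11 (-y))
    (hh : 1.253315 - gaussWeightIntegralPartial 10 (-y) ≤ h) : lowerGauss y ∈ Set.Icc l h := by
  have hy' : 0 ≤ -y := neg_nonneg.2 hy
  rw [← neg_neg y, lowerGauss_neg, upperGauss_eq_sub]
  constructor
  · linarith [alternating_gaussWeightIntegralPartial 11 hy', lt_sqrt_two_mul_pi]
  · linarith [alternating_gaussWeightIntegralPartial 10 hy', sqrt_two_mul_pi_lt]

lemma odds_le_of_lowerGauss_mul_le {z r : ℝ} (hr : 0 ≤ r)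
    (h : lowerGauss z * (1 + r) ≤ r * 2.50662) : lowerGauss z / upperGauss z ≤ r := by
  rw [div_le_iff₀ (upperGauss_pos z), upperGauss_eq_sub]
  linarith [mul_le_mul_of_nonneg_left lt_sqrt_two_mul_pi.le hr]

lemma odds_le_of_nonneg {y r : ℝ} (hy : 0 ≤ y) (hr : 0 ≤ r)
    (h : (1.253315 + gaussWeightIntegralPartial 11 y) * (1 + r) ≤ r * 2.50662) :
    lowerGauss y / upperGauss y ≤ r :=
  odds_le_of_lowerGauss_mul_le hr ((mul_le_mul_of_nonneg_right
    (lowerGauss_mem_Icc_of_nonneg hy le_rfl le_rfl).2 (by linarith)).trans h)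

lemma odds_le_of_nonpos {y r : ℝ} (hy : y ≤ 0) (hr : 0 ≤ r)
    (h : (1.253315 - gaussWeightIntegralPartial 10 (-y)) * (1 + r) ≤ r * 2.50662) :
    lowerGauss y / upperGauss y ≤ r :=
  odds_le_of_lowerGauss_mul_le hr ((mul_le_mul_of_nonneg_right
    (lowerGauss_mem_Icc_of_nonpos hy le_rfl le_rfl).2 (by linarith)).trans h)

lemma odds_neg_five_fourths_le : lowerGauss (-(5 / 4)) / upperGauss (-(5 / 4)) ≤ 0.1184 :=
  odds_le_of_nonpos (by norm_num) (by norm_num)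
    (by norm_num [gaussWeightIntegralPartial, Finset.sum_range_succ, Nat.factorial])

lemma odds_neg_one_half_le : lowerGauss (-(1 / 2)) / upperGauss (-(1 / 2)) ≤ 0.4467 :=
  odds_le_of_nonpos (by norm_num) (by norm_num)
    (by norm_num [gaussWeightIntegralPartial, Finset.sum_range_succ, Nat.factorial])

lemma odds_zero_le : lowerGauss 0 / upperGauss 0 ≤ 1.0009 :=
  odds_le_of_nonneg (by norm_num) (by norm_num)
    (by norm_num [gaussWeightIntegralPartial, Finset.sum_range_succ, Nat.factorial])

lemma odds_nine_twentieths_le : lowerGauss (9 / 20) / upperGauss (9 / 20) ≤ 2.0659 :=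
  odds_le_of_nonneg (by norm_num) (by norm_num)
    (by norm_num [gaussWeightIntegralPartial, Finset.sum_range_succ, Nat.factorial])

lemma odds_nineteen_twentieths_le : lowerGauss (19 / 20) / upperGauss (19 / 20) ≤ 4.8501 :=
  odds_le_of_nonneg (by norm_num) (by norm_num)
    (by norm_num [gaussWeightIntegralPartial, Finset.sum_range_succ, Nat.factorial])

lemma odds_three_halves_le : lowerGauss (3 / 2) / upperGauss (3 / 2) ≤ 13.9798 :=
  odds_le_of_nonneg (by norm_num) (by norm_num)
    (by norm_num [gaussWeightIntegralPartial, Finset.sum_range_succ, Nat.factorial])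

/-- The tangent of the majorant at `m` is linear in `e = e^{m - 1/2}` and
`w = e^{m²/2} * lowerGauss (m - 1)`, so it suffices to check it on rational boxes for these. -/
lemma odds_le_oddsMajorantReal_of_tangent_on_box {u v m el eh fl fh pl ph ru rv : ℝ} (hpl : 0 ≤ pl)
    (he : Real.exp (m - 1 / 2) ∈ Set.Icc el eh)
    (hf : Real.exp (m ^ 2 / 2) ∈ Set.Icc fl fh)
    (hp : lowerGauss (m - 1) ∈ Set.Icc pl ph)
    (hu : lowerGauss u / upperGauss u ≤ ru) (hv : lowerGauss v / upperGauss v ≤ rv)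
    (htangent : ∀ e ∈ Set.Icc el eh, ∀ w ∈ Set.Icc (fl * pl) (fh * ph),
      ru ≤ e + (m + 5 / 4) * w + ((m + 9 / 4) * e + (1 + m ^ 2 + 5 / 4 * m) * w) * (u - m) ∧
      rv ≤ e + (m + 5 / 4) * w + ((m + 9 / 4) * e + (1 + m ^ 2 + 5 / 4 * m) * w) * (v - m))
    {z : ℝ} (hz : z ∈ Set.Icc u v) : lowerGauss z / upperGauss z ≤ oddsMajorantReal z := by
  obtain ⟨hu', hv'⟩ := htangent _ he (Real.exp (m ^ 2 / 2) * lowerGauss (m - 1))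
    ⟨mul_le_mul hf.1 hp.1 hpl (Real.exp_nonneg _),
      mul_le_mul hf.2 hp.2 (lowerGauss_pos _).le ((Real.exp_nonneg _).trans hf.2)⟩
  exact odds_le_oddsMajorantReal_of_tangent (hu.trans hu') (hv.trans hv') hz

lemma odds_le_oddsMajorantReal_of_mem_Icc_neg_five_fourths_neg_one_half {z : ℝ}
    (hz : z ∈ Set.Icc (-(5 / 4) : ℝ) (-(1 / 2))) :
    lowerGauss z / upperGauss z ≤ oddsMajorantReal z := by
  have he : Real.exp (-(17 / 20) - 1 / 2) ∈ Set.Icc 0.25904 0.25945 :=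
    exp_mem_Icc_of_nonpos (by norm_num)
      (by norm_num [expPartial, Finset.sum_range_succ, Nat.factorial])
      (by norm_num [expPartial, Finset.sum_range_succ, Nat.factorial])
  have hf : Real.exp ((-(17 / 20)) ^ 2 / 2) ∈ Set.Icc 1.43492 1.43533 :=
    exp_mem_Icc_of_nonneg (by norm_num)
      (by norm_num [expPartial, Finset.sum_range_succ, Nat.factorial]) (by norm_num)
      (by norm_num [expPartial, Finset.sum_range_succ, Nat.factorial]) (by norm_num)
  have hp : lowerGauss (-(17 / 20) - 1) ∈ Set.Icc 0.08058 0.08063 :=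
    lowerGauss_mem_Icc_of_nonpos (by norm_num)
      (by norm_num [gaussWeightIntegralPartial, Finset.sum_range_succ, Nat.factorial])
      (by norm_num [gaussWeightIntegralPartial, Finset.sum_range_succ, Nat.factorial])
  refine odds_le_oddsMajorantReal_of_tangent_on_box (by norm_num) he hf hp
    odds_neg_five_fourths_le odds_neg_one_half_le (fun e ⟨_, _⟩ w ⟨_, _⟩ => ?_) hz
  constructor <;> norm_num at * <;> linarith

lemma odds_le_oddsMajorantReal_of_mem_Icc_neg_one_half_zero {z : ℝ}
    (hz : z ∈ Set.Icc (-(1 / 2) : ℝ) 0) :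
    lowerGauss z / upperGauss z ≤ oddsMajorantReal z := by
  have he : Real.exp (-(1 / 4) - 1 / 2) ∈ Set.Icc 0.47216 0.47257 :=
    exp_mem_Icc_of_nonpos (by norm_num)
      (by norm_num [expPartial, Finset.sum_range_succ, Nat.factorial])
      (by norm_num [expPartial, Finset.sum_range_succ, Nat.factorial])
  have hf : Real.exp ((-(1 / 4)) ^ 2 / 2) ∈ Set.Icc 1.03154 1.03195 :=
    exp_mem_Icc_of_nonneg (by norm_num)
      (by norm_num [expPartial, Finset.sum_range_succ, Nat.factorial]) (by norm_num)
      (by norm_num [expPartial, Finset.sum_range_succ, Nat.factorial]) (by norm_num)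
  have hp : lowerGauss (-(1 / 4) - 1) ∈ Set.Icc 0.26480 0.26485 :=
    lowerGauss_mem_Icc_of_nonpos (by norm_num)
      (by norm_num [gaussWeightIntegralPartial, Finset.sum_range_succ, Nat.factorial])
      (by norm_num [gaussWeightIntegralPartial, Finset.sum_range_succ, Nat.factorial])
  refine odds_le_oddsMajorantReal_of_tangent_on_box (by norm_num) he hf hp
    odds_neg_one_half_le odds_zero_le (fun e ⟨_, _⟩ w ⟨_, _⟩ => ?_) hz
  constructor <;> norm_num at * <;> linarith

lemma odds_le_oddsMajorantReal_of_mem_Icc_zero_nine_twentieths {z : ℝ}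
    (hz : z ∈ Set.Icc (0 : ℝ) (9 / 20)) :
    lowerGauss z / upperGauss z ≤ oddsMajorantReal z := by
  have he : Real.exp (1 / 5 - 1 / 2) ∈ Set.Icc 0.74061 0.74102 :=
    exp_mem_Icc_of_nonpos (by norm_num)
      (by norm_num [expPartial, Finset.sum_range_succ, Nat.factorial])
      (by norm_num [expPartial, Finset.sum_range_succ, Nat.factorial])
  have hf : Real.exp ((1 / 5) ^ 2 / 2) ∈ Set.Icc 1.02000 1.02041 :=
    exp_mem_Icc_of_nonneg (by norm_num)
      (by norm_num [expPartial, Finset.sum_range_succ, Nat.factorial]) (by norm_num)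
      (by norm_num [expPartial, Finset.sum_range_succ, Nat.factorial]) (by norm_num)
  have hp : lowerGauss (1 / 5 - 1) ∈ Set.Icc 0.53102 0.53107 :=
    lowerGauss_mem_Icc_of_nonpos (by norm_num)
      (by norm_num [gaussWeightIntegralPartial, Finset.sum_range_succ, Nat.factorial])
      (by norm_num [gaussWeightIntegralPartial, Finset.sum_range_succ, Nat.factorial])
  refine odds_le_oddsMajorantReal_of_tangent_on_box (by norm_num) he hf hp
    odds_zero_le odds_nine_twentieths_le (fun e ⟨_, _⟩ w ⟨_, _⟩ => ?_) hz
  constructor <;> norm_num at * <;> linarith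

lemma odds_le_oddsMajorantReal_of_mem_Icc_nine_twentieths_nineteen_twentieths {z : ℝ}
    (hz : z ∈ Set.Icc (9 / 20 : ℝ) (19 / 20)) :
    lowerGauss z / upperGauss z ≤ oddsMajorantReal z := by
  have he : Real.exp (13 / 20 - 1 / 2) ∈ Set.Icc 1.16163 1.16204 :=
    exp_mem_Icc_of_nonneg (by norm_num)
      (by norm_num [expPartial, Finset.sum_range_succ, Nat.factorial]) (by norm_num)
      (by norm_num [expPartial, Finset.sum_range_succ, Nat.factorial]) (by norm_num)
  have hf : Real.exp ((13 / 20) ^ 2 / 2) ∈ Set.Icc 1.23502 1.23543 :=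
    exp_mem_Icc_of_nonneg (by norm_num)
      (by norm_num [expPartial, Finset.sum_range_succ, Nat.factorial]) (by norm_num)
      (by norm_num [expPartial, Finset.sum_range_succ, Nat.factorial]) (by norm_num)
  have hp : lowerGauss (13 / 20 - 1) ∈ Set.Icc 0.91031 0.91036 :=
    lowerGauss_mem_Icc_of_nonpos (by norm_num)
      (by norm_num [gaussWeightIntegralPartial, Finset.sum_range_succ, Nat.factorial])
      (by norm_num [gaussWeightIntegralPartial, Finset.sum_range_succ, Nat.factorial])
  refine odds_le_oddsMajorantReal_of_tangent_on_box (by norm_num) he hf hp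
    odds_nine_twentieths_le odds_nineteen_twentieths_le (fun e ⟨_, _⟩ w ⟨_, _⟩ => ?_) hz
  constructor <;> norm_num at * <;> linarith

lemma odds_le_oddsMajorantReal_of_mem_Icc_nineteen_twentieths_three_halves {z : ℝ}
    (hz : z ∈ Set.Icc (19 / 20 : ℝ) (3 / 2)) :
    lowerGauss z / upperGauss z ≤ oddsMajorantReal z := by
  have he : Real.exp (23 / 20 - 1 / 2) ∈ Set.Icc 1.91534 1.91575 :=
    exp_mem_Icc_of_nonneg (by norm_num)
      (by norm_num [expPartial, Finset.sum_range_succ, Nat.factorial]) (by norm_num)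
      (by norm_num [expPartial, Finset.sum_range_succ, Nat.factorial]) (by norm_num)
  have hf : Real.exp ((23 / 20) ^ 2 / 2) ∈ Set.Icc 1.93701 1.93742 :=
    exp_mem_Icc_of_nonneg (by norm_num)
      (by norm_num [expPartial, Finset.sum_range_succ, Nat.factorial]) (by norm_num)
      (by norm_num [expPartial, Finset.sum_range_succ, Nat.factorial]) (by norm_num)
  have hp : lowerGauss (23 / 20 - 1) ∈ Set.Icc 1.40273 1.40278 :=
    lowerGauss_mem_Icc_of_nonneg (by norm_num)
      (by norm_num [gaussWeightIntegralPartial, Finset.sum_range_succ, Nat.factorial])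
      (by norm_num [gaussWeightIntegralPartial, Finset.sum_range_succ, Nat.factorial])
  refine odds_le_oddsMajorantReal_of_tangent_on_box (by norm_num) he hf hp
    odds_nineteen_twentieths_le odds_three_halves_le (fun e ⟨_, _⟩ w ⟨_, _⟩ => ?_) hz
  constructor <;> norm_num at * <;> linarith

lemma gaussWeight_mul_exp_sq_div_two (z : ℝ) : gaussWeight z * Real.exp (z ^ 2 / 2) = 1 := by
  rw [gaussWeight, ← Real.exp_add, neg_add_cancel, Real.exp_zero]

lemma exp_sq_div_two_mul_gaussWeight_sub_one (z : ℝ) :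
    Real.exp (z ^ 2 / 2) * gaussWeight (z - 1) = Real.exp (z - 1 / 2) := by
  rw [gaussWeight, ← Real.exp_add]
  congr 1
  ring

lemma mul_exp_le_oddsMajorantReal {z : ℝ} (hz : z ≤ -(5 / 4)) :
    Real.exp (z - 1 / 2) * (9 / 4 / (1 - z)) ≤ oddsMajorantReal z := by
  have hz1 : 0 < 1 - z := by linarith
  have hmills : lowerGauss (z - 1) ≤ gaussWeight (z - 1) / (1 - z) := by
    rw [le_div_iff₀ hz1, mul_comm, ← neg_sub 1 z, lowerGauss_neg, gaussWeight_neg]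
    exact mul_upperGauss_le _
  have hbound : Real.exp (z ^ 2 / 2) * lowerGauss (z - 1) ≤ Real.exp (z - 1 / 2) / (1 - z) := by
    rw [← exp_sq_div_two_mul_gaussWeight_sub_one, mul_div_assoc]
    gcongr
  calc Real.exp (z - 1 / 2) * (9 / 4 / (1 - z))
      = Real.exp (z - 1 / 2) + (z + 5 / 4) * (Real.exp (z - 1 / 2) / (1 - z)) := by
        field_simp
        ring
    _ ≤ oddsMajorantReal z :=
        add_le_add_right (mul_le_mul_of_nonpos_left hbound (by linarith)) _

lemma odds_le_oddsMajorantReal_of_le_neg_five_fourths {z : ℝ} (hz : z ≤ -(5 / 4)) :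
    lowerGauss z / upperGauss z ≤ oddsMajorantReal z := by
  have hz0 : 0 < -z := by linarith
  have hupper : 2.2 ≤ upperGauss z := by
    rw [← lowerGauss_neg]
    refine (lowerGauss_mem_Icc_of_nonneg (y := 5 / 4) (l := 2.2) (by norm_num)
      (by norm_num [gaussWeightIntegralPartial, Finset.sum_range_succ, Nat.factorial])
      le_rfl).1.trans ?_
    exact monotone_of_hasDerivAt_nonneg hasDerivAt_lowerGauss (fun t => (gaussWeight_pos t).le)
      (by linarith)
  have hlower : lowerGauss z ≤ gaussWeight z / -z := by
    rw [le_div_iff₀ hz0, mul_comm, ← gaussWeight_neg, ← neg_neg z, lowerGauss_neg, neg_neg]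
    exact mul_upperGauss_le _
  have hweight : gaussWeight z ≤ 2.7183 * Real.exp (z - 1 / 2) := by
    calc gaussWeight z ≤ Real.exp 1 * Real.exp (z - 1 / 2) := by
          rw [gaussWeight, ← Real.exp_add]
          exact Real.exp_le_exp.2 (by linarith [sq_nonneg (z + 1)])
      _ ≤ 2.7183 * Real.exp (z - 1 / 2) := by
          gcongr
          exact Real.exp_one_lt_d9.le.trans (by norm_num)
  calc lowerGauss z / upperGauss z ≤ (2.7183 * Real.exp (z - 1 / 2) / -z) / 2.2 :=
        div_le_div₀ (by positivity) (hlower.trans (by gcongr)) (by norm_num) hupper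
    _ = Real.exp (z - 1 / 2) * (2.7183 / (2.2 * -z)) := by field_simp
    _ ≤ Real.exp (z - 1 / 2) * (9 / 4 / (1 - z)) := by
        refine mul_le_mul_of_nonneg_left ?_ (Real.exp_nonneg _)
        rw [div_div, div_le_div_iff₀ (by positivity) (by linarith)]
        linarith
    _ ≤ oddsMajorantReal z := mul_exp_le_oddsMajorantReal hz

lemma exp_mul_le_oddsMajorantReal {z : ℝ} (hz : 3 / 2 ≤ z) :
    Real.exp (z ^ 2 / 2) * (√(2 * Real.pi) * (z + 1 / 2)) ≤ oddsMajorantReal z := by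
  have hhead : 1.7 ≤ lowerGauss (1 / 2) := (lowerGauss_mem_Icc_of_nonneg (by norm_num)
    (by norm_num [gaussWeightIntegralPartial, Finset.sum_range_succ, Nat.factorial]) le_rfl).1
  have htail : upperGauss (z - 1) ≤ √(2 * Real.pi) - 1.7 :=
    (upperGauss_antitone (by linarith : (1 : ℝ) / 2 ≤ z - 1)).trans
      (by linarith [upperGauss_eq_sub (1 / 2)])
  have hbracket : √(2 * Real.pi) * (z + 1 / 2)
      ≤ gaussWeight (z - 1) + (z + 5 / 4) * lowerGauss (z - 1) := by
    linarith [mul_upperGauss_le (z - 1), lowerGauss_add_upperGauss (z - 1), sqrt_two_mul_pi_lt,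
      congrArg (fun t => (z + 5 / 4) * t) (lowerGauss_add_upperGauss (z - 1))]
  refine (mul_le_mul_of_nonneg_left hbracket (Real.exp_nonneg _)).trans_eq ?_
  rw [mul_add, exp_sq_div_two_mul_gaussWeight_sub_one, oddsMajorantReal]
  ring

lemma odds_le_oddsMajorantReal_of_three_halves_le {z : ℝ} (hz : 3 / 2 ≤ z) :
    lowerGauss z / upperGauss z ≤ oddsMajorantReal z := by
  have hz0 : 0 < z := by linarith
  refine le_trans ?_ (exp_mul_le_oddsMajorantReal hz)
  rw [div_le_iff₀ (upperGauss_pos z)]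
  have hrational : 1 ≤ (z ^ 3 + 5 * z) / (z ^ 4 + 6 * z ^ 2 + 3) * (z + 1 / 2) := by
    rw [div_mul_eq_mul_div, le_div_iff₀ (by positivity)]
    nlinarith [mul_nonneg (sub_nonneg.2 hz) (sq_nonneg (z - 1)),
      mul_nonneg (sub_nonneg.2 hz) hz0.le]
  calc lowerGauss z ≤ √(2 * Real.pi) * 1 := by
        linarith [lowerGauss_add_upperGauss z, upperGauss_pos z]
    _ ≤ √(2 * Real.pi) * ((z ^ 3 + 5 * z) / (z ^ 4 + 6 * z ^ 2 + 3) * (z + 1 / 2)) := by gcongr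
    _ = Real.exp (z ^ 2 / 2) * (√(2 * Real.pi) * (z + 1 / 2))
          * (gaussWeight z * ((z ^ 3 + 5 * z) / (z ^ 4 + 6 * z ^ 2 + 3))) := by
        linear_combination (-(√(2 * Real.pi) * ((z ^ 3 + 5 * z) / (z ^ 4 + 6 * z ^ 2 + 3)
          * (z + 1 / 2)))) * gaussWeight_mul_exp_sq_div_two z
    _ ≤ Real.exp (z ^ 2 / 2) * (√(2 * Real.pi) * (z + 1 / 2)) * upperGauss z := by
        gcongr
        exact le_upperGauss hz0

lemma odds_le_oddsMajorantReal (z : ℝ) : lowerGauss z / upperGauss z ≤ oddsMajorantReal z := by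
  rcases le_total z (-(5 / 4)) with h | h
  · exact odds_le_oddsMajorantReal_of_le_neg_five_fourths h
  rcases le_total z (-(1 / 2)) with h1 | h1
  · exact odds_le_oddsMajorantReal_of_mem_Icc_neg_five_fourths_neg_one_half ⟨h, h1⟩
  rcases le_total z 0 with h2 | h2
  · exact odds_le_oddsMajorantReal_of_mem_Icc_neg_one_half_zero ⟨h1, h2⟩
  rcases le_total z (9 / 20) with h3 | h3
  · exact odds_le_oddsMajorantReal_of_mem_Icc_zero_nine_twentieths ⟨h2, h3⟩
  rcases le_total z (19 / 20) with h4 | h4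
  · exact odds_le_oddsMajorantReal_of_mem_Icc_nine_twentieths_nineteen_twentieths ⟨h3, h4⟩
  rcases le_total z (3 / 2) with h5 | h5
  · exact odds_le_oddsMajorantReal_of_mem_Icc_nineteen_twentieths_three_halves ⟨h4, h5⟩
  exact odds_le_oddsMajorantReal_of_three_halves_le h5

lemma gaussOdds_le_oddsMajorant (z : ℝ) : gaussOdds z ≤ oddsMajorant z := by
  rw [gaussOdds_eq_ofReal, oddsMajorant_eq_ofReal]
  exact ENNReal.ofReal_le_ofReal (odds_le_oddsMajorantReal z)

end Numerics

section Deterministic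

variable {K : ℕ} {Θ : Type*} {μ : Fin K → Θ → ℝ} {α σ : ℝ} {τ : ℕ → Finset (Fin K) → Fin K}
  {I : ℕ → (Fin K → ℕ) → (Fin K → ℝ) → Fin K → EReal} {x : Fin K → ℕ → ℝ}

/-- The arm pulled in round `t + 1` along the trajectory of the algorithm. -/
noncomputable def armAt (μ : Fin K → Θ → ℝ) (α σ : ℝ) (τ : ℕ → Finset (Fin K) → Fin K)
    (I : ℕ → (Fin K → ℕ) → (Fin K → ℝ) → Fin K → EReal) (x : Fin K → ℕ → ℝ) (t : ℕ) : Fin K :=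
  nextArm μ α σ τ I x t (pulls μ α σ τ I x t)

lemma pulls_succ (t : ℕ) (k : Fin K) :
    pulls μ α σ τ I x (t + 1) k
      = pulls μ α σ τ I x t k + if armAt μ α σ τ I x t = k then 1 else 0 := rfl

lemma pulls_eq_sum (T : ℕ) (k : Fin K) :
    pulls μ α σ τ I x T k = ∑ t ∈ Finset.range T, if armAt μ α σ τ I x t = k then 1 else 0 := by
  induction T with
  | zero => rfl
  | succ T ih => rw [pulls_succ, Finset.sum_range_succ, ih]

lemma pulls_le (t : ℕ) (k : Fin K) : pulls μ α σ τ I x t k ≤ t := by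
  rw [pulls_eq_sum]
  calc ∑ i ∈ Finset.range t, (if armAt μ α σ τ I x i = k then 1 else 0)
      ≤ ∑ _i ∈ Finset.range t, 1 := Finset.sum_le_sum fun i _ => by split_ifs <;> simp
    _ = t := by simp

-- The pull counts of an arm at the rounds in which it is pulled are `0, 1, 2, …`.
lemma sum_ite_armAt_eq_sum_range {M : Type*} [AddCommMonoid M] (f : ℕ → M) (T : ℕ) (k : Fin K) :
    ∑ t ∈ Finset.range T,
        (if armAt μ α σ τ I x t = k then f (pulls μ α σ τ I x t k) else 0)
      = ∑ n ∈ Finset.range (pulls μ α σ τ I x T k), f n := by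
  induction T with
  | zero => rfl
  | succ T ih =>
    rw [Finset.sum_range_succ, ih, pulls_succ]
    split_ifs with h
    · rw [Finset.sum_range_succ]
    · simp

lemma competitiveSet_nonempty (t : ℕ) (n : Fin K → ℕ) (m : Fin K → ℝ) (k₀ : Fin K) :
    (competitiveSet μ α σ t n m).Nonempty := by
  classical
  unfold competitiveSet
  split_ifs with h
  · exact ⟨k₀, Finset.mem_univ _⟩
  · obtain ⟨θ, hθ⟩ := Set.nonempty_iff_ne_empty.2 h
    obtain ⟨l, -, hl⟩ :=
      Finset.exists_max_image Finset.univ (fun l => μ l θ) ⟨k₀, Finset.mem_univ _⟩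
    exact ⟨l, by simpa using ⟨θ, hθ, fun j => hl j (Finset.mem_univ _)⟩⟩

lemma mem_argmaxOn {C : Finset (Fin K)} {J : Fin K → EReal} {k : Fin K} :
    k ∈ argmaxOn C J ↔ k ∈ C ∧ ∀ l ∈ C, J l ≤ J k := by
  simp [argmaxOn]

lemma argmaxOn_nonempty {C : Finset (Fin K)} (hC : C.Nonempty) (J : Fin K → EReal) :
    (argmaxOn C J).Nonempty := by
  obtain ⟨l, hl, h⟩ := Finset.exists_max_image C J hC
  exact ⟨l, mem_argmaxOn.2 ⟨hl, h⟩⟩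

lemma nextArm_mem (hτ : IsTieBreaking τ) (k₀ : Fin K) (t : ℕ) (n : Fin K → ℕ) :
    nextArm μ α σ τ I x t n ∈
      argmaxOn (competitiveSet μ α σ t n (empMean x n)) (I t n (empMean x n)) :=
  hτ _ _ (argmaxOn_nonempty (competitiveSet_nonempty _ _ _ k₀) _)

lemma mem_competitiveSet_of_mem_confSet {θ : Θ} {l : Fin K} {t : ℕ} {n : Fin K → ℕ}
    {m : Fin K → ℝ} (hθ : θ ∈ confSet μ α σ t n m) (hl : IsBestAt μ l θ) :
    l ∈ competitiveSet μ α σ t n m := by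
  classical
  have : confSet μ α σ t n m ≠ ∅ := Set.nonempty_iff_ne_empty.1 ⟨θ, hθ⟩
  simp only [competitiveSet, this, if_false, Finset.mem_filter, Finset.mem_univ, true_and]
  exact ⟨θ, hθ, hl⟩

lemma abs_sub_lt_of_mem_confSet {θ : Θ} {l : Fin K} {t : ℕ} {n : Fin K → ℕ}
    {m : Fin K → ℝ} (hθ : θ ∈ confSet μ α σ t n m) (hl : n l ≠ 0) :
    |μ l θ - m l| < √(2 * α * σ ^ 2 * Real.log t / n l) := by
  have := hθ l
  simp only [confRadius, hl, if_false] at this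
  exact_mod_cast this

lemma ucbIndex_of_ne_zero {t : ℕ} {n : Fin K → ℕ} {m : Fin K → ℝ} {l : Fin K} (hl : n l ≠ 0) :
    ucbIndex α σ t n m l
      = ((m l + √(2 * α * σ ^ 2 * Real.log t / n l) : ℝ) : EReal) := by
  simp [ucbIndex, confRadius, hl]

lemma ucbIndex_of_eq_zero {t : ℕ} {n : Fin K → ℕ} {m : Fin K → ℝ} {l : Fin K} (hl : n l = 0) :
    ucbIndex α σ t n m l = ⊤ := by
  simp [ucbIndex, confRadius, hl]

lemma gap_lt_two_mul_sqrt_of_ucbIndex_le {θ : Θ} {ks k : Fin K} {t : ℕ} {n : Fin K → ℕ}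
    {m : Fin K → ℝ} (hθ : θ ∈ confSet μ α σ t n m) (hn : n k ≠ 0)
    (hle : ucbIndex α σ t n m ks ≤ ucbIndex α σ t n m k) :
    gap μ θ ks k < 2 * √(2 * α * σ ^ 2 * Real.log t / n k) := by
  rw [ucbIndex_of_ne_zero hn] at hle
  have hs : n ks ≠ 0 := fun hs => by
    rw [ucbIndex_of_eq_zero hs, top_le_iff] at hle
    exact EReal.coe_ne_top _ hle
  rw [ucbIndex_of_ne_zero hs, EReal.coe_le_coe_iff] at hle
  have hk_low := (abs_lt.1 (abs_sub_lt_of_mem_confSet hθ hn)).1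
  have hs_high := (abs_lt.1 (abs_sub_lt_of_mem_confSet hθ hs)).2
  unfold gap
  linarith

lemma lt_four_mul_div_sq_of_lt_two_mul_sqrt {d c n : ℝ} (hd : 0 < d) (hn : 0 < n)
    (h : d < 2 * √(c / n)) : n < 4 * c / d ^ 2 := by
  have hpos : 0 < c / n := Real.sqrt_pos.1 (by linarith)
  have hsq : d ^ 2 < 4 * (c / n) := by
    nlinarith [Real.sq_sqrt hpos.le]
  rw [lt_div_iff₀ (by positivity)]
  calc n * d ^ 2 < n * (4 * (c / n)) := by gcongr
    _ = 4 * c := by field_simp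

lemma lt_of_nextArm_ucbIndex (hτ : IsTieBreaking τ) {θ : Θ} {ks k : Fin K}
    (hks : IsBestAt μ ks θ) (hgap : 0 < gap μ θ ks k) {t : ℕ} {n : Fin K → ℕ}
    (hθ : θ ∈ confSet μ α σ t n (empMean x n))
    (hk : nextArm μ α σ τ (ucbIndex α σ) x t n = k) (hn : n k ≠ 0) :
    (n k : ℝ) < 8 * α * σ ^ 2 * Real.log t / gap μ θ ks k ^ 2 := by
  have hmem := nextArm_mem (μ := μ) (α := α) (σ := σ) (I := ucbIndex α σ) (x := x) hτ ks t n
  rw [hk, mem_argmaxOn] at hmem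
  have hle := hmem.2 ks (mem_competitiveSet_of_mem_confSet hθ hks)
  calc (n k : ℝ) < 4 * (2 * α * σ ^ 2 * Real.log t) / gap μ θ ks k ^ 2 :=
        lt_four_mul_div_sq_of_lt_two_mul_sqrt hgap (by exact_mod_cast Nat.pos_of_ne_zero hn)
          (gap_lt_two_mul_sqrt_of_ucbIndex_le hθ hn hle)
    _ = 8 * α * σ ^ 2 * Real.log t / gap μ θ ks k ^ 2 := by ring

end Deterministic

section Measurability

variable {K : ℕ} {Θ : Type*} {μ : Fin K → Θ → ℝ} {α σ : ℝ} {τ : ℕ → Finset (Fin K) → Fin K}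

lemma isOpen_mem_confSet (θ : Θ) (t : ℕ) (n : Fin K → ℕ) :
    IsOpen {m : Fin K → ℝ | θ ∈ confSet μ α σ t n m} := by
  have : {m : Fin K → ℝ | θ ∈ confSet μ α σ t n m}
      = ⋂ l, {m : Fin K → ℝ | ((|μ l θ - m l| : ℝ) : EReal) < confRadius α σ t (n l)} := by
    ext m; simp [confSet]
  rw [this]
  refine isOpen_iInter_of_finite fun l => isOpen_lt ?_ continuous_const
  exact continuous_coe_real_ereal.comp (by fun_prop)

lemma measurable_exists_confSet (p : Θ → Prop) (t : ℕ) (n : Fin K → ℕ) :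
    Measurable fun m : Fin K → ℝ => ∃ θ ∈ confSet μ α σ t n m, p θ := by
  rw [← measurableSet_setOfPred]
  have : {m : Fin K → ℝ | ∃ θ ∈ confSet μ α σ t n m, p θ}
      = ⋃ θ ∈ {θ | p θ}, {m : Fin K → ℝ | θ ∈ confSet μ α σ t n m} := by
    ext m; simp [and_comm]
  rw [this]
  exact (isOpen_biUnion fun θ _ => isOpen_mem_confSet θ t n).measurableSet

lemma measurable_mem_competitiveSet (t : ℕ) (n : Fin K → ℕ) (l : Fin K) :
    Measurable fun m : Fin K → ℝ => l ∈ competitiveSet μ α σ t n m := by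
  have : (fun m : Fin K → ℝ => l ∈ competitiveSet μ α σ t n m)
      = fun m => (∃ θ ∈ confSet μ α σ t n m, True) → ∃ θ ∈ confSet μ α σ t n m, IsBestAt μ l θ := by
    classical
    ext m
    unfold competitiveSet
    split_ifs with h
    · simp [h]
    · have : ∃ θ, θ ∈ confSet μ α σ t n m := Set.nonempty_iff_ne_empty.2 h
      simp [this]
  rw [this]
  exact (measurable_exists_confSet _ t n).imp (measurable_exists_confSet _ t n)

variable {S : Type*} [MeasurableSpace S] {x : S → Fin K → ℕ → ℝ}
  {I : S → ℕ → (Fin K → ℕ) → (Fin K → ℝ) → Fin K → EReal}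

lemma measurable_empMean (hx : ∀ l m, Measurable fun s => x s l m) (n : Fin K → ℕ) :
    Measurable fun s => empMean (x s) n := by
  refine measurable_pi_lambda _ fun l => ?_
  unfold empMean
  exact (Finset.measurable_sum _ fun m _ => hx l m).div_const _

lemma measurable_nextArm (hx : ∀ l m, Measurable fun s => x s l m)
    (hI : ∀ t n l, Measurable fun p : S × (Fin K → ℝ) => I p.1 t n p.2 l)
    (t : ℕ) (n : Fin K → ℕ) :
    Measurable fun s => nextArm μ α σ τ (I s) (x s) t n := by
  classical
  refine measurable_to_countable' fun k => ?_
  set A : S → Finset (Fin K) := fun s =>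
    argmaxOn (competitiveSet μ α σ t n (empMean (x s) n)) (I s t n (empMean (x s) n)) with hA
  have hm := measurable_empMean hx n
  have hC : ∀ l, Measurable fun s => l ∈ competitiveSet μ α σ t n (empMean (x s) n) :=
    fun l => (measurable_mem_competitiveSet t n l).comp hm
  have hJ : ∀ l, Measurable fun s => I s t n (empMean (x s) n) l :=
    fun l => (hI t n l).comp (measurable_id.prodMk hm)
  have hmem : ∀ l, Measurable fun s => l ∈ A s := fun l => by
    simp only [hA, mem_argmaxOn]
    refine (hC l).and (Measurable.forall fun j => (hC j).imp ?_)
    exact measurableSet_setOfPred.1 (measurableSet_le (hJ j) (hJ l))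
  have hset : ∀ B : Finset (Fin K), MeasurableSet {s | A s = B} := fun B => by
    simp only [Finset.ext_iff]
    exact measurableSet_setOfPred.2 (Measurable.forall fun l => (hmem l).iff measurable_const)
  have : (fun s => nextArm μ α σ τ (I s) (x s) t n) ⁻¹' {k}
      = ⋃ B ∈ {B : Finset (Fin K) | τ t B = k}, {s | A s = B} := by
    ext s; simp [nextArm, hA]
  rw [this]
  exact MeasurableSet.biUnion (Set.to_countable _) fun B _ => hset B

lemma measurable_nextArm_comp (hx : ∀ l m, Measurable fun s => x s l m)
    (hI : ∀ t n l, Measurable fun p : S × (Fin K → ℝ) => I p.1 t n p.2 l) (t : ℕ)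
    {N : S → Fin K → ℕ} (h : Measurable N) :
    Measurable fun s => nextArm μ α σ τ (I s) (x s) t (N s) :=
  Measurable.comp (g := fun p : S × (Fin K → ℕ) => nextArm μ α σ τ (I p.1) (x p.1) t p.2)
    (f := fun s => (s, N s)) (measurable_from_prod_countable_left fun n =>
      measurable_nextArm hx hI t n) (measurable_id.prodMk h)

lemma measurable_pulls (hx : ∀ l m, Measurable fun s => x s l m)
    (hI : ∀ t n l, Measurable fun p : S × (Fin K → ℝ) => I p.1 t n p.2 l) (t : ℕ) :
    Measurable fun s => pulls μ α σ τ (I s) (x s) t := by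
  induction t with
  | zero => exact measurable_const
  | succ t ih =>
    have harm : Measurable fun s => armAt μ α σ τ (I s) (x s) t :=
      measurable_nextArm_comp hx hI t ih
    refine measurable_pi_lambda _ fun k => ?_
    simp only [pulls_succ]
    refine Measurable.add (measurable_pi_iff.1 ih k) ?_
    exact Measurable.ite (harm (measurableSet_singleton k)) measurable_const measurable_const

lemma measurable_ucbIndex (t : ℕ) (n : Fin K → ℕ) (l : Fin K) :
    Measurable fun p : S × (Fin K → ℝ) => ucbIndex α σ t n p.2 l := by
  unfold ucbIndex
  exact (measurable_coe_real_ereal.comp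
    ((measurable_pi_apply l).comp measurable_snd)).add measurable_const

lemma measurable_tsSample {β : ℝ} {g : S → ℕ → Fin K → ℝ}
    (hg : ∀ t l, Measurable fun s => g s t l) (t : ℕ) (n : Fin K → ℕ) (l : Fin K) :
    Measurable fun p : S × (Fin K → ℝ) => tsSample β σ (g p.1) t n p.2 l := by
  unfold tsSample
  split_ifs
  · exact measurable_const
  · exact measurable_coe_real_ereal.comp (((measurable_pi_apply l).comp measurable_snd).add
      (((hg t l).comp measurable_fst).const_mul _))

end Measurability

section Independence

variable {Ω : Type*} [MeasurableSpace Ω] {P : Measure Ω}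

lemma indepFun_prodMk_left [IsProbabilityMeasure P] {A B C : Type*} [MeasurableSpace A]
    [MeasurableSpace B] [MeasurableSpace C] {f : Ω → A} {g : Ω → B} {h : Ω → C} (hf : Measurable f)
    (hg : Measurable g) (hh : Measurable h) (hfgh : IndepFun f (fun ω => (g ω, h ω)) P)
    (hgh : IndepFun g h P) : IndepFun (fun ω => (f ω, g ω)) h P := by
  have hfg : IndepFun f g P := hfgh.comp (φ := id) (ψ := Prod.fst) measurable_id measurable_fst
  have := Measure.isProbabilityMeasure_map (μ := P) hf.aemeasurable
  have := Measure.isProbabilityMeasure_map (μ := P) hg.aemeasurable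
  have := Measure.isProbabilityMeasure_map (μ := P) hh.aemeasurable
  rw [indepFun_iff_map_prod_eq_prod_map_map (hf.prodMk hg).aemeasurable hh.aemeasurable]
  rw [indepFun_iff_map_prod_eq_prod_map_map hf.aemeasurable hg.aemeasurable] at hfg
  rw [indepFun_iff_map_prod_eq_prod_map_map hg.aemeasurable hh.aemeasurable] at hgh
  rw [indepFun_iff_map_prod_eq_prod_map_map hf.aemeasurable (hg.prodMk hh).aemeasurable,
    hgh] at hfgh
  rw [hfg]
  apply MeasurableEquiv.prodAssoc.map_measurableEquiv_injective
  rw [Measure.prodAssoc_prod, ← hfgh, Measure.map_map MeasurableEquiv.prodAssoc.measurable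
    ((hf.prodMk hg).prodMk hh)]
  rfl

variable {K : ℕ} {Θ : Type*} {μ : Fin K → Θ → ℝ} {α β σ : ℝ} {τ : ℕ → Finset (Fin K) → Fin K}

lemma tscPulls_congr {x : Fin K → ℕ → ℝ} {g g' : ℕ → Fin K → ℝ} {t : ℕ}
    (h : ∀ s < t, g s = g' s) :
    tscPulls μ α β σ τ x g t = tscPulls μ α β σ τ x g' t := by
  induction t with
  | zero => rfl
  | succ t ih =>
    have ih' := ih fun s hs => h s (hs.trans (Nat.lt_succ_self t))
    have ht := h t (Nat.lt_succ_self t)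
    funext k
    unfold tscPulls at ih' ⊢
    simp only [pulls_succ, armAt, ih']
    have : nextArm μ α σ τ (tsSample β σ g) x t (pulls μ α σ τ (tsSample β σ g') x t)
        = nextArm μ α σ τ (tsSample β σ g') x t (pulls μ α σ τ (tsSample β σ g') x t) := by
      unfold nextArm
      congr 2
      funext l
      simp only [tsSample, ht]
    rw [this]
    congr

lemma measurable_tscPulls {S : Type*} [MeasurableSpace S] {x : S → Fin K → ℕ → ℝ}
    {g : S → ℕ → Fin K → ℝ} (hx : ∀ l m, Measurable fun s => x s l m)
    (hg : ∀ t l, Measurable fun s => g s t l) (t : ℕ) :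
    Measurable fun s => tscPulls μ α β σ τ (x s) (g s) t :=
  measurable_pulls hx (measurable_tsSample hg) t

variable {ν : Fin K → Measure ℝ} {X : Fin K → ℕ → Ω → ℝ} {G : ℕ → Fin K → Ω → ℝ}

/-- What TS-C has seen when it draws the samples of round `t + 1`: the table of rewards, including
those not yet collected, and the pull counts of the first `t` rounds. -/
noncomputable def tsHistory (μ : Fin K → Θ → ℝ) (α β σ : ℝ) (τ : ℕ → Finset (Fin K) → Fin K)
    (X : Fin K → ℕ → Ω → ℝ) (G : ℕ → Fin K → Ω → ℝ) (t : ℕ) (ω : Ω) :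
    (Fin K → ℕ → ℝ) × (Fin K → ℕ) :=
  (fun l m => X l m ω, tscPulls μ α β σ τ (fun l m => X l m ω) (fun s l => G s l ω) t)

lemma measurable_tsHistory (hX : IsRewardTable P ν X) (hG : IsSamplingNoise P X G) (t : ℕ) :
    Measurable (tsHistory μ α β σ τ X G t) :=
  (measurable_pi_lambda _ fun l => measurable_pi_lambda _ fun m => hX.measurable l m).prodMk
    (measurable_tscPulls hX.measurable hG.measurable t)

variable [IsProbabilityMeasure P]

lemma indepFun_past_noise (hX : IsRewardTable P ν X) (hG : IsSamplingNoise P X G) (t : ℕ) :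
    IndepFun (fun ω => ((fun p : Fin K × ℕ => X p.1 p.2 ω), fun (s : Fin t) l => G s l ω))
      (fun ω l => G t l ω) P := by
  classical
  have hpast : Measurable fun ω (s : Fin t) l => G s l ω :=
    measurable_pi_lambda _ fun s => measurable_pi_lambda _ fun l => hG.measurable s l
  have hnow : Measurable fun ω l => G t l ω := measurable_pi_lambda _ fun l => hG.measurable t l
  have hrew : Measurable fun ω (p : Fin K × ℕ) => X p.1 p.2 ω :=
    measurable_pi_lambda _ fun p => hX.measurable p.1 p.2
  have hpast_now : IndepFun (fun ω (s : Fin t) l => G s l ω) (fun ω l => G t l ω) P := by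
    let A : Finset (ℕ × Fin K) := Finset.range t ×ˢ Finset.univ
    let B : Finset (ℕ × Fin K) := {t} ×ˢ Finset.univ
    have hAB : Disjoint A B := by
      refine Finset.disjoint_left.2 fun q hqA hqB => ?_
      simp only [A, B, Finset.mem_product, Finset.mem_range, Finset.mem_singleton] at hqA hqB
      omega
    refine (hG.indep.indepFun_finset A B hAB fun q => hG.measurable q.1 q.2).comp
      (φ := fun (p : A → ℝ) (s : Fin t) l => p ⟨(s, l), by simp [A]⟩)
      (ψ := fun (p : B → ℝ) l => p ⟨(t, l), by simp [B]⟩) ?_ ?_ <;> fun_prop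
  refine indepFun_prodMk_left hrew hpast hnow ?_ hpast_now
  exact hG.indep_rewards.comp (φ := id)
    (ψ := fun g : ℕ × Fin K → ℝ => ((fun (s : Fin t) l => g (s, l)), fun l => g (t, l)))
    measurable_id (by fun_prop)

lemma indepFun_tsHistory_noise (hX : IsRewardTable P ν X) (hG : IsSamplingNoise P X G) (t : ℕ) :
    IndepFun (tsHistory μ α β σ τ X G t) (fun ω l => G t l ω) P := by
  let E : (Fin t → Fin K → ℝ) → ℕ → Fin K → ℝ := fun p s l => if h : s < t then p ⟨s, h⟩ l else 0
  let φ : (Fin K × ℕ → ℝ) × (Fin t → Fin K → ℝ) → (Fin K → ℕ → ℝ) × (Fin K → ℕ) := fun q =>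
    (fun l m => q.1 (l, m), tscPulls μ α β σ τ (fun l m => q.1 (l, m)) (E q.2) t)
  have hE : ∀ s l, Measurable fun q : (Fin K × ℕ → ℝ) × (Fin t → Fin K → ℝ) => E q.2 s l :=
    fun s l => by
      simp only [E]
      split_ifs <;> fun_prop
  have hφ : Measurable φ :=
    Measurable.prodMk (by fun_prop) (measurable_tscPulls (by fun_prop) hE t)
  have hfactor : tsHistory μ α β σ τ X G t
      = φ ∘ fun ω => ((fun p : Fin K × ℕ => X p.1 p.2 ω), fun (s : Fin t) l => G s l ω) := by
    funext ω
    simp only [tsHistory, φ, Function.comp_apply, Prod.mk.injEq, true_and]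
    exact tscPulls_congr fun s hs => by funext l; simp [E, hs]
  rw [hfactor]
  exact (indepFun_past_noise hX hG t).comp hφ measurable_id

/-- The law of the noise of one round. -/
noncomputable abbrev noiseLaw (K : ℕ) : Measure (Fin K → ℝ) := Measure.pi fun _ => gaussianReal 0 1

lemma noiseLaw_setOf_mem (l : Fin K) {A : Set ℝ} (hA : MeasurableSet A) :
    noiseLaw K {v | v l ∈ A} = gaussianReal 0 1 A :=
  (measurePreserving_eval (fun _ : Fin K => gaussianReal 0 1) l).measure_preimage
    hA.nullMeasurableSet

lemma map_noise (hG : IsSamplingNoise P X G) (t : ℕ) :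
    P.map (fun ω l => G t l ω) = noiseLaw K := by
  have h := hG.indep.precomp (g := fun l : Fin K => (t, l)) (fun a b h => by simpa using h)
  rw [iIndepFun_iff_map_fun_eq_pi_map fun l => (hG.measurable t l).aemeasurable] at h
  simpa [hG.map_eq] using h

lemma lintegral_tsHistory_noise (hX : IsRewardTable P ν X) (hG : IsSamplingNoise P X G) (t : ℕ)
    {h : ((Fin K → ℕ → ℝ) × (Fin K → ℕ)) × (Fin K → ℝ) → ENNReal} (hh : Measurable h) :
    ∫⁻ ω, h (tsHistory μ α β σ τ X G t ω, fun l => G t l ω) ∂P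
      = ∫⁻ ω, ∫⁻ v, h (tsHistory μ α β σ τ X G t ω, v) ∂(noiseLaw K) ∂P := by
  have hV : Measurable fun ω l => G t l ω := measurable_pi_lambda _ fun l => hG.measurable t l
  have hU : Measurable (tsHistory μ α β σ τ X G t) := measurable_tsHistory hX hG t
  have hlaw := (indepFun_iff_map_prod_eq_prod_map_map hU.aemeasurable hV.aemeasurable).1
    (indepFun_tsHistory_noise hX hG t)
  rw [← lintegral_map hh (hU.prodMk hV), hlaw, map_noise hG, lintegral_prod _ hh.aemeasurable,
    lintegral_map hh.lintegral_prod_right' hU]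

end Independence

section OneStep

variable {K : ℕ} {Θ : Type*} {μ : Fin K → Θ → ℝ} {α β σ : ℝ} {τ : ℕ → Finset (Fin K) → Fin K}

/-- The odds that the Thompson sample of an arm with empirical mean `m` after `j` pulls falls
below `y`; zero for an arm that has not been pulled, whose sample is `+∞`. -/
noncomputable def sampleOdds (β σ y m : ℝ) (j : ℕ) : ENNReal :=
  if j = 0 then 0 else gaussOdds ((y - m) / √(β * σ ^ 2 / j))

lemma sqrt_div_natCast_pos (hβ : 0 < β) (hσ : 0 < σ) {n : ℕ} (hn : n ≠ 0) :
    0 < √(β * σ ^ 2 / n) := by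
  have : (0 : ℝ) < n := by exact_mod_cast Nat.pos_of_ne_zero hn
  positivity

lemma add_sqrt_mul_le_iff (hβ : 0 < β) (hσ : 0 < σ) {n : ℕ} (hn : n ≠ 0) {m r y : ℝ} :
    m + √(β * σ ^ 2 / n) * r ≤ y ↔ r ≤ (y - m) / √(β * σ ^ 2 / n) := by
  rw [le_div_iff₀' (sqrt_div_natCast_pos hβ hσ hn), le_sub_iff_add_le']

lemma tsSample_of_ne_zero {g : ℕ → Fin K → ℝ} {t : ℕ} {n : Fin K → ℕ} {m : Fin K → ℝ} {l : Fin K}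
    (hl : n l ≠ 0) :
    tsSample β σ g t n m l = ((m l + √(β * σ ^ 2 / n l) * g t l : ℝ) : EReal) :=
  if_neg hl

lemma tsSample_le_coe_iff (hβ : 0 < β) (hσ : 0 < σ) {g : ℕ → Fin K → ℝ} {t : ℕ} {n : Fin K → ℕ}
    {m : Fin K → ℝ} {l : Fin K} (hl : n l ≠ 0) {y : ℝ} :
    tsSample β σ g t n m l ≤ (y : EReal) ↔ g t l ≤ (y - m l) / √(β * σ ^ 2 / n l) := by
  rw [tsSample_of_ne_zero hl, EReal.coe_le_coe_iff, add_sqrt_mul_le_iff hβ hσ hl]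

lemma ne_zero_of_nextArm_tsSample (hτ : IsTieBreaking τ) {ks k : Fin K} {x : Fin K → ℕ → ℝ}
    {g : ℕ → Fin K → ℝ} {t : ℕ} {n : Fin K → ℕ}
    (hks : ks ∈ competitiveSet μ α σ t n (empMean x n)) (hn : n k ≠ 0)
    (hk : nextArm μ α σ τ (tsSample β σ g) x t n = k) : n ks ≠ 0 := fun h0 => by
  have hle := (mem_argmaxOn.1 (hk ▸ nextArm_mem hτ k t n)).2 ks hks
  rw [tsSample_of_ne_zero hn, tsSample, if_pos h0, top_le_iff] at hle
  exact EReal.coe_ne_top _ hle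

/-- The noise values for which the Thompson sample of the arm `l` is at most `y`; all of them when
`l` is not competitive. -/
def lowNoise (μ : Fin K → Θ → ℝ) (α β σ : ℝ) (t : ℕ) (n : Fin K → ℕ) (m : Fin K → ℝ) (y : ℝ)
    (l : Fin K) : Set ℝ :=
  {r | l ∈ competitiveSet μ α σ t n m → tsSample β σ (fun _ _ => r) t n m l ≤ (y : EReal)}

lemma nextArm_subset_pi_lowNoise (hβ : 0 < β) (hσ : 0 < σ) (hτ : IsTieBreaking τ) {ks k : Fin K}
    (hne : ks ≠ k) {x : Fin K → ℕ → ℝ} {t : ℕ} {n : Fin K → ℕ}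
    (hks : ks ∈ competitiveSet μ α σ t n (empMean x n)) (hn : n k ≠ 0) (hns : n ks ≠ 0) (y : ℝ)
    (A : Set ℝ) :
    {v | nextArm μ α σ τ (tsSample β σ fun _ => v) x t n = k ∧ v k ∈ A ∧
        empMean x n k + √(β * σ ^ 2 / n k) * v k ≤ y}
      ⊆ Set.univ.pi (Function.update (Function.update (lowNoise μ α β σ t n (empMean x n) y) k
          (A ∩ Set.Iic ((y - empMean x n k) / √(β * σ ^ 2 / n k)))) ks
          (Set.Iic ((y - empMean x n ks) / √(β * σ ^ 2 / n ks)))) := by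
  rintro v ⟨hk, hvA, hvy⟩ l -
  have hmax := (mem_argmaxOn.1 (hk ▸ nextArm_mem hτ k t n)).2
  have hlow : ∀ l ∈ competitiveSet μ α σ t n (empMean x n),
      tsSample β σ (fun _ => v) t n (empMean x n) l ≤ (y : EReal) := fun l hl =>
    (hmax l hl).trans ((tsSample_of_ne_zero hn).trans_le (EReal.coe_le_coe_iff.2 hvy))
  rcases eq_or_ne l ks with rfl | hls
  · rw [Function.update_self]
    exact (tsSample_le_coe_iff hβ hσ hns).1 (hlow l hks)
  rw [Function.update_of_ne hls]
  rcases eq_or_ne l k with rfl | hlk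
  · rw [Function.update_self]
    exact ⟨hvA, (add_sqrt_mul_le_iff hβ hσ hn).1 hvy⟩
  · rw [Function.update_of_ne hlk]
    exact hlow l

lemma pi_lowNoise_subset_nextArm (hβ : 0 < β) (hσ : 0 < σ) (hτ : IsTieBreaking τ) {ks k : Fin K}
    {x : Fin K → ℕ → ℝ} {t : ℕ} {n : Fin K → ℕ}
    (hks : ks ∈ competitiveSet μ α σ t n (empMean x n)) (hn : n k ≠ 0) (hns : n ks ≠ 0) (y : ℝ) :
    Set.univ.pi (Function.update (Function.update (lowNoise μ α β σ t n (empMean x n) y) k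
        (Set.Iic ((y - empMean x n k) / √(β * σ ^ 2 / n k)))) ks
        (Set.Ioi ((y - empMean x n ks) / √(β * σ ^ 2 / n ks))))
      ⊆ {v | nextArm μ α σ τ (tsSample β σ fun _ => v) x t n = ks} := by
  intro v hv
  have hhigh : (y : EReal) < tsSample β σ (fun _ => v) t n (empMean x n) ks := by
    have := hv ks (Set.mem_univ _)
    rw [Function.update_self] at this
    exact not_le.1 fun h => absurd ((tsSample_le_coe_iff hβ hσ hns).1 h) (not_le.2 this)
  have hlow : ∀ l ∈ competitiveSet μ α σ t n (empMean x n), l ≠ ks →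
      tsSample β σ (fun _ => v) t n (empMean x n) l ≤ (y : EReal) := fun l hl hls => by
    have := hv l (Set.mem_univ _)
    rw [Function.update_of_ne hls] at this
    rcases eq_or_ne l k with rfl | hlk
    · rw [Function.update_self] at this
      exact (tsSample_le_coe_iff hβ hσ hn).2 this
    · rw [Function.update_of_ne hlk] at this
      exact this hl
  have hmax := mem_argmaxOn.1 (nextArm_mem (μ := μ) (α := α) (σ := σ) (x := x)
    (I := tsSample β σ fun _ => v) hτ k t n)
  by_contra hcon
  exact absurd ((hmax.2 ks hks).trans (hlow _ hmax.1 hcon)) (not_le.2 hhigh)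

lemma pi_update_update {ι : Type*} [Fintype ι] [DecidableEq ι] {X : ι → Type*}
    [∀ i, MeasurableSpace (X i)] (ρ : ∀ i, Measure (X i)) [∀ i, SigmaFinite (ρ i)] {a b : ι}
    (hab : a ≠ b) (B : ∀ i, Set (X i)) (U : Set (X b)) (V : Set (X a)) :
    Measure.pi ρ (Set.univ.pi (Function.update (Function.update B b U) a V))
      = ρ a V * (ρ b U * ∏ i ∈ (Finset.univ.erase a).erase b, ρ i (B i)) := by
  rw [Measure.pi_pi, ← Finset.mul_prod_erase Finset.univ _ (Finset.mem_univ a),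
    ← Finset.mul_prod_erase (Finset.univ.erase a) _ (a := b) (by simp [hab.symm]),
    Function.update_self, Function.update_of_ne hab.symm, Function.update_self]
  congr 2
  refine Finset.prod_congr rfl fun i hi => ?_
  simp only [Finset.mem_erase] at hi
  rw [Function.update_of_ne hi.2.1, Function.update_of_ne hi.1]

-- If the samples of `k` and of the optimal arm `ks` are both below `y`, moving the latter above `y`
-- makes `ks` the arm pulled. The samples being independent, this costs the odds of that of `ks`.
lemma noiseLaw_nextArm_le (hβ : 0 < β) (hσ : 0 < σ) (hτ : IsTieBreaking τ) {ks k : Fin K}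
    (hne : ks ≠ k) {x : Fin K → ℕ → ℝ} {t : ℕ} {n : Fin K → ℕ}
    (hks : ks ∈ competitiveSet μ α σ t n (empMean x n)) (hn : n k ≠ 0) (y : ℝ)
    {A : Set ℝ} {q : ENNReal} (hq : ∀ b, gaussianReal 0 1 (A ∩ Set.Iic b) ≤ q * gaussCdf b) :
    noiseLaw K {v | nextArm μ α σ τ (tsSample β σ fun _ => v) x t n = k ∧ v k ∈ A ∧
        empMean x n k + √(β * σ ^ 2 / n k) * v k ≤ y}
      ≤ q * sampleOdds β σ y (empMean x n ks) (n ks) *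
        noiseLaw K {v | nextArm μ α σ τ (tsSample β σ fun _ => v) x t n = ks} := by
  rcases eq_or_ne (n ks) 0 with hns | hns
  · have hempty : {v | nextArm μ α σ τ (tsSample β σ fun _ => v) x t n = k ∧ v k ∈ A ∧
        empMean x n k + √(β * σ ^ 2 / n k) * v k ≤ y} = ∅ :=
      Set.eq_empty_of_forall_notMem fun v hv => ne_zero_of_nextArm_tsSample hτ hks hn hv.1 hns
    rw [hempty, measure_empty]
    exact zero_le
  set b := (y - empMean x n k) / √(β * σ ^ 2 / n k)
  set c := (y - empMean x n ks) / √(β * σ ^ 2 / n ks)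
  set B := lowNoise μ α β σ t n (empMean x n) y
  set R := ∏ l ∈ (Finset.univ.erase ks).erase k, gaussianReal 0 1 (B l)
  calc _ ≤ noiseLaw K (Set.univ.pi (Function.update (Function.update B k (A ∩ Set.Iic b)) ks
          (Set.Iic c))) :=
        measure_mono (nextArm_subset_pi_lowNoise hβ hσ hτ hne hks hn hns y A)
    _ = gaussCdf c * (gaussianReal 0 1 (A ∩ Set.Iic b) * R) := pi_update_update _ hne _ _ _
    _ ≤ gaussCdf c * (q * gaussCdf b * R) := by
        gcongr
        exact hq b
    _ = q * sampleOdds β σ y (empMean x n ks) (n ks) * (gaussTail c * (gaussCdf b * R)) := by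
        rw [← gaussOdds_mul_gaussTail c, sampleOdds, if_neg hns]
        ring
    _ = q * sampleOdds β σ y (empMean x n ks) (n ks) *
          noiseLaw K (Set.univ.pi (Function.update (Function.update B k (Set.Iic b)) ks
            (Set.Ioi c))) := by
        rw [pi_update_update _ hne]
        rfl
    _ ≤ _ := by
        gcongr
        exact pi_lowNoise_subset_nextArm hβ hσ hτ hks hn hns y

end OneStep

section Concentration

variable {K : ℕ} {Θ : Type*} {μ : Fin K → Θ → ℝ} {θ : Θ} {α : ℝ} {σ : ℝ≥0}
  {ν : Fin K → Measure ℝ}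
  {Ω : Type*} {X : Fin K → ℕ → Ω → ℝ}

/-- Sum of the deviations of the first `n` rewards `x` from the mean `c`. -/
noncomputable def sumDev (x : ℕ → ℝ) (c : ℝ) (n : ℕ) : ℝ := ∑ m ∈ Finset.range n, (x m - c)

lemma empMean_sub_eq_sumDev_div {x : Fin K → ℕ → ℝ} {n : Fin K → ℕ} {l : Fin K}
    (h : n l ≠ 0) (c : ℝ) :
    empMean x n l - c = sumDev (x l) c (n l) / n l := by
  have : (n l : ℝ) ≠ 0 := by exact_mod_cast h
  simp only [empMean, sumDev, Finset.sum_sub_distrib, Finset.sum_const, Finset.card_range,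
    nsmul_eq_mul]
  field_simp

/-- The event that, for some arm `l` and some `j ≤ t`, the mean of the first `j` rewards of `l` is
off by at least the confidence radius; stated for the sums, so that nothing is divided by `j`. -/
def badEvent (μ : Fin K → Θ → ℝ) (θ : Θ) (α : ℝ) (σ : ℝ≥0) (X : Fin K → ℕ → Ω → ℝ) (t : ℕ) :
    Set Ω :=
  ⋃ l, ⋃ j ∈ Finset.Icc 1 t,
    {ω | √(2 * α * σ ^ 2 * Real.log t * j) ≤ |sumDev (fun m => X l m ω) (μ l θ) j|}

lemma badEvent_zero : badEvent μ θ α σ X 0 = ∅ := by simp [badEvent]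

lemma mem_confSet_of_notMem_badEvent {t : ℕ} {n : Fin K → ℕ} {ω : Ω} (hn : ∀ l, n l ≤ t)
    (h : ω ∉ badEvent μ θ α σ X t) :
    θ ∈ confSet μ α σ t n (empMean (fun l m => X l m ω) n) := by
  intro l
  unfold confRadius
  split_ifs with hn0
  · exact EReal.coe_lt_top _
  · rw [EReal.coe_lt_coe_iff]
    by_contra hcon
    refine h (Set.mem_iUnion.2 ⟨l, Set.mem_iUnion₂.2
      ⟨n l, Finset.mem_Icc.2 ⟨Nat.one_le_iff_ne_zero.2 hn0, hn l⟩, ?_⟩⟩)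
    have hp : (0 : ℝ) < n l := by exact_mod_cast Nat.pos_of_ne_zero hn0
    rw [abs_sub_comm, empMean_sub_eq_sumDev_div hn0, abs_div, abs_of_pos hp, not_lt,
      le_div_iff₀ hp] at hcon
    refine le_trans (le_of_eq ?_) hcon
    rw [← Real.sqrt_sq hp.le, ← Real.sqrt_mul' _ (by positivity), Real.sqrt_sq hp.le]
    congr 1
    field_simp

variable [MeasurableSpace Ω] {P : Measure Ω}

lemma measurable_sumDev (hX : IsRewardTable P ν X) (l : Fin K) (c : ℝ) (n : ℕ) :
    Measurable fun ω => sumDev (fun m => X l m ω) c n :=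
  Finset.measurable_sum _ fun m _ => (hX.measurable l m).sub_const c

lemma hasSubgaussianMGF_sumDev [IsProbabilityMeasure P] (hX : IsRewardTable P ν X)
    (hsubG : ∀ l, HasSubgaussianMGF (fun r => r - μ l θ) (σ ^ 2) (ν l)) (l : Fin K) (n : ℕ) :
    HasSubgaussianMGF (fun ω => sumDev (fun m => X l m ω) (μ l θ) n) (n * σ ^ 2) P := by
  have hcentered : ∀ m, HasSubgaussianMGF (fun ω => X l m ω - μ l θ) (σ ^ 2) P := fun m => by
    have := hsubG l
    rw [← hX.map_eq l m] at this
    exact HasSubgaussianMGF.of_map (hX.measurable l m).aemeasurable this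
  have hindep : iIndepFun (fun m ω => X l m ω - μ l θ) P :=
    (hX.indep.precomp (g := fun m : ℕ => (l, m)) (fun a b h => by simpa using h)).comp
      (fun _ r => r - μ l θ) (fun _ => measurable_id.sub_const _)
  have hsum := HasSubgaussianMGF.sum_of_iIndepFun hindep (s := Finset.range n)
    (fun m _ => hcentered m)
  simpa [sumDev] using hsum

lemma measurableSet_badEvent (hX : IsRewardTable P ν X) (t : ℕ) :
    MeasurableSet (badEvent μ θ α σ X t) := by
  refine MeasurableSet.iUnion fun l => Finset.measurableSet_biUnion _ fun j _ => ?_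
  exact measurableSet_le measurable_const (measurable_sumDev hX l _ j).abs

lemma measure_abs_sumDev_ge_le [IsProbabilityMeasure P] (hX : IsRewardTable P ν X)
    (hsubG : ∀ l, HasSubgaussianMGF (fun r => r - μ l θ) (σ ^ 2) (ν l)) (l : Fin K) (n : ℕ)
    {ε : ℝ} (hε : 0 ≤ ε) :
    P {ω | ε ≤ |sumDev (fun m => X l m ω) (μ l θ) n|}
      ≤ ENNReal.ofReal (2 * Real.exp (-ε ^ 2 / (2 * (n * σ ^ 2)))) := by
  have h := hasSubgaussianMGF_sumDev (P := P) hX hsubG l n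
  have hupper := h.measure_ge_le hε
  have hlower := h.neg.measure_ge_le hε
  have hsub : {ω | ε ≤ |sumDev (fun m => X l m ω) (μ l θ) n|}
      ⊆ {ω | ε ≤ sumDev (fun m => X l m ω) (μ l θ) n}
        ∪ {ω | ε ≤ (-fun ω => sumDev (fun m => X l m ω) (μ l θ) n) ω} :=
    fun ω (hω : ε ≤ |sumDev (fun m => X l m ω) (μ l θ) n|) => le_abs.1 hω
  have hunion := (measureReal_mono (μ := P) hsub).trans (measureReal_union_le _ _)
  rw [← ENNReal.ofReal_toReal (measure_ne_top P _)]
  refine ENNReal.ofReal_le_ofReal ?_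
  push_cast at hupper hlower
  change P.real _ ≤ _
  linarith

lemma measure_badEvent_le [IsProbabilityMeasure P] (hσ : 0 < σ) (hα : 0 ≤ α)
    (hX : IsRewardTable P ν X)
    (hsubG : ∀ l, HasSubgaussianMGF (fun r => r - μ l θ) (σ ^ 2) (ν l)) {t : ℕ} (ht : 1 ≤ t) :
    P (badEvent μ θ α σ X t) ≤ ENNReal.ofReal (2 * K * (t : ℝ) ^ (1 - α)) := by
  have ht0 : (0 : ℝ) < t := by exact_mod_cast ht
  have : 0 ≤ Real.log t := Real.log_nonneg (by exact_mod_cast ht)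
  have : (0 : ℝ) < σ := by exact_mod_cast hσ
  have hpair : ∀ l, ∀ j ∈ Finset.Icc 1 t,
      P {ω | √(2 * α * σ ^ 2 * Real.log t * j) ≤ |sumDev (fun m => X l m ω) (μ l θ) j|}
        ≤ ENNReal.ofReal (2 * (t : ℝ) ^ (-α)) := by
    intro l j hj
    refine (measure_abs_sumDev_ge_le hX hsubG l j (Real.sqrt_nonneg _)).trans
      (ENNReal.ofReal_le_ofReal (le_of_eq ?_))
    have hj0 : (0 : ℝ) < j := by exact_mod_cast (Finset.mem_Icc.1 hj).1
    rw [Real.sq_sqrt (by positivity), Real.rpow_def_of_pos ht0]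
    congr 2
    field_simp
  calc P (badEvent μ θ α σ X t)
      ≤ ∑ l, ∑ j ∈ Finset.Icc 1 t,
        P {ω | √(2 * α * σ ^ 2 * Real.log t * j) ≤ |sumDev (fun m => X l m ω) (μ l θ) j|} := by
        refine (measure_iUnion_le _).trans ?_
        rw [tsum_fintype]
        exact Finset.sum_le_sum fun l _ => measure_biUnion_finset_le _ _
    _ ≤ ∑ _l : Fin K, ∑ _j ∈ Finset.Icc 1 t, ENNReal.ofReal (2 * (t : ℝ) ^ (-α)) :=
        Finset.sum_le_sum fun l _ => Finset.sum_le_sum fun j hj => hpair l j hj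
    _ = ENNReal.ofReal (2 * K * (t : ℝ) ^ (1 - α)) := by
        simp only [Finset.sum_const, Finset.card_univ, Fintype.card_fin, Nat.card_Icc,
          add_tsub_cancel_right, nsmul_eq_mul]
        rw [← ENNReal.ofReal_natCast, ← ENNReal.ofReal_natCast,
          ← ENNReal.ofReal_mul (by positivity), ← ENNReal.ofReal_mul (by positivity)]
        congr 1
        rw [show (1 : ℝ) - α = 1 + -α by ring, Real.rpow_add ht0, Real.rpow_one]
        ring

lemma measure_sumDev_ge_le [IsProbabilityMeasure P] (hX : IsRewardTable P ν X)
    (hsubG : ∀ l, HasSubgaussianMGF (fun r => r - μ l θ) (σ ^ 2) (ν l)) (l : Fin K) {n : ℕ}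
    (hn : n ≠ 0) {δ : ℝ} (hδ : 0 ≤ δ) :
    P {ω | n * δ ≤ sumDev (fun m => X l m ω) (μ l θ) n}
      ≤ ENNReal.ofReal (Real.exp (-(n * δ ^ 2 / (2 * σ ^ 2)))) := by
  have htail := (hasSubgaussianMGF_sumDev (P := P) hX hsubG l n).measure_ge_le
    (ε := n * δ) (by positivity)
  rw [← ENNReal.ofReal_toReal (measure_ne_top P _)]
  refine ENNReal.ofReal_le_ofReal (htail.trans (le_of_eq ?_))
  congr 1
  push_cast
  have : (n : ℝ) ≠ 0 := by exact_mod_cast hn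
  rcases eq_or_ne (σ : ℝ) 0 with h | h
  · simp [h]
  · field_simp

end Concentration

section Counting

lemma sum_ite_natCast_lt_max_one_le {L : ℝ} (hL : 0 ≤ L) (N : ℕ) :
    ∑ n ∈ Finset.range N, (if (n : ℝ) < max L 1 then (1 : ENNReal) else 0)
      ≤ ENNReal.ofReal (L + 1) := by
  calc ∑ n ∈ Finset.range N, (if (n : ℝ) < max L 1 then (1 : ENNReal) else 0)
      = ((Finset.range N).filter fun n : ℕ => (n : ℝ) < max L 1).card := by
        rw [Finset.sum_boole]
    _ ≤ (⌈max L 1⌉₊ : ENNReal) := by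
        have : ((Finset.range N).filter fun n : ℕ => (n : ℝ) < max L 1)
            ⊆ Finset.range ⌈max L 1⌉₊ := by
          intro n hn
          exact Finset.mem_range.2 (Nat.lt_ceil.2 (Finset.mem_filter.1 hn).2)
        exact_mod_cast (Finset.card_le_card this).trans (Finset.card_range _).le
    _ ≤ ENNReal.ofReal (L + 1) := by
        rw [← ENNReal.ofReal_natCast]
        refine ENNReal.ofReal_le_ofReal ?_
        rcases le_total L 1 with h | h
        · rw [max_eq_right h, Nat.ceil_one, Nat.cast_one]; linarith
        · rw [max_eq_left h]; exact (Nat.ceil_lt_add_one hL).le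

lemma integral_natCast_le {Ω : Type*} [MeasurableSpace Ω] {P : Measure Ω} {N : Ω → ℕ}
    (hN : Measurable N) {B : ℝ} (hB : 0 ≤ B)
    (h : ∫⁻ ω, (N ω : ENNReal) ∂P ≤ ENNReal.ofReal B) : ∫ ω, (N ω : ℝ) ∂P ≤ B := by
  rw [integral_eq_lintegral_of_nonneg_ae (Eventually.of_forall fun ω => Nat.cast_nonneg _)
    (measurable_from_nat.comp hN).aestronglyMeasurable]
  simp only [ENNReal.ofReal_natCast]
  exact ENNReal.toReal_le_of_le_ofReal hB h

lemma integrable_natCast_of_le {Ω : Type*} [MeasurableSpace Ω] {P : Measure Ω}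
    [IsFiniteMeasure P] {N : Ω → ℕ} (hN : Measurable N) {T : ℕ} (h : ∀ ω, N ω ≤ T) :
    Integrable (fun ω => (N ω : ℝ)) P :=
  Integrable.of_bound (measurable_from_nat.comp hN).aestronglyMeasurable T
    (Eventually.of_forall fun ω => by
      rw [Real.norm_of_nonneg (Nat.cast_nonneg _)]; exact_mod_cast h ω)

lemma exists_forall_sum_Icc_rpow_le {s : ℝ} (hs : s < -1) :
    ∃ C : ℝ, ∀ T : ℕ, ∑ t ∈ Finset.Icc 1 T, (t : ℝ) ^ s ≤ C :=
  ⟨∑' t : ℕ, (t : ℝ) ^ s, fun _ => (Real.summable_nat_rpow.2 hs).sum_le_tsum _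
    fun _ _ => Real.rpow_nonneg (Nat.cast_nonneg _) _⟩

lemma isBigO_log_of_le {f : ℕ → ℝ} {a b : ℝ} (h0 : ∀ T, 0 ≤ f T)
    (h : ∀ T : ℕ, f T ≤ a * Real.log T + b) : f =O[atTop] fun T : ℕ => Real.log T := by
  refine IsBigO.of_bound (a + |b|) ?_
  filter_upwards [eventually_ge_atTop 3] with T hT
  have hT3 : (3 : ℝ) ≤ T := by exact_mod_cast hT
  have hlog : 1 ≤ Real.log T := by
    rw [Real.le_log_iff_exp_le (by linarith)]
    exact (Real.exp_one_lt_d9.le.trans (by norm_num)).trans hT3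
  rw [Real.norm_of_nonneg (h0 T), Real.norm_of_nonneg (by linarith)]
  have := h T
  have := le_abs_self b
  have := abs_nonneg b
  nlinarith

end Counting

section UCB

variable {K : ℕ} {Θ : Type*} {μ : Fin K → Θ → ℝ} {θ : Θ} {ks k : Fin K} {α : ℝ} {σ : ℝ≥0}
  {τ : ℕ → Finset (Fin K) → Fin K} {ν : Fin K → Measure ℝ}
  {Ω : Type*} {X : Fin K → ℕ → Ω → ℝ}

lemma ucbcPulls_le (hks : IsBestAt μ ks θ) (hgap : 0 < gap μ θ ks k) (hα : 0 ≤ α)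
    (hτ : IsTieBreaking τ) (T : ℕ) (ω : Ω) :
    (ucbcPulls μ α σ τ (fun l m => X l m ω) T k : ENNReal)
      ≤ ENNReal.ofReal (8 * α * (σ : ℝ) ^ 2 * Real.log T / gap μ θ ks k ^ 2 + 1)
        + ∑ t ∈ Finset.range T, (badEvent μ θ α σ X t).indicator 1 ω := by
  have hT0 : 0 ≤ Real.log T := Real.log_natCast_nonneg T
  set L := 8 * α * (σ : ℝ) ^ 2 * Real.log T / gap μ θ ks k ^ 2 with hL
  set x : Fin K → ℕ → ℝ := fun l m => X l m ω
  set n := pulls μ α σ τ (ucbIndex α σ) x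
  have hround : ∀ t ∈ Finset.range T, armAt μ α σ τ (ucbIndex α σ) x t = k →
      ω ∉ badEvent μ θ α σ X t → (n t k : ℝ) < max L 1 := fun t ht hk hbad => by
    rcases eq_or_ne (n t k) 0 with hn | hn
    · simp [hn]
    refine lt_max_of_lt_left ((lt_of_nextArm_ucbIndex hτ hks hgap
      (mem_confSet_of_notMem_badEvent (pulls_le t) hbad) hk hn).trans_le ?_)
    have hlog : Real.log t ≤ Real.log T := by
      rcases Nat.eq_zero_or_pos t with h | h
      · simp [h, hT0]
      · exact Real.log_le_log (by exact_mod_cast h) (by exact_mod_cast (Finset.mem_range.1 ht).le)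
    rw [hL]
    gcongr
  calc (n T k : ENNReal)
      = ∑ t ∈ Finset.range T,
          (if armAt μ α σ τ (ucbIndex α σ) x t = k then (1 : ENNReal) else 0) := by
        simp only [n, pulls_eq_sum, Nat.cast_sum, Nat.cast_ite, Nat.cast_one, Nat.cast_zero]
    _ ≤ ∑ t ∈ Finset.range T, ((if armAt μ α σ τ (ucbIndex α σ) x t = k then
            (if (n t k : ℝ) < max L 1 then (1 : ENNReal) else 0) else 0)
          + (badEvent μ θ α σ X t).indicator 1 ω) := by
        refine Finset.sum_le_sum fun t ht => ?_
        by_cases hk : armAt μ α σ τ (ucbIndex α σ) x t = k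
        · by_cases hbad : ω ∈ badEvent μ θ α σ X t
          · simp [hk, hbad]
          · simp [hk, hround t ht hk hbad]
        · simp [hk]
    _ = ∑ j ∈ Finset.range (n T k), (if (j : ℝ) < max L 1 then (1 : ENNReal) else 0)
          + ∑ t ∈ Finset.range T, (badEvent μ θ α σ X t).indicator 1 ω := by
        rw [Finset.sum_add_distrib, ← sum_ite_armAt_eq_sum_range]
    _ ≤ _ := by
        gcongr
        exact sum_ite_natCast_lt_max_one_le (by positivity) _

variable [MeasurableSpace Ω] {P : Measure Ω}

lemma measurable_ucbcPulls (hX : IsRewardTable P ν X) (T : ℕ) :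
    Measurable fun ω => ucbcPulls μ α σ τ (fun l m => X l m ω) T k :=
  measurable_pi_iff.1 (measurable_pulls (x := fun ω l m => X l m ω) (I := fun _ => ucbIndex α σ)
    hX.measurable measurable_ucbIndex T) k

lemma sum_range_measure_badEvent_le_sum_Icc (T : ℕ) :
    ∑ t ∈ Finset.range T, P (badEvent μ θ α σ X t)
      ≤ ∑ t ∈ Finset.Icc 1 T, P (badEvent μ θ α σ X t) := by
  calc ∑ t ∈ Finset.range T, P (badEvent μ θ α σ X t)
      ≤ ∑ t ∈ Finset.range (T + 1), P (badEvent μ θ α σ X t) :=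
        Finset.sum_le_sum_of_subset (Finset.range_subset_range.2 (Nat.le_succ T))
    _ = ∑ t ∈ Finset.Icc 1 T, P (badEvent μ θ α σ X t) := by
        rw [Finset.sum_range_succ', badEvent_zero, measure_empty, add_zero,
          Finset.range_eq_Ico, Finset.sum_Ico_add' (fun t => P (badEvent μ θ α σ X t)) 0 T 1]
        rfl

variable [IsProbabilityMeasure P]

lemma sum_range_measure_badEvent_le (hσ : 0 < σ) (hα : 0 ≤ α) (hX : IsRewardTable P ν X)
    (hsubG : ∀ l, HasSubgaussianMGF (fun r => r - μ l θ) (σ ^ 2) (ν l)) (T : ℕ) :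
    ∑ t ∈ Finset.range T, P (badEvent μ θ α σ X t)
      ≤ ENNReal.ofReal (∑ t ∈ Finset.Icc 1 T, 2 * (K : ℝ) * (t : ℝ) ^ (1 - α)) := by
  rw [ENNReal.ofReal_sum_of_nonneg fun t _ => by positivity]
  refine (sum_range_measure_badEvent_le_sum_Icc T).trans (Finset.sum_le_sum fun t ht => ?_)
  exact measure_badEvent_le hσ hα hX hsubG (Finset.mem_Icc.1 ht).1

lemma lintegral_ucbcPulls_le (hks : IsBestAt μ ks θ) (hgap : 0 < gap μ θ ks k) (hσ : 0 < σ)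
    (hα : 0 ≤ α) (hτ : IsTieBreaking τ) (hX : IsRewardTable P ν X)
    (hsubG : ∀ l, HasSubgaussianMGF (fun r => r - μ l θ) (σ ^ 2) (ν l)) (T : ℕ) :
    ∫⁻ ω, (ucbcPulls μ α σ τ (fun l m => X l m ω) T k : ENNReal) ∂P
      ≤ ENNReal.ofReal (8 * α * (σ : ℝ) ^ 2 * Real.log T / gap μ θ ks k ^ 2 + 1
          + ∑ t ∈ Finset.Icc 1 T, 2 * (K : ℝ) * (t : ℝ) ^ (1 - α)) := by
  have : 0 ≤ Real.log T := Real.log_natCast_nonneg T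
  set L := 8 * α * (σ : ℝ) ^ 2 * Real.log T / gap μ θ ks k ^ 2
  calc _ ≤ ∫⁻ ω, (ENNReal.ofReal (L + 1)
        + ∑ t ∈ Finset.range T, (badEvent μ θ α σ X t).indicator 1 ω) ∂P :=
        lintegral_mono (ucbcPulls_le hks hgap hα hτ T)
    _ = ENNReal.ofReal (L + 1) + ∑ t ∈ Finset.range T, P (badEvent μ θ α σ X t) := by
      rw [lintegral_add_left measurable_const, lintegral_finsetSum _ fun t _ =>
        measurable_one.indicator (measurableSet_badEvent hX t)]
      simp [lintegral_indicator_one (measurableSet_badEvent hX _)]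
    _ ≤ _ := by
      rw [ENNReal.ofReal_add (by positivity) (Finset.sum_nonneg fun t _ => by positivity)]
      gcongr
      exact sum_range_measure_badEvent_le hσ hα hX hsubG T

end UCB

section Thompson

variable {K : ℕ} {Θ : Type*} {μ : Fin K → Θ → ℝ} {ks k : Fin K} {α β σ : ℝ}
  {τ : ℕ → Finset (Fin K) → Fin K}

lemma measurable_empMean_comp {S : Type*} [MeasurableSpace S] {x : S → Fin K → ℕ → ℝ}
    (hx : ∀ l m, Measurable fun s => x s l m) {N : S → Fin K → ℕ} (hN : Measurable N) :
    Measurable fun s => empMean (x s) (N s) :=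
  Measurable.comp (g := fun p : S × (Fin K → ℕ) => empMean (x p.1) p.2)
    (f := fun s => (s, N s)) (measurable_from_prod_countable_left fun n =>
      measurable_empMean hx n) (measurable_id.prodMk hN)

lemma measurable_sampleOdds (y : ℝ) (j : ℕ) : Measurable fun m => sampleOdds β σ y m j := by
  unfold sampleOdds
  split_ifs
  · exact measurable_const
  · exact gaussOdds_mono.measurable.comp (by fun_prop)

lemma measurable_sampleOdds_comp {S : Type*} [MeasurableSpace S] {m : S → ℝ}
    (hm : Measurable m) {j : S → ℕ} (hj : Measurable j) (y : ℝ) :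
    Measurable fun s => sampleOdds β σ y (m s) (j s) :=
  Measurable.comp (g := fun p : ℝ × ℕ => sampleOdds β σ y p.1 p.2)
    (f := fun s => (m s, j s)) (measurable_from_prod_countable_left fun n =>
      measurable_sampleOdds y n) (hm.prodMk hj)

/-- A table of rewards and the pull counts at the beginning of a round. -/
abbrev History (K : ℕ) : Type := (Fin K → ℕ → ℝ) × (Fin K → ℕ)

lemma measurable_empMean_history :
    Measurable fun u : History K => empMean u.1 u.2 :=
  measurable_empMean_comp (S := History K) (x := fun u => u.1) (fun l m => by fun_prop)
    (N := fun u => u.2) (by fun_prop)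

lemma measurable_natCast_pulls (l : Fin K) : Measurable fun u : History K => (u.2 l : ℝ) :=
  measurable_from_nat.comp (by fun_prop)

/-- The arm pulled by TS-C in round `t + 1`, as a function of the history and of the noise of the
round. -/
noncomputable def tsArm (μ : Fin K → Θ → ℝ) (α β σ : ℝ) (τ : ℕ → Finset (Fin K) → Fin K) (t : ℕ)
    (p : History K × (Fin K → ℝ)) : Fin K :=
  nextArm μ α σ τ (tsSample β σ fun _ => p.2) p.1.1 t p.1.2

lemma measurable_tsArm (t : ℕ) : Measurable (tsArm μ α β σ τ t) :=
  measurable_nextArm_comp (S := History K × (Fin K → ℝ)) (x := fun p => p.1.1)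
    (I := fun p => tsSample β σ fun _ => p.2) (fun l m => by fun_prop)
    (measurable_tsSample (S := History K × (Fin K → ℝ)) (g := fun p _ => p.2)
      fun _ l => by fun_prop) t (N := fun p => p.1.2) (by fun_prop)

/-- The Thompson sample of the arm `l`, as a function of the history and of the noise of the round;
meaningful only for an arm that has been pulled. -/
noncomputable def tsValue (β σ : ℝ) (l : Fin K) (p : History K × (Fin K → ℝ)) : ℝ :=
  empMean p.1.1 p.1.2 l + √(β * σ ^ 2 / p.1.2 l) * p.2 l

lemma measurable_tsValue (l : Fin K) : Measurable (tsValue β σ l) :=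
  ((measurable_pi_iff.1 measurable_empMean_history l).comp measurable_fst).add
    ((((measurable_natCast_pulls l).comp measurable_fst).const_div _).sqrt.mul (by fun_prop))

/-- The odds that the sample of the arm `l` falls below `y`, counted only when the arm `l` is
pulled in round `t + 1`. -/
noncomputable def pulledOdds (μ : Fin K → Θ → ℝ) (α β σ : ℝ) (τ : ℕ → Finset (Fin K) → Fin K)
    (l : Fin K) (y : ℝ) (t : ℕ) (p : History K × (Fin K → ℝ)) : ENNReal :=
  if tsArm μ α β σ τ t p = l then sampleOdds β σ y (empMean p.1.1 p.1.2 l) (p.1.2 l) else 0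

lemma measurable_pulledOdds (l : Fin K) (y : ℝ) (t : ℕ) :
    Measurable (pulledOdds μ α β σ τ l y t) :=
  Measurable.ite (measurable_tsArm t (measurableSet_singleton l))
    (measurable_sampleOdds_comp
      ((measurable_pi_iff.1 measurable_empMean_history l).comp measurable_fst)
      (measurable_pi_iff.1 (measurable_snd.comp measurable_fst) l) y) measurable_const

lemma noiseLaw_tsArm_le (hβ : 0 < β) (hσ : 0 < σ) (hτ : IsTieBreaking τ) (hne : ks ≠ k) (t : ℕ)
    {u : History K} (hk : u.2 k ≠ 0)
    (hks : ks ∈ competitiveSet μ α σ t u.2 (empMean u.1 u.2)) (ylo : EReal) (y : ℝ) {q : ENNReal}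
    (hq : ∀ b, gaussianReal 0 1
      ({r | ylo < ((empMean u.1 u.2 k + √(β * σ ^ 2 / u.2 k) * r : ℝ) : EReal)} ∩ Set.Iic b)
        ≤ q * gaussCdf b) :
    noiseLaw K {v | tsArm μ α β σ τ t (u, v) = k ∧ ylo < (tsValue β σ k (u, v) : EReal) ∧
        tsValue β σ k (u, v) ≤ y}
      ≤ q * ∫⁻ v, pulledOdds μ α β σ τ ks y t (u, v) ∂(noiseLaw K) := by
  have hpulled : ∫⁻ v, pulledOdds μ α β σ τ ks y t (u, v) ∂(noiseLaw K)
      = sampleOdds β σ y (empMean u.1 u.2 ks) (u.2 ks) *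
        noiseLaw K {v | tsArm μ α β σ τ t (u, v) = ks} := by
    have hset : MeasurableSet {v | tsArm μ α β σ τ t (u, v) = ks} :=
      measurable_prodMk_left (measurable_tsArm t (measurableSet_singleton ks))
    rw [← lintegral_indicator_const hset]
    exact lintegral_congr fun v => by
      simp only [pulledOdds, Set.indicator_apply, Set.mem_ofPred_eq]
  rw [hpulled, ← mul_assoc]
  exact noiseLaw_nextArm_le hβ hσ hτ hne hks hk y hq

variable {ν : Fin K → Measure ℝ} {Ω : Type*} [MeasurableSpace Ω] {P : Measure Ω}
  {X : Fin K → ℕ → Ω → ℝ} {G : ℕ → Fin K → Ω → ℝ}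

/-- The data from which TS-C determines the arm of round `t + 1`. -/
noncomputable def tsRound (μ : Fin K → Θ → ℝ) (α β σ : ℝ) (τ : ℕ → Finset (Fin K) → Fin K)
    (X : Fin K → ℕ → Ω → ℝ) (G : ℕ → Fin K → Ω → ℝ) (t : ℕ) (ω : Ω) : History K × (Fin K → ℝ) :=
  (tsHistory μ α β σ τ X G t ω, fun l => G t l ω)

lemma measurable_tsRound (hX : IsRewardTable P ν X) (hG : IsSamplingNoise P X G) (t : ℕ) :
    Measurable (tsRound μ α β σ τ X G t) :=
  (measurable_tsHistory hX hG t).prodMk (measurable_pi_lambda _ fun l => hG.measurable t l)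

variable [IsProbabilityMeasure P]

lemma measure_preimage_tsRound (hX : IsRewardTable P ν X) (hG : IsSamplingNoise P X G) (t : ℕ)
    {D : Set (History K × (Fin K → ℝ))} (hD : MeasurableSet D) :
    P (tsRound μ α β σ τ X G t ⁻¹' D)
      = ∫⁻ ω, noiseLaw K (Prod.mk (tsHistory μ α β σ τ X G t ω) ⁻¹' D) ∂P := by
  rw [← lintegral_indicator_one (measurable_tsRound hX hG t hD)]
  refine (lintegral_tsHistory_noise hX hG t (measurable_one.indicator hD)).trans ?_
  exact lintegral_congr fun ω => lintegral_indicator_one (measurable_prodMk_left hD)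

lemma lintegral_pulledOdds (hX : IsRewardTable P ν X) (hG : IsSamplingNoise P X G) (l : Fin K)
    (y : ℝ) (t : ℕ) :
    ∫⁻ ω, pulledOdds μ α β σ τ l y t (tsRound μ α β σ τ X G t ω) ∂P
      = ∫⁻ ω, ∫⁻ v, pulledOdds μ α β σ τ l y t (tsHistory μ α β σ τ X G t ω, v) ∂(noiseLaw K) ∂P :=
  lintegral_tsHistory_noise hX hG t (measurable_pulledOdds l y t)

lemma measure_layer_le (hβ : 0 < β) (hσ : 0 < σ) (hτ : IsTieBreaking τ) (hne : ks ≠ k)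
    (hX : IsRewardTable P ν X) (hG : IsSamplingNoise P X G) (t : ℕ)
    {H : Set (History K)} (hH : MeasurableSet H) (ylo : EReal) (y : ℝ) {q : ENNReal}
    (hq_top : q ≠ ⊤) (hHk : ∀ u ∈ H, u.2 k ≠ 0)
    (hHs : ∀ u ∈ H, ks ∈ competitiveSet μ α σ t u.2 (empMean u.1 u.2))
    (hq : ∀ u ∈ H, ∀ b, gaussianReal 0 1
      ({r | ylo < ((empMean u.1 u.2 k + √(β * σ ^ 2 / u.2 k) * r : ℝ) : EReal)} ∩ Set.Iic b)
        ≤ q * gaussCdf b) :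
    P (tsRound μ α β σ τ X G t ⁻¹' {p | p.1 ∈ H ∧ tsArm μ α β σ τ t p = k ∧
        ylo < (tsValue β σ k p : EReal) ∧ tsValue β σ k p ≤ y})
      ≤ q * ∫⁻ ω, pulledOdds μ α β σ τ ks y t (tsRound μ α β σ τ X G t ω) ∂P := by
  have hvalue := measurable_tsValue (β := β) (σ := σ) k
  have hlayer : MeasurableSet {p | p.1 ∈ H ∧ tsArm μ α β σ τ t p = k ∧
      ylo < (tsValue β σ k p : EReal) ∧ tsValue β σ k p ≤ y} :=
    (measurable_fst hH).inter (((measurable_tsArm t) (measurableSet_singleton k)).inter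
      ((measurableSet_lt measurable_const (measurable_coe_real_ereal.comp hvalue)).inter
        (measurableSet_le hvalue measurable_const)))
  rw [measure_preimage_tsRound hX hG t hlayer, lintegral_pulledOdds hX hG,
    ← lintegral_const_mul' q _ hq_top]
  refine lintegral_mono fun ω => ?_
  by_cases hu : tsHistory μ α β σ τ X G t ω ∈ H
  · refine (measure_mono ?_).trans
      (noiseLaw_tsArm_le hβ hσ hτ hne t (hHk _ hu) (hHs _ hu) ylo y (hq _ hu))
    exact fun v hv => hv.2
  · exact (measure_mono fun v hv => hu hv.1).trans (measure_empty.trans_le zero_le)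

lemma measure_top_layer_le (hX : IsRewardTable P ν X) (hG : IsSamplingNoise P X G) (t : ℕ)
    {H : Set (History K)} (hH : MeasurableSet H) (y : ℝ) {q : ENNReal}
    (hq : ∀ u ∈ H, gaussianReal 0 1
      {r | y < empMean u.1 u.2 k + √(β * σ ^ 2 / u.2 k) * r} ≤ q) :
    P (tsRound μ α β σ τ X G t ⁻¹' {p | p.1 ∈ H ∧ y < tsValue β σ k p}) ≤ q := by
  have htop : MeasurableSet {p | p.1 ∈ H ∧ y < tsValue β σ k p} :=
    (measurable_fst hH).inter (measurableSet_lt measurable_const (measurable_tsValue k))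
  rw [measure_preimage_tsRound hX hG t htop]
  refine (lintegral_mono (g := fun _ => q) fun ω => ?_).trans
    (by rw [lintegral_const, measure_univ, mul_one])
  by_cases hu : tsHistory μ α β σ τ X G t ω ∈ H
  · refine le_trans ?_ (hq _ hu)
    rw [← noiseLaw_setOf_mem k (measurableSet_lt measurable_const (by fun_prop))]
    exact measure_mono fun v hv => hv.2
  · exact (measure_mono fun v hv => hu hv.1).trans (measure_empty.trans_le zero_le)

end Thompson

section Decomposition

variable {K : ℕ} {Θ : Type*} {μ : Fin K → Θ → ℝ} {θ : Θ} {ks k : Fin K} {α β σ : ℝ}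
  {τ : ℕ → Finset (Fin K) → Fin K}

/-- The histories for which the true parameter is in the confidence set, the arm `k` has been
pulled at least `max L 1` times, and its empirical mean is less than `c`. -/
def typicalHistory (μ : Fin K → Θ → ℝ) (θ : Θ) (α σ : ℝ) (k : Fin K) (L c : ℝ) (t : ℕ) :
    Set (History K) :=
  {u | θ ∈ confSet μ α σ t u.2 (empMean u.1 u.2) ∧ max L 1 ≤ u.2 k ∧ empMean u.1 u.2 k < c}

lemma measurableSet_typicalHistory (L c : ℝ) (t : ℕ) :
    MeasurableSet (typicalHistory μ θ α σ k L c t) := by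
  have hconf : Measurable fun p : (Fin K → ℝ) × (Fin K → ℕ) => θ ∈ confSet μ α σ t p.2 p.1 :=
    measurable_from_prod_countable_left fun n =>
      measurableSet_setOfPred.1 (isOpen_mem_confSet θ t n).measurableSet
  exact (measurableSet_setOfPred.2
      (hconf.comp (measurable_empMean_history.prodMk measurable_snd))).inter
    ((measurableSet_le measurable_const (measurable_natCast_pulls k)).inter
      (measurableSet_lt (measurable_pi_iff.1 measurable_empMean_history k) measurable_const))

lemma one_le_of_mem_typicalHistory {L c : ℝ} {t : ℕ} {u : History K}
    (hu : u ∈ typicalHistory μ θ α σ k L c t) : (1 : ℝ) ≤ u.2 k :=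
  (le_max_right _ _).trans hu.2.1

lemma ne_zero_of_mem_typicalHistory {L c : ℝ} {t : ℕ} {u : History K}
    (hu : u ∈ typicalHistory μ θ α σ k L c t) : u.2 k ≠ 0 :=
  Nat.cast_ne_zero.1 (zero_lt_one.trans_le (one_le_of_mem_typicalHistory hu)).ne'

lemma setOf_lt_add_mul {y m s : ℝ} (hs : 0 < s) :
    {r : ℝ | y < m + s * r} = Set.Ioi ((y - m) / s) := by
  ext r
  rw [Set.mem_Ioi, div_lt_iff₀ hs, Set.mem_ofPred_eq, sub_lt_iff_lt_add', mul_comm]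

/-- The mean reward level that lies `a` gaps below the best mean. -/
noncomputable def level (μ : Fin K → Θ → ℝ) (θ : Θ) (ks k : Fin K) (a : ℝ) : ℝ :=
  μ ks θ - a * gap μ θ ks k

lemma exists_setOf_level_lt_eq_Ioi (hβ : 0 < β) (hσ : 0 < σ) (hgap : 0 < gap μ θ ks k)
    {r a b : ℝ} (hab : a + b ≤ 1) {t : ℕ} {u : History K}
    (hu : u ∈ typicalHistory μ θ α σ k (β * σ ^ 2 / gap μ θ ks k ^ 2 * r ^ 2)
      (μ k θ + b * gap μ θ ks k) t) :
    ∃ c, (1 - a - b) * r ≤ c ∧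
      {z : ℝ | level μ θ ks k a < empMean u.1 u.2 k + √(β * σ ^ 2 / u.2 k) * z} = Set.Ioi c := by
  have hn : (0 : ℝ) < u.2 k := zero_lt_one.trans_le (one_le_of_mem_typicalHistory hu)
  have hs : 0 < √(β * σ ^ 2 / u.2 k) := by positivity
  refine ⟨_, (le_div_iff₀ hs).2 ?_, setOf_lt_add_mul hs⟩
  have hscale : r * √(β * σ ^ 2 / u.2 k) ≤ gap μ θ ks k := by
    have hpulls : β * σ ^ 2 / gap μ θ ks k ^ 2 * r ^ 2 ≤ u.2 k := (le_max_left _ _).trans hu.2.1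
    refine (abs_le_of_sq_le_sq' ?_ hgap.le).2
    rw [mul_pow, Real.sq_sqrt (by positivity), ← mul_div_assoc, div_le_iff₀ hn]
    rw [div_mul_eq_mul_div, div_le_iff₀ (by positivity)] at hpulls
    linarith
  calc (1 - a - b) * r * √(β * σ ^ 2 / u.2 k)
      = (1 - a - b) * (r * √(β * σ ^ 2 / u.2 k)) := by ring
    _ ≤ (1 - a - b) * gap μ θ ks k := by gcongr; linarith
    _ = level μ θ ks k a - (μ k θ + b * gap μ θ ks k) := by unfold level gap; ring
    _ ≤ level μ θ ks k a - empMean u.1 u.2 k := sub_le_sub_left hu.2.2.le _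

/-- The rounds in which TS-C pulls the arm `k` after a typical history. -/
def typicalPull (μ : Fin K → Θ → ℝ) (θ : Θ) (α β σ : ℝ) (τ : ℕ → Finset (Fin K) → Fin K)
    (k : Fin K) (L c : ℝ) (t : ℕ) : Set (History K × (Fin K → ℝ)) :=
  {p | p.1 ∈ typicalHistory μ θ α σ k L c t ∧ tsArm μ α β σ τ t p = k}

lemma measurableSet_typicalPull (L c : ℝ) (t : ℕ) :
    MeasurableSet (typicalPull μ θ α β σ τ k L c t) :=
  (measurable_fst (measurableSet_typicalHistory L c t)).inter
    (measurable_tsArm t (measurableSet_singleton k))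

variable {ν : Fin K → Measure ℝ} {Ω : Type*} {X : Fin K → ℕ → Ω → ℝ} {G : ℕ → Fin K → Ω → ℝ}

/-- The event that, for an `n` of at least `max L 1`, the mean of the first `n` rewards of the arm
`k` exceeds its expectation by at least `δ`; stated for the sum, as in `badEvent`. -/
def overestimateEvent (μ : Fin K → Θ → ℝ) (θ : Θ) (X : Fin K → ℕ → Ω → ℝ) (k : Fin K) (L δ : ℝ)
    (n : ℕ) : Set Ω :=
  {ω | max L 1 ≤ (n : ℝ) ∧ n * δ ≤ sumDev (fun m => X k m ω) (μ k θ) n}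

lemma one_le_indicator_sum_of_armAt {σ : ℝ≥0} {L δ : ℝ} {t : ℕ} {ω : Ω}
    (harm : tsArm μ α β σ τ t (tsRound μ α β σ τ X G t ω) = k) :
    (1 : ENNReal) ≤ (badEvent μ θ α σ X t).indicator 1 ω
      + ((if ((tsHistory μ α β σ τ X G t ω).2 k : ℝ) < max L 1 then (1 : ENNReal) else 0)
        + (overestimateEvent μ θ X k L δ ((tsHistory μ α β σ τ X G t ω).2 k)).indicator 1 ω)
      + (tsRound μ α β σ τ X G t ⁻¹'
          typicalPull μ θ α β σ τ k L (μ k θ + δ) t).indicator 1 ω := by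
  set u := tsHistory μ α β σ τ X G t ω
  by_cases hbad : ω ∈ badEvent μ θ α σ X t
  · simp [hbad, add_assoc]
  rcases lt_or_ge (u.2 k : ℝ) (max L 1) with hfew | hmany
  · simp [hfew, add_assoc, add_left_comm _ (1 : ENNReal)]
  by_cases hover : ω ∈ overestimateEvent μ θ X k L δ (u.2 k)
  · simp [hover, add_assoc, add_left_comm _ (1 : ENNReal)]
  have hpos : (0 : ℝ) < u.2 k := zero_lt_one.trans_le ((le_max_right _ _).trans hmany)
  have hmean : empMean u.1 u.2 k < μ k θ + δ := by
    have hdev : sumDev (u.1 k) (μ k θ) (u.2 k) < u.2 k * δ :=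
      not_le.1 fun h => hover ⟨hmany, h⟩
    rw [← sub_lt_iff_lt_add', empMean_sub_eq_sumDev_div (Nat.cast_ne_zero.1 hpos.ne'),
      div_lt_iff₀ hpos]
    linarith
  have htypical : ω ∈ tsRound μ α β σ τ X G t ⁻¹'
      typicalPull μ θ α β σ τ k L (μ k θ + δ) t :=
    ⟨⟨mem_confSet_of_notMem_badEvent (pulls_le t) hbad, hmany, hmean⟩, harm⟩
  simp [htypical]

lemma tscPulls_le {σ : ℝ≥0} {L : ℝ} (hL : 0 ≤ L) (δ : ℝ) (T : ℕ) (ω : Ω) :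
    (tscPulls μ α β σ τ (fun l m => X l m ω) (fun s l => G s l ω) T k : ENNReal)
      ≤ ∑ t ∈ Finset.range T, (badEvent μ θ α σ X t).indicator 1 ω
        + (ENNReal.ofReal (L + 1)
          + ∑ n ∈ Finset.range T, (overestimateEvent μ θ X k L δ n).indicator 1 ω)
        + ∑ t ∈ Finset.range T, (tsRound μ α β σ τ X G t ⁻¹'
            typicalPull μ θ α β σ τ k L (μ k θ + δ) t).indicator 1 ω := by
  set x : Fin K → ℕ → ℝ := fun l m => X l m ω
  set I := tsSample (K := K) β σ fun s l => G s l ω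
  set n := pulls μ α σ τ I x
  set f : ℕ → ENNReal := fun j => (if (j : ℝ) < max L 1 then (1 : ENNReal) else 0)
    + (overestimateEvent μ θ X k L δ j).indicator 1 ω with hf
  calc (n T k : ENNReal)
      = ∑ t ∈ Finset.range T, (if armAt μ α σ τ I x t = k then (1 : ENNReal) else 0) := by
        simp only [n, pulls_eq_sum, Nat.cast_sum, Nat.cast_ite, Nat.cast_one, Nat.cast_zero]
    _ ≤ ∑ t ∈ Finset.range T, ((badEvent μ θ α σ X t).indicator 1 ω
          + (if armAt μ α σ τ I x t = k then f (n t k) else 0)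
          + (tsRound μ α β σ τ X G t ⁻¹'
              typicalPull μ θ α β σ τ k L (μ k θ + δ) t).indicator 1 ω) := by
        refine Finset.sum_le_sum fun t _ => ?_
        split_ifs with harm
        · exact one_le_indicator_sum_of_armAt harm
        · exact zero_le
    _ = ∑ t ∈ Finset.range T, (badEvent μ θ α σ X t).indicator 1 ω
        + ∑ j ∈ Finset.range (n T k), f j
        + ∑ t ∈ Finset.range T, (tsRound μ α β σ τ X G t ⁻¹'
            typicalPull μ θ α β σ τ k L (μ k θ + δ) t).indicator 1 ω := by
        rw [Finset.sum_add_distrib, Finset.sum_add_distrib, ← sum_ite_armAt_eq_sum_range]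
    _ ≤ _ := by
        rw [hf, Finset.sum_add_distrib]
        gcongr
        · exact sum_ite_natCast_lt_max_one_le hL _
        · exact pulls_le T k

variable [MeasurableSpace Ω] {P : Measure Ω}

lemma measurable_tscPulls_comp (hX : IsRewardTable P ν X) (hG : IsSamplingNoise P X G) (T : ℕ) :
    Measurable fun ω => tscPulls μ α β σ τ (fun l m => X l m ω) (fun s l => G s l ω) T k :=
  measurable_pi_iff.1 (measurable_tscPulls (x := fun ω l m => X l m ω)
    (g := fun ω s l => G s l ω) hX.measurable hG.measurable T) k

lemma measurableSet_overestimateEvent (hX : IsRewardTable P ν X) (L δ : ℝ) (n : ℕ) :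
    MeasurableSet (overestimateEvent μ θ X k L δ n) :=
  (MeasurableSet.const _).inter (measurableSet_le measurable_const (measurable_sumDev hX k _ n))

/-- The total expected odds that the sample of an arm with rewards `x` lies below `y`, over its
first `T` numbers of pulls. -/
noncomputable def totalOdds (P : Measure Ω) (β σ : ℝ) (x : ℕ → Ω → ℝ) (y : ℝ) (T : ℕ) : ENNReal :=
  ∑ j ∈ Finset.range T, ∫⁻ ω, sampleOdds β σ y ((∑ m ∈ Finset.range j, x m ω) / j) j ∂P

lemma sum_lintegral_pulledOdds_le (hX : IsRewardTable P ν X) (hG : IsSamplingNoise P X G)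
    (y : ℝ) (T : ℕ) :
    ∑ t ∈ Finset.range T,
        ∫⁻ ω, pulledOdds μ α β σ τ ks y t (tsRound μ α β σ τ X G t ω) ∂P
      ≤ totalOdds P β σ (X ks) y T := by
  have hodds : ∀ j, Measurable fun ω =>
      sampleOdds β σ y ((∑ m ∈ Finset.range j, X ks m ω) / j) j := fun j =>
    (measurable_sampleOdds y j).comp
      ((Finset.measurable_sum _ fun m _ => hX.measurable ks m).div_const _)
  have hpulled : ∀ t, Measurable fun ω =>
      pulledOdds μ α β σ τ ks y t (tsRound μ α β σ τ X G t ω) := fun t =>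
    (measurable_pulledOdds ks y t).comp (measurable_tsRound hX hG t)
  rw [totalOdds, ← lintegral_finsetSum _ fun t _ => hpulled t,
    ← lintegral_finsetSum _ fun j _ => hodds j]
  refine lintegral_mono fun ω => ?_
  have hcount := sum_ite_armAt_eq_sum_range (μ := μ) (α := α) (σ := σ) (τ := τ)
    (I := tsSample β σ fun s l => G s l ω) (x := fun l m => X l m ω)
    (fun j => sampleOdds β σ y ((∑ m ∈ Finset.range j, X ks m ω) / j) j) T ks
  exact hcount.le.trans (Finset.sum_le_sum_of_subset (Finset.range_subset_range.2 (pulls_le T ks)))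

variable [IsProbabilityMeasure P]

lemma measure_overestimateEvent_le {σ : ℝ≥0} (hX : IsRewardTable P ν X)
    (hsubG : ∀ l, HasSubgaussianMGF (fun r => r - μ l θ) (σ ^ 2) (ν l)) (L : ℝ) {δ : ℝ}
    (hδ : 0 ≤ δ) (n : ℕ) :
    P (overestimateEvent μ θ X k L δ n) ≤ if max L 1 ≤ (n : ℝ) then
      ENNReal.ofReal (Real.exp (-(n * δ ^ 2 / (2 * σ ^ 2)))) else 0 := by
  split_ifs with hn
  · have hn0 : n ≠ 0 := Nat.cast_ne_zero.1
      (zero_lt_one.trans_le ((le_max_right L 1).trans hn)).ne'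
    exact (measure_mono fun ω hω => hω.2).trans (measure_sumDev_ge_le hX hsubG k hn0 hδ)
  · exact (measure_mono fun ω hω => hn hω.1).trans measure_empty.le

lemma sum_measure_typicalPull_below_level_le (hks : IsBestAt μ ks θ) (hgap : 0 < gap μ θ ks k)
    (hβ : 0 < β) (hσ : 0 < σ) (hτ : IsTieBreaking τ) (hX : IsRewardTable P ν X)
    (hG : IsSamplingNoise P X G) {r b : ℝ} {a : ℕ → ℝ} (hab : ∀ j, a j + b ≤ 1) (T J : ℕ) :
    ∑ t ∈ Finset.range T, P (tsRound μ α β σ τ X G t ⁻¹'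
        {p | p ∈ typicalPull μ θ α β σ τ k (β * σ ^ 2 / gap μ θ ks k ^ 2 * r ^ 2)
          (μ k θ + b * gap μ θ ks k) t ∧ tsValue β σ k p ≤ level μ θ ks k (a J)})
      ≤ totalOdds P β σ (X ks) (level μ θ ks k (a 0)) T
        + ∑ j ∈ Finset.range J, gaussTail ((1 - a j - b) * r) *
            totalOdds P β σ (X ks) (level μ θ ks k (a (j + 1))) T := by
  have hne : ks ≠ k := by
    rintro rfl
    simp [gap] at hgap
  set H := typicalHistory μ θ α σ k (β * σ ^ 2 / gap μ θ ks k ^ 2 * r ^ 2)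
    (μ k θ + b * gap μ θ ks k)
  have hlayer : ∀ (ylo : EReal) (y : ℝ) (q : ENNReal), q ≠ ⊤ → (∀ t, ∀ u ∈ H t, ∀ c,
      gaussianReal 0 1 ({z | ylo < ((empMean u.1 u.2 k + √(β * σ ^ 2 / u.2 k) * z : ℝ) : EReal)}
        ∩ Set.Iic c) ≤ q * gaussCdf c) →
      ∑ t ∈ Finset.range T, P (tsRound μ α β σ τ X G t ⁻¹' {p | p.1 ∈ H t ∧
        tsArm μ α β σ τ t p = k ∧ ylo < (tsValue β σ k p : EReal) ∧ tsValue β σ k p ≤ y})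
      ≤ q * totalOdds P β σ (X ks) y T := fun ylo y q hq_top hq => by
    refine (Finset.sum_le_sum fun t _ => measure_layer_le hβ hσ hτ hne hX hG t
      (measurableSet_typicalHistory _ _ t) ylo y hq_top (fun u => ne_zero_of_mem_typicalHistory)
      (fun u hu => mem_competitiveSet_of_mem_confSet hu.1 hks) (hq t)).trans ?_
    rw [← Finset.mul_sum]
    gcongr
    exact sum_lintegral_pulledOdds_le hX hG y T
  induction J with
  | zero =>
    rw [Finset.sum_range_zero, add_zero, ← one_mul (totalOdds _ _ _ _ _ _)]
    refine le_trans (Finset.sum_le_sum fun t _ => measure_mono fun ω hω => ?_)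
      (hlayer ⊥ _ 1 ENNReal.one_ne_top fun t u _ c => ?_)
    · exact ⟨hω.1.1, hω.1.2, EReal.bot_lt_coe _, hω.2⟩
    · rw [one_mul]
      exact measure_mono Set.inter_subset_right
  | succ J ih =>
    rw [Finset.sum_range_succ, ← add_assoc]
    refine le_trans ?_ (add_le_add ih (hlayer (level μ θ ks k (a J)) _ _ (gaussTail_ne_top _)
      fun t u hu c => ?_))
    · rw [← Finset.sum_add_distrib]
      refine Finset.sum_le_sum fun t _ => (measure_mono fun ω hω => ?_).trans (measure_union_le _ _)
      rcases le_or_gt (tsValue β σ k (tsRound μ α β σ τ X G t ω)) (level μ θ ks k (a J)) with h | h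
      · exact Or.inl ⟨hω.1, h⟩
      · exact Or.inr ⟨hω.1.1, hω.1.2, EReal.coe_lt_coe_iff.2 h, hω.2⟩
    · obtain ⟨d, hd, hset⟩ := exists_setOf_level_lt_eq_Ioi hβ hσ hgap (hab J) hu
      simp only [EReal.coe_lt_coe_iff]
      rw [hset]
      exact (measure_Ioi_inter_Iic_le _ _ _).trans
        (mul_le_mul_left (gaussTail_antitone hd) _)

lemma sum_measure_typicalPull_le (hks : IsBestAt μ ks θ) (hgap : 0 < gap μ θ ks k)
    (hβ : 0 < β) (hσ : 0 < σ) (hτ : IsTieBreaking τ) (hX : IsRewardTable P ν X)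
    (hG : IsSamplingNoise P X G) {r b : ℝ} {a : ℕ → ℝ} (hab : ∀ j, a j + b ≤ 1) (T J : ℕ) :
    ∑ t ∈ Finset.range T, P (tsRound μ α β σ τ X G t ⁻¹'
        typicalPull μ θ α β σ τ k (β * σ ^ 2 / gap μ θ ks k ^ 2 * r ^ 2)
          (μ k θ + b * gap μ θ ks k) t)
      ≤ totalOdds P β σ (X ks) (level μ θ ks k (a 0)) T
        + ∑ j ∈ Finset.range J, gaussTail ((1 - a j - b) * r) *
            totalOdds P β σ (X ks) (level μ θ ks k (a (j + 1))) T
        + T * gaussTail ((1 - a J - b) * r) := by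
  set H := typicalHistory μ θ α σ k (β * σ ^ 2 / gap μ θ ks k ^ 2 * r ^ 2)
    (μ k θ + b * gap μ θ ks k)
  have htop : ∀ t, P (tsRound μ α β σ τ X G t ⁻¹'
      {p | p.1 ∈ H t ∧ level μ θ ks k (a J) < tsValue β σ k p})
        ≤ gaussTail ((1 - a J - b) * r) := fun t =>
    measure_top_layer_le hX hG t (measurableSet_typicalHistory _ _ t) _ fun u hu => by
      obtain ⟨d, hd, hset⟩ := exists_setOf_level_lt_eq_Ioi hβ hσ hgap (hab J) hu
      rw [hset]
      exact gaussTail_antitone hd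
  have hbelow := sum_measure_typicalPull_below_level_le (α := α) hks hgap hβ hσ hτ hX hG (r := r)
    hab T J
  have htops := Finset.sum_le_card_nsmul (Finset.range T) _ _ fun t _ => htop t
  rw [Finset.card_range, nsmul_eq_mul] at htops
  refine le_trans ?_ (add_le_add hbelow htops)
  rw [← Finset.sum_add_distrib]
  refine Finset.sum_le_sum fun t _ => (measure_mono fun ω hω => ?_).trans (measure_union_le _ _)
  rcases le_or_gt (tsValue β σ k (tsRound μ α β σ τ X G t ω)) (level μ θ ks k (a J)) with h | h
  · exact Or.inl ⟨hω, h⟩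
  · exact Or.inr ⟨hω.1, h⟩

lemma lintegral_tscPulls_le {σ : ℝ≥0} (hks : IsBestAt μ ks θ) (hgap : 0 < gap μ θ ks k)
    (hβ : 0 < β) (hσ : 0 < σ) (hτ : IsTieBreaking τ) (hX : IsRewardTable P ν X)
    (hG : IsSamplingNoise P X G)
    (hsubG : ∀ l, HasSubgaussianMGF (fun r => r - μ l θ) (σ ^ 2) (ν l))
    {κ r b : ℝ} (hκ : κ = β * σ ^ 2 / gap μ θ ks k ^ 2) (hb : 0 ≤ b)
    {a : ℕ → ℝ} (hab : ∀ j, a j + b ≤ 1) (T J : ℕ) :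
    ∫⁻ ω, (tscPulls μ α β σ τ (fun l m => X l m ω) (fun s l => G s l ω) T k : ENNReal) ∂P
      ≤ ∑ t ∈ Finset.range T, P (badEvent μ θ α σ X t)
        + (ENNReal.ofReal (κ * r ^ 2 + 1)
          + ∑ n ∈ Finset.range T, (if max (κ * r ^ 2) 1 ≤ (n : ℝ) then
              ENNReal.ofReal (Real.exp (-(n * (b * gap μ θ ks k) ^ 2 / (2 * σ ^ 2)))) else 0))
        + (totalOdds P β σ (X ks) (level μ θ ks k (a 0)) T
          + ∑ j ∈ Finset.range J, gaussTail ((1 - a j - b) * r) *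
              totalOdds P β σ (X ks) (level μ θ ks k (a (j + 1))) T
          + T * gaussTail ((1 - a J - b) * r)) := by
  subst hκ
  set L := β * (σ : ℝ) ^ 2 / gap μ θ ks k ^ 2 * r ^ 2
  set δ := b * gap μ θ ks k
  have hindicator : ∀ {B : Set Ω}, MeasurableSet B → Measurable (B.indicator (1 : Ω → ENNReal)) :=
    measurable_one.indicator
  have hbad := fun t => measurableSet_badEvent (μ := μ) (θ := θ) (α := α) (σ := σ) hX t
  have hover := fun n => measurableSet_overestimateEvent (μ := μ) (θ := θ) (k := k) hX L δ n
  have hpull : ∀ t, MeasurableSet (tsRound μ α β σ τ X G t ⁻¹'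
      typicalPull μ θ α β σ τ k L (μ k θ + δ) t) := fun t =>
    measurable_tsRound hX hG t (measurableSet_typicalPull _ _ t)
  calc _ ≤ ∫⁻ ω, (∑ t ∈ Finset.range T, (badEvent μ θ α σ X t).indicator 1 ω
        + (ENNReal.ofReal (L + 1)
          + ∑ n ∈ Finset.range T, (overestimateEvent μ θ X k L δ n).indicator 1 ω)
        + ∑ t ∈ Finset.range T, (tsRound μ α β σ τ X G t ⁻¹'
            typicalPull μ θ α β σ τ k L (μ k θ + δ) t).indicator 1 ω) ∂P :=
        lintegral_mono (tscPulls_le (by positivity) δ T)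
    _ = ∑ t ∈ Finset.range T, P (badEvent μ θ α σ X t)
        + (ENNReal.ofReal (L + 1) + ∑ n ∈ Finset.range T, P (overestimateEvent μ θ X k L δ n))
        + ∑ t ∈ Finset.range T, P (tsRound μ α β σ τ X G t ⁻¹'
            typicalPull μ θ α β σ τ k L (μ k θ + δ) t) := by
      rw [lintegral_add_right _ (Finset.measurable_sum _ fun t _ => hindicator (hpull t)),
        lintegral_add_left (Finset.measurable_sum _ fun t _ => hindicator (hbad t)),
        lintegral_add_left measurable_const, lintegral_const, measure_univ, mul_one,
        lintegral_finsetSum _ fun t _ => hindicator (hpull t),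
        lintegral_finsetSum _ fun t _ => hindicator (hbad t),
        lintegral_finsetSum _ fun n _ => hindicator (hover n)]
      simp only [lintegral_indicator_one (hpull _), lintegral_indicator_one (hbad _),
        lintegral_indicator_one (hover _)]
    _ ≤ _ := by
      gcongr with n
      · exact measure_overestimateEvent_le hX hsubG L (by positivity) n
      · exact sum_measure_typicalPull_le hks hgap hβ hσ hτ hX hG hab T J

end Decomposition

section TotalOdds

lemma lintegral_Ioi_mul_exp_neg {d : ℝ} (hd : 0 < d) :
    ∫⁻ s in Set.Ioi (1 : ℝ), ENNReal.ofReal ((s + 5 / 4) * Real.exp (-(d * s)))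
      = ENNReal.ofReal (Real.exp (-d) * (1 / d ^ 2 + 9 / 4 / d)) := by
  set g : ℝ → ℝ := fun s => -(((s + 5 / 4) / d + 1 / d ^ 2) * Real.exp (-(d * s))) with hg
  have hder : ∀ s ∈ Set.Ici (1 : ℝ), HasDerivAt g ((s + 5 / 4) * Real.exp (-(d * s))) s := by
    intro s _
    have hlin : HasDerivAt (fun s : ℝ => (s + 5 / 4) / d + 1 / d ^ 2) (1 / d) s :=
      (((hasDerivAt_id s).add_const _).div_const d).add_const _
    have hexp : HasDerivAt (fun s : ℝ => Real.exp (-(d * s))) (Real.exp (-(d * s)) * -(d * 1)) s :=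
      (((hasDerivAt_id s).const_mul d).neg).exp
    refine (hlin.mul hexp).neg.congr_deriv ?_
    field_simp
    ring
  have hpos : ∀ s ∈ Set.Ioi (1 : ℝ), 0 ≤ (s + 5 / 4) * Real.exp (-(d * s)) := by
    intro s hs
    have : (1 : ℝ) < s := hs
    positivity
  have hlim : Tendsto g atTop (nhds 0) := by
    have hlinear := tendsto_rpow_mul_exp_neg_mul_atTop_nhds_zero 1 d hd
    have hconst := tendsto_rpow_mul_exp_neg_mul_atTop_nhds_zero 0 d hd
    have hsum := ((hlinear.const_mul (1 / d)).add (hconst.const_mul (5 / 4 / d + 1 / d ^ 2))).neg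
    simp only [mul_zero, add_zero, neg_zero] at hsum
    refine hsum.congr fun s => ?_
    simp only [hg, Real.rpow_one, Real.rpow_zero, neg_mul]
    ring
  rw [← ofReal_integral_eq_lintegral_ofReal
    (integrableOn_Ioi_deriv_of_nonneg' hder hpos hlim)
    ((ae_restrict_iff' measurableSet_Ioi).2 (Eventually.of_forall hpos)),
    integral_Ioi_of_hasDerivAt_of_nonneg' hder hpos hlim]
  congr 1
  simp only [hg, mul_one]
  ring

lemma lintegral_oddsMajorant_le {Ω : Type*} [MeasurableSpace Ω] {P : Measure Ω} [SFinite P]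
    {W : Ω → ℝ} (hW : Measurable W)
    (hmgf : ∀ s : ℝ, ∫⁻ ω, ENNReal.ofReal (Real.exp (s * W ω)) ∂P
      ≤ ENNReal.ofReal (Real.exp (s ^ 2 / 2))) {d : ℝ} (hd : 0 < d) :
    ∫⁻ ω, oddsMajorant (W ω - d) ∂P
      ≤ ENNReal.ofReal (Real.exp (-d) * (1 / d ^ 2 + 9 / 4 / d)) := by
  unfold oddsMajorant
  rw [lintegral_lintegral_swap]
  · rw [← lintegral_Ioi_mul_exp_neg hd]
    refine setLIntegral_mono (by fun_prop) fun s hs => ?_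
    have : (1 : ℝ) < s := hs
    have hfactor : ∀ ω, ENNReal.ofReal ((s + 5 / 4) * Real.exp (s * (W ω - d) - s ^ 2 / 2))
        = ENNReal.ofReal ((s + 5 / 4) * Real.exp (-(d * s) - s ^ 2 / 2))
          * ENNReal.ofReal (Real.exp (s * W ω)) := fun ω => by
      rw [← ENNReal.ofReal_mul (by positivity), mul_assoc, ← Real.exp_add]
      congr 3
      ring
    simp only [hfactor]
    rw [lintegral_const_mul _ (by fun_prop)]
    refine (mul_le_mul_right (hmgf s) _).trans (le_of_eq ?_)
    rw [← ENNReal.ofReal_mul (by positivity), mul_assoc, ← Real.exp_add]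
    congr 3
    ring
  · refine Measurable.aemeasurable ?_
    unfold Function.uncurry
    fun_prop

/-- The sum over `n` of the bounds for the expected odds of a sample at the normalized distance
`δ √n` below its mean is at most `oddsBound δ / δ ^ 2`. -/
noncomputable def oddsBound (δ : ℝ) : ℝ :=
  Real.exp (-δ) * (1 + 2 * Real.log (1 + 1 / δ) + 9 / 4 * (2 + δ))

lemma sum_exp_neg_mul_sqrt_mul_le {δ : ℝ} (hδ : 0 < δ) (T : ℕ) :
    ∑ i ∈ Finset.range T, Real.exp (-(δ * √((i : ℝ) + 1)))
        * (1 / (δ * √((i : ℝ) + 1)) ^ 2 + 9 / 4 / (δ * √((i : ℝ) + 1)))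
      ≤ 1 / δ ^ 2 * oddsBound δ := by
  have hterm : ∀ i : ℕ, Real.exp (-(δ * √((i : ℝ) + 1)))
      * (1 / (δ * √((i : ℝ) + 1)) ^ 2 + 9 / 4 / (δ * √((i : ℝ) + 1)))
      = 1 / δ ^ 2 * (Real.exp (-(δ * √((i : ℝ) + 1))) / ((i : ℝ) + 1))
        + 9 / 4 / δ * (Real.exp (-(δ * √((i : ℝ) + 1))) / √((i : ℝ) + 1)) := fun i => by
    rw [mul_pow, Real.sq_sqrt (by positivity)]
    field_simp
  simp only [hterm, Finset.sum_add_distrib, ← Finset.mul_sum]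
  calc _ ≤ 1 / δ ^ 2 * (Real.exp (-δ) * (1 + 2 * Real.log (1 + 1 / δ)))
        + 9 / 4 / δ * (Real.exp (-δ) * (1 + 2 / δ)) := by
        gcongr
        · exact sum_exp_neg_sqrt_div_le hδ T
        · exact sum_exp_neg_sqrt_div_sqrt_le hδ T
    _ = _ := by unfold oddsBound; field_simp; ring

lemma sub_mean_div_sqrt_eq {v : ℝ} (hv : 0 < v) {n : ℕ} (hn : n ≠ 0) (x : ℕ → ℝ) (c ε : ℝ) :
    (c - ε - (∑ m ∈ Finset.range n, x m) / n) / √(v / n)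
      = -(1 / √(v * n)) * sumDev x c n - ε / √v * √n := by
  have hn' : (0 : ℝ) < n := by exact_mod_cast Nat.pos_of_ne_zero hn
  have hsum : ∑ m ∈ Finset.range n, x m = sumDev x c n + n * c := by simp [sumDev]
  rw [hsum, Real.sqrt_div hv.le, Real.sqrt_mul hv.le]
  field_simp
  rw [Real.sq_sqrt hn'.le]
  ring

variable {K : ℕ} {Θ : Type*} {μ : Fin K → Θ → ℝ} {θ : Θ} {ks : Fin K} {β : ℝ} {σ : ℝ≥0}
  {ν : Fin K → Measure ℝ} {Ω : Type*} [MeasurableSpace Ω] {P : Measure Ω}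
  [IsProbabilityMeasure P] {X : Fin K → ℕ → Ω → ℝ}

lemma lintegral_exp_mul_sumDev_le (hX : IsRewardTable P ν X)
    (hsubG : ∀ l, HasSubgaussianMGF (fun r => r - μ l θ) (σ ^ 2) (ν l)) (l : Fin K) (n : ℕ)
    (s : ℝ) :
    ∫⁻ ω, ENNReal.ofReal (Real.exp (s * sumDev (fun m => X l m ω) (μ l θ) n)) ∂P
      ≤ ENNReal.ofReal (Real.exp (n * σ ^ 2 * s ^ 2 / 2)) := by
  have h := hasSubgaussianMGF_sumDev (P := P) hX hsubG l n
  rw [← ofReal_integral_eq_lintegral_ofReal (h.integrable_exp_mul s)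
    (Eventually.of_forall fun ω => Real.exp_nonneg _)]
  refine ENNReal.ofReal_le_ofReal ((h.mgf_le s).trans (le_of_eq ?_))
  push_cast
  rfl

lemma lintegral_sampleOdds_le (hβ : 1 ≤ β) (hσ : 0 < σ) (hX : IsRewardTable P ν X)
    (hsubG : ∀ l, HasSubgaussianMGF (fun r => r - μ l θ) (σ ^ 2) (ν l)) {ε : ℝ} (hε : 0 < ε)
    {n : ℕ} (hn : n ≠ 0) {d : ℝ} (hd : d = ε / √(β * σ ^ 2) * √n) :
    ∫⁻ ω, sampleOdds β σ (μ ks θ - ε) ((∑ m ∈ Finset.range n, X ks m ω) / n) n ∂P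
      ≤ ENNReal.ofReal (Real.exp (-d) * (1 / d ^ 2 + 9 / 4 / d)) := by
  have : (0 : ℝ) < σ := NNReal.coe_pos.2 hσ
  have : 0 < β := one_pos.trans_le hβ
  have : (0 : ℝ) < n := by exact_mod_cast Nat.pos_of_ne_zero hn
  have hd0 : 0 < d := by rw [hd]; positivity
  have hmaj : ∀ ω, sampleOdds β σ (μ ks θ - ε) ((∑ m ∈ Finset.range n, X ks m ω) / n) n
      ≤ oddsMajorant (-(1 / √(β * σ ^ 2 * n)) * sumDev (fun m => X ks m ω) (μ ks θ) n - d) := by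
    intro ω
    rw [sampleOdds, if_neg hn, sub_mean_div_sqrt_eq (by positivity) hn, hd]
    exact gaussOdds_le_oddsMajorant _
  refine (lintegral_mono hmaj).trans (lintegral_oddsMajorant_le
    ((measurable_sumDev hX ks _ _).const_mul _) (fun s => ?_) hd0)
  simp only [← mul_assoc]
  refine (lintegral_exp_mul_sumDev_le (P := P) hX hsubG ks n _).trans
    (ENNReal.ofReal_le_ofReal (Real.exp_le_exp.2 ?_))
  have hvar : n * (σ : ℝ) ^ 2 * (s * -(1 / √(β * σ ^ 2 * n))) ^ 2 = s ^ 2 / β := by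
    rw [mul_pow, neg_sq, div_pow, Real.sq_sqrt (by positivity)]
    field_simp
  rw [hvar]
  gcongr
  exact div_le_self (sq_nonneg s) hβ

lemma totalOdds_le (hβ : 1 ≤ β) (hσ : 0 < σ) (hX : IsRewardTable P ν X)
    (hsubG : ∀ l, HasSubgaussianMGF (fun r => r - μ l θ) (σ ^ 2) (ν l)) {ε δ : ℝ} (hε : 0 < ε)
    (hδ : δ = ε / √(β * σ ^ 2)) (T : ℕ) :
    totalOdds P β σ (X ks) (μ ks θ - ε) T ≤ ENNReal.ofReal (1 / δ ^ 2 * oddsBound δ) := by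
  have : (0 : ℝ) < σ := NNReal.coe_pos.2 hσ
  have hδ0 : 0 < δ := by rw [hδ]; positivity
  calc totalOdds P β σ (X ks) (μ ks θ - ε) T
      ≤ totalOdds P β σ (X ks) (μ ks θ - ε) (T + 1) :=
        Finset.sum_le_sum_of_subset (Finset.range_subset_range.2 (Nat.le_succ T))
    _ = ∑ i ∈ Finset.range T, ∫⁻ ω, sampleOdds β σ (μ ks θ - ε)
          ((∑ m ∈ Finset.range (i + 1), X ks m ω) / (i + 1 : ℕ)) (i + 1) ∂P := by
        rw [totalOdds, Finset.sum_range_succ']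
        simp [sampleOdds]
    _ ≤ ∑ i ∈ Finset.range T, ENNReal.ofReal (Real.exp (-(δ * √((i : ℝ) + 1)))
        * (1 / (δ * √((i : ℝ) + 1)) ^ 2 + 9 / 4 / (δ * √((i : ℝ) + 1)))) :=
        Finset.sum_le_sum fun i _ => lintegral_sampleOdds_le hβ hσ hX hsubG hε i.succ_ne_zero
          (by rw [hδ, Nat.cast_succ])
    _ = ENNReal.ofReal (∑ i ∈ Finset.range T, Real.exp (-(δ * √((i : ℝ) + 1)))
        * (1 / (δ * √((i : ℝ) + 1)) ^ 2 + 9 / 4 / (δ * √((i : ℝ) + 1)))) :=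
        (ENNReal.ofReal_sum_of_nonneg fun i _ => by positivity).symm
    _ ≤ _ := ENNReal.ofReal_le_ofReal (sum_exp_neg_mul_sqrt_mul_le hδ0 T)

end TotalOdds

section OddsBound

lemma oddsBound_nonneg {δ : ℝ} (hδ : 0 < δ) : 0 ≤ oddsBound δ := by
  have := Real.log_nonneg (le_add_of_nonneg_right (a := 1) (one_div_pos.2 hδ).le)
  unfold oddsBound
  positivity

/-- A tangent line of the logarithm turns the bound on `oddsBound` into a polynomial inequality. -/
lemma oddsBound_inv_le {Z₀ l p q : ℝ} (hZ₀ : 0 < Z₀) (hl : Real.log (1 + Z₀) ≤ l)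
    (hpoly : ∀ Z : ℝ, 0 < Z →
      (5.5 + 2 * (l - Z₀ / (1 + Z₀))) * Z ^ 2 + 2 * Z ^ 3 / (1 + Z₀) + 2.25 * Z
        ≤ (p + q * Z) * (Z ^ 2 + Z + 1 / 2)) {Z : ℝ} (hZ : 0 < Z) :
    oddsBound (1 / Z) ≤ p + q * Z := by
  have hlog : Real.log (1 + Z) ≤ l + (Z - Z₀) / (1 + Z₀) := by
    have hlog_div := Real.log_le_sub_one_of_pos (x := (1 + Z) / (1 + Z₀)) (by positivity)
    rw [Real.log_div (by positivity) (by positivity)] at hlog_div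
    have : (1 + Z) / (1 + Z₀) - 1 = (Z - Z₀) / (1 + Z₀) := by field_simp; ring
    linarith
  have hexp : Real.exp (-(1 / Z)) ≤ Z ^ 2 / (Z ^ 2 + Z + 1 / 2) := by
    rw [Real.exp_neg, inv_le_comm₀ (Real.exp_pos _) (by positivity), inv_div]
    refine le_trans (le_of_eq ?_) (Real.quadratic_le_exp_of_nonneg (by positivity))
    field_simp
  have hpos : 0 ≤ 1 + 2 * Real.log (1 + Z) + 9 / 4 * (2 + 1 / Z) := by
    have := Real.log_nonneg (show (1 : ℝ) ≤ 1 + Z by linarith)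
    positivity
  unfold oddsBound
  rw [one_div_one_div]
  calc _ ≤ Z ^ 2 / (Z ^ 2 + Z + 1 / 2)
        * (1 + 2 * (l + (Z - Z₀) / (1 + Z₀)) + 9 / 4 * (2 + 1 / Z)) := by gcongr
    _ = ((5.5 + 2 * (l - Z₀ / (1 + Z₀))) * Z ^ 2 + 2 * Z ^ 3 / (1 + Z₀) + 2.25 * Z)
        / (Z ^ 2 + Z + 1 / 2) := by field_simp; ring
    _ ≤ _ := by
      rw [div_le_iff₀ (by positivity)]
      exact hpoly Z hZ

lemma oddsBound_inv_le_tangent_three_halves {Z : ℝ} (hZ : 0 < Z) :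
    oddsBound (1 / Z) ≤ 1.84 + 1.91 * Z := by
  refine oddsBound_inv_le (Z₀ := 1.5) (l := 0.9163) (by norm_num) ?_ ?_ hZ
  · refine (Real.log_le_iff_le_exp (by norm_num)).2
      (le_trans ?_ (Real.sum_le_exp_of_nonneg (by norm_num) 10))
    norm_num [Finset.sum_range_succ, Nat.factorial]
  · intro Z hZ
    norm_num
    nlinarith [mul_nonneg hZ.le (sq_nonneg (Z - 1.305)), sq_nonneg (Z - 1.305)]

lemma oddsBound_inv_le_tangent_two {Z : ℝ} (hZ : 0 < Z) :
    oddsBound (1 / Z) ≤ 2.65 + 1.4 * Z := by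
  refine oddsBound_inv_le (Z₀ := 2) (l := 1.09862) (by norm_num) ?_ ?_ hZ
  · refine (Real.log_le_iff_le_exp (by norm_num)).2
      (le_trans ?_ (Real.sum_le_exp_of_nonneg (by norm_num) 12))
    norm_num [Finset.sum_range_succ, Nat.factorial]
  · intro Z hZ
    norm_num
    nlinarith [mul_nonneg hZ.le (sq_nonneg (Z - 2)), sq_nonneg (Z - 2), sq_nonneg Z]

lemma oddsBound_inv_le_tangent_three {Z : ℝ} (hZ : 0 < Z) :
    oddsBound (1 / Z) ≤ 3.81 + 0.9 * Z := by
  refine oddsBound_inv_le (Z₀ := 3) (l := 1.3863) (by norm_num) ?_ ?_ hZ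
  · refine (Real.log_le_iff_le_exp (by norm_num)).2
      (le_trans ?_ (Real.sum_le_exp_of_nonneg (by norm_num) 12))
    norm_num [Finset.sum_range_succ, Nat.factorial]
  · intro Z hZ
    norm_num
    nlinarith [mul_nonneg hZ.le (sq_nonneg (Z - 3)), sq_nonneg (Z - 3), sq_nonneg Z]

lemma oddsBound_inv_le_tangent_four {Z : ℝ} (hZ : 0 < Z) :
    oddsBound (1 / Z) ≤ 4.66 + 0.65 * Z := by
  refine oddsBound_inv_le (Z₀ := 4) (l := 1.6095) (by norm_num) ?_ ?_ hZ
  · refine (Real.log_le_iff_le_exp (by norm_num)).2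
      (le_trans ?_ (Real.sum_le_exp_of_nonneg (by norm_num) 13))
    norm_num [Finset.sum_range_succ, Nat.factorial]
  · intro Z hZ
    norm_num
    nlinarith [mul_nonneg hZ.le (sq_nonneg (Z - 4)), sq_nonneg (Z - 4), sq_nonneg Z]

end OddsBound

section Assembly

lemma sum_ite_exp_neg_mul_add_le {c : ℝ} (hc : 0 < c) (L : ℝ) (T : ℕ) :
    ∑ n ∈ Finset.range T, (if L ≤ (n : ℝ) then Real.exp (-(c * n)) else 0)
      + Real.exp (-(c * max (T : ℝ) L)) * (1 + 1 / c) ≤ Real.exp (-(c * L)) * (1 + 1 / c) := by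
  induction T with
  | zero =>
    simp only [Finset.range_zero, Finset.sum_empty, zero_add]
    gcongr
    exact le_max_right _ _
  | succ T ih =>
    rw [Finset.sum_range_succ]
    refine le_trans ?_ ih
    by_cases hT : L ≤ T
    · have hmax : max ((T + 1 : ℕ) : ℝ) L = T + 1 := by
        rw [Nat.cast_succ, max_eq_left (by linarith)]
      have hstep : Real.exp (-(c * (T + 1))) = Real.exp (-(c * T)) * Real.exp (-c) := by
        rw [← Real.exp_add]; congr 1; ring
      have hratio : Real.exp (-c) * (1 + 1 / c) ≤ 1 / c := by
        have hexp : Real.exp (-c) ≤ 1 / (1 + c) := by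
          rw [Real.exp_neg, inv_eq_one_div]
          exact one_div_le_one_div_of_le (by positivity) (by linarith [Real.add_one_le_exp c])
        refine (mul_le_mul_of_nonneg_right hexp (by positivity)).trans (le_of_eq ?_)
        field_simp
        ring
      rw [if_pos hT, max_eq_left hT, hmax, hstep]
      linarith [mul_le_mul_of_nonneg_left hratio (Real.exp_pos (-(c * T))).le]
    · rw [if_neg hT, add_zero]
      gcongr
      exact T.le_succ

lemma sum_ite_max_one_exp_neg_mul_le {c : ℝ} (hc : 0 < c) (L : ℝ) (T : ℕ) :
    ∑ n ∈ Finset.range T,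
        (if max L 1 ≤ (n : ℝ) then ENNReal.ofReal (Real.exp (-(c * n))) else 0)
      ≤ ENNReal.ofReal (Real.exp (-(c * L)) * (1 + 1 / c)) := by
  calc _ ≤ ∑ n ∈ Finset.range T,
        ENNReal.ofReal (if L ≤ (n : ℝ) then Real.exp (-(c * n)) else 0) := by
        refine Finset.sum_le_sum fun n _ => ?_
        split_ifs with hmax hL
        · exact le_rfl
        · exact absurd ((le_max_left _ _).trans hmax) hL
        · exact zero_le
        · simp
    _ = ENNReal.ofReal (∑ n ∈ Finset.range T,
          if L ≤ (n : ℝ) then Real.exp (-(c * n)) else 0) := by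
        rw [ENNReal.ofReal_sum_of_nonneg]
        intro n _
        split_ifs <;> positivity
    _ ≤ _ := by
        apply ENNReal.ofReal_le_ofReal
        have : 0 ≤ Real.exp (-(c * max (T : ℝ) L)) * (1 + 1 / c) := by positivity
        linarith [sum_ite_exp_neg_mul_add_le hc L T]

lemma sum_ite_exp_neg_mul_gap_le {β σ Δ κ b r v : ℝ} (hβ : 1 ≤ β) (hσ : 0 < σ) (hΔ : 0 < Δ)
    (hκ : κ = β * σ ^ 2 / Δ ^ 2) (hb : 0 < b) (hv : Real.exp (-(b ^ 2 * r ^ 2 / 2)) ≤ v) (T : ℕ) :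
    ∑ n ∈ Finset.range T, (if max (κ * r ^ 2) 1 ≤ (n : ℝ) then
        ENNReal.ofReal (Real.exp (-(n * (b * Δ) ^ 2 / (2 * σ ^ 2)))) else 0)
      ≤ ENNReal.ofReal (v * (1 + 2 * κ / b ^ 2)) := by
  set c := (b * Δ) ^ 2 / (2 * σ ^ 2) with hc
  have hexponent : c * (κ * r ^ 2) = β * (b ^ 2 * r ^ 2 / 2) := by
    rw [hc, hκ]; field_simp
  have hinv : 1 / c = 2 * (1 * σ ^ 2 / Δ ^ 2) / b ^ 2 := by
    rw [hc]; field_simp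
  have hterm : ∀ n : ℕ, n * (b * Δ) ^ 2 / (2 * σ ^ 2) = c * n := fun n => by
    rw [hc]; ring
  simp only [hterm]
  refine (sum_ite_max_one_exp_neg_mul_le (by positivity) _ T).trans
    (ENNReal.ofReal_le_ofReal ?_)
  rw [hexponent, hinv, hκ]
  refine mul_le_mul ((Real.exp_le_exp.2 (neg_le_neg ?_)).trans hv) (by gcongr) (by positivity)
    ((Real.exp_pos _).le.trans hv)
  exact le_mul_of_one_le_left (by positivity) hβ

variable {K : ℕ} {Θ : Type*} {μ : Fin K → Θ → ℝ} {θ : Θ} {ks k : Fin K} {α β : ℝ} {σ : ℝ≥0}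
  {τ : ℕ → Finset (Fin K) → Fin K} {ν : Fin K → Measure ℝ}
  {Ω : Type*} [MeasurableSpace Ω] {P : Measure Ω} [IsProbabilityMeasure P]
  {X : Fin K → ℕ → Ω → ℝ} {G : ℕ → Fin K → Ω → ℝ}

lemma totalOdds_level_le (hβ : 1 ≤ β) (hσ : 0 < σ) (hX : IsRewardTable P ν X)
    (hsubG : ∀ l, HasSubgaussianMGF (fun r => r - μ l θ) (σ ^ 2) (ν l))
    (hgap : 0 < gap μ θ ks k) {κ a p q : ℝ} (hκ : κ = β * σ ^ 2 / gap μ θ ks k ^ 2) (ha : 0 < a)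
    (hline : ∀ Z : ℝ, 0 < Z → oddsBound (1 / Z) ≤ p + q * Z) (T : ℕ) :
    totalOdds P β σ (X ks) (level μ θ ks k a) T
      ≤ ENNReal.ofReal (κ / a ^ 2 * (p + q * (√κ / a))) := by
  have : (0 : ℝ) < σ := NNReal.coe_pos.2 hσ
  have hκ0 : 0 < κ := by rw [hκ]; positivity
  have hδ : a / √κ = a * gap μ θ ks k / √(β * σ ^ 2) := by
    rw [hκ, Real.sqrt_div (by positivity), Real.sqrt_sq hgap.le]
    field_simp
  refine (totalOdds_le hβ hσ hX hsubG (by positivity) hδ T).trans (ENNReal.ofReal_le_ofReal ?_)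
  have hbound := hline (√κ / a) (by positivity)
  rw [one_div_div] at hbound
  rw [div_pow, Real.sq_sqrt hκ0.le, one_div_div]
  gcongr

lemma lintegral_tscPulls_le_of_lines (hks : IsBestAt μ ks θ) (hgap : 0 < gap μ θ ks k)
    (hβ : 1 ≤ β) (hσ : 0 < σ) (hτ : IsTieBreaking τ) (hX : IsRewardTable P ν X)
    (hG : IsSamplingNoise P X G)
    (hsubG : ∀ l, HasSubgaussianMGF (fun r => r - μ l θ) (σ ^ 2) (ν l))
    {κ r b v d : ℝ} (hκ : κ = β * σ ^ 2 / gap μ θ ks k ^ 2) (hb : 0 < b)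
    (hv : Real.exp (-(b ^ 2 * r ^ 2 / 2)) ≤ v) {a p q g : ℕ → ℝ} (ha : ∀ j, 0 < a j)
    (hab : ∀ j, a j + b ≤ 1) (hline : ∀ j Z, 0 < Z → oddsBound (1 / Z) ≤ p j + q j * Z)
    {T J : ℕ} (hg : ∀ j < J, gaussTail ((1 - a j - b) * r) ≤ ENNReal.ofReal (g j)) (hd0 : 0 ≤ d)
    (hd : T * gaussTail ((1 - a J - b) * r) ≤ ENNReal.ofReal d) :
    ∫⁻ ω, (tscPulls μ α β σ τ (fun l m => X l m ω) (fun s l => G s l ω) T k : ENNReal) ∂P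
      ≤ ∑ t ∈ Finset.range T, P (badEvent μ θ α σ X t)
        + ENNReal.ofReal (κ * r ^ 2 + 1 + v * (1 + 2 * κ / b ^ 2)
          + (κ / a 0 ^ 2 * (p 0 + q 0 * (√κ / a 0))
            + ∑ j ∈ Finset.range J,
                g j * (κ / a (j + 1) ^ 2 * (p (j + 1) + q (j + 1) * (√κ / a (j + 1)))) + d)) := by
  have : (0 : ℝ) < σ := NNReal.coe_pos.2 hσ
  have hκ0 : 0 < κ := by rw [hκ]; positivity
  have hv0 : 0 ≤ v := (Real.exp_pos _).le.trans hv
  have hg0 : ∀ j ∈ Finset.range J, 0 ≤ g j := fun j hj =>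
    (ENNReal.ofReal_pos.1 ((gaussTail_pos _).trans_le (hg j (Finset.mem_range.1 hj)))).le
  set o := fun j => κ / a j ^ 2 * (p j + q j * (√κ / a j))
  have ho0 : ∀ j, 0 ≤ o j := fun j => by
    have hbound := hline j (√κ / a j) (div_pos (Real.sqrt_pos.2 hκ0) (ha j))
    rw [one_div_div] at hbound
    exact mul_nonneg (by positivity)
      ((oddsBound_nonneg (div_pos (ha j) (Real.sqrt_pos.2 hκ0))).trans hbound)
  have hodds : ∀ j, totalOdds P β σ (X ks) (level μ θ ks k (a j)) T ≤ ENNReal.ofReal (o j) :=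
    fun j => totalOdds_level_le hβ hσ hX hsubG hgap hκ (ha j) (hline j) T
  calc _ ≤ _ := lintegral_tscPulls_le (α := α) hks hgap (by linarith) hσ hτ hX hG hsubG (r := r)
        hκ hb.le hab T J
    _ ≤ ∑ t ∈ Finset.range T, P (badEvent μ θ α σ X t)
        + (ENNReal.ofReal (κ * r ^ 2 + 1) + ENNReal.ofReal (v * (1 + 2 * κ / b ^ 2)))
        + (ENNReal.ofReal (o 0) + ∑ j ∈ Finset.range J, ENNReal.ofReal (g j * o (j + 1))
          + ENNReal.ofReal d) := by
      gcongr with j hj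
      · exact sum_ite_exp_neg_mul_gap_le hβ (by positivity) hgap hκ hb hv T
      · exact hodds 0
      · rw [ENNReal.ofReal_mul (hg0 j hj)]
        exact mul_le_mul' (hg j (Finset.mem_range.1 hj)) (hodds _)
    _ = _ := by
      have hsum := Finset.sum_nonneg fun j hj => mul_nonneg (hg0 j hj) (ho0 (j + 1))
      have := ho0 0
      rw [← ENNReal.ofReal_sum_of_nonneg fun j hj => mul_nonneg (hg0 j hj) (ho0 _),
        ← ENNReal.ofReal_add (by positivity) (by positivity), ← ENNReal.ofReal_add this hsum,
        ← ENNReal.ofReal_add (by positivity) hd0, add_assoc,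
        ← ENNReal.ofReal_add (by positivity) (by positivity)]

end Assembly

section Horizons

lemma gaussTail_le_ofReal {x₀ x c g : ℝ} (hx₀ : 0 < x₀) (hx : x₀ ≤ x) (hc : gaussWeight x₀ ≤ c)
    (h : c * ((x₀ ^ 2 + 2) / (x₀ ^ 3 + 3 * x₀)) ≤ 2.50662 * g) :
    gaussTail x ≤ ENNReal.ofReal g := by
  refine (gaussTail_antitone hx).trans ?_
  rw [gaussTail_eq_ofReal]
  apply ENNReal.ofReal_le_ofReal
  have hc0 : 0 ≤ c := (gaussWeight_pos _).le.trans hc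
  have hg : 0 ≤ g := by
    have : 0 ≤ 2.50662 * g := le_trans (by positivity) h
    linarith
  rw [div_le_iff₀ (by positivity), mul_comm g]
  calc upperGauss x₀ ≤ gaussWeight x₀ * ((x₀ ^ 2 + 2) / (x₀ ^ 3 + 3 * x₀)) := upperGauss_le hx₀
    _ ≤ c * ((x₀ ^ 2 + 2) / (x₀ ^ 3 + 3 * x₀)) := by gcongr
    _ ≤ 2.50662 * g := h
    _ ≤ √(2 * Real.pi) * g := by gcongr; exact lt_sqrt_two_mul_pi.le

lemma gaussTail_zero : gaussTail 0 = ENNReal.ofReal (1 / 2) := by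
  rw [gaussTail_eq_ofReal, upperGauss_zero]
  congr 1
  field_simp

lemma antitoneOn_sq_add_two_div :
    AntitoneOn (fun x : ℝ => (x ^ 2 + 2) / (x ^ 3 + 3 * x)) (Set.Ioi 0) := by
  intro x (hx : 0 < x) y (hy : 0 < y) hxy
  refine (div_le_div_iff₀ (by positivity) (by positivity)).2 ?_
  have hdiff : 0 ≤ (y - x) * (y ^ 2 * x ^ 2 + 2 * (y ^ 2 + y * x + x ^ 2) - 3 * y * x + 6) := by
    apply mul_nonneg (by linarith)
    nlinarith [sq_nonneg (y - x), sq_nonneg (y * x), mul_pos hy hx]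
  linarith

lemma natCast_mul_gaussTail_le {T : ℕ} (hT : T ≠ 0) {x₀ x c d : ℝ} (hx₀ : 0 < x₀) (hx : x₀ ≤ x)
    (hc : Real.exp (Real.log T - x ^ 2 / 2) ≤ c)
    (h : c * ((x₀ ^ 2 + 2) / (x₀ ^ 3 + 3 * x₀)) ≤ 2.50662 * d) :
    T * gaussTail x ≤ ENNReal.ofReal d := by
  have hx0 : 0 < x := hx₀.trans_le hx
  have hT0 : (0 : ℝ) < T := by exact_mod_cast Nat.pos_of_ne_zero hT
  rw [gaussTail_eq_ofReal, ← ENNReal.ofReal_natCast, ← ENNReal.ofReal_mul hT0.le]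
  apply ENNReal.ofReal_le_ofReal
  have hc0 : 0 ≤ c := (Real.exp_pos _).le.trans hc
  have hd : 0 ≤ d := by
    have : 0 ≤ 2.50662 * d := le_trans (by positivity) h
    linarith
  rw [← mul_div_assoc, div_le_iff₀ (by positivity), mul_comm d]
  calc T * upperGauss x ≤ T * (gaussWeight x * ((x ^ 2 + 2) / (x ^ 3 + 3 * x))) := by
        gcongr; exact upperGauss_le hx0
    _ = Real.exp (Real.log T - x ^ 2 / 2) * ((x ^ 2 + 2) / (x ^ 3 + 3 * x)) := by
        rw [sub_eq_add_neg, Real.exp_add, Real.exp_log hT0, gaussWeight, mul_assoc]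
    _ ≤ c * ((x₀ ^ 2 + 2) / (x₀ ^ 3 + 3 * x₀)) := by
        gcongr ?_ * ?_
        exact antitoneOn_sq_add_two_div hx₀ hx0 hx
    _ ≤ 2.50662 * d := h
    _ ≤ √(2 * Real.pi) * d := by gcongr; exact lt_sqrt_two_mul_pi.le

lemma gaussWeight_le_of_expPartial_le {x c : ℝ} (h : expPartial 9 (x ^ 2 / 2) ≤ c) :
    gaussWeight x ≤ c :=
  (exp_neg_le_expPartial (by positivity)).trans h

lemma exp_neg_le_of_expPartial_le {u v c : ℝ} (hv : 0 ≤ v) (hvu : v ≤ u) (h : expPartial 9 v ≤ c) :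
    Real.exp (-u) ≤ c :=
  (Real.exp_le_exp.2 (neg_le_neg hvu)).trans ((exp_neg_le_expPartial hv).trans h)

lemma exp_le_of_le_of_one_le_mul_expPartial {u v c : ℝ} (hv : 0 ≤ v) (huv : u ≤ v) (hc : 0 ≤ c)
    (h : 1 ≤ c * expPartial 10 v) : Real.exp u ≤ c :=
  (Real.exp_le_exp.2 huv).trans (exp_le_of_one_le_mul_expPartial hv hc h)

lemma gaussWeight_two_point_eight_nine_le : gaussWeight 2.89 ≤ 0.2493 ^ 3 := by
  have hcbrt : Real.exp (-1.39) ≤ 0.2493 := exp_neg_le_of_expPartial_le (by norm_num) le_rfl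
    (by norm_num [expPartial, Finset.sum_range_succ, Nat.factorial])
  refine le_trans ?_ (pow_le_pow_left₀ (Real.exp_pos _).le hcbrt 3)
  rw [gaussWeight, ← Real.exp_nat_mul]
  exact Real.exp_le_exp.2 (by norm_num)

variable {K : ℕ} {Θ : Type*} {μ : Fin K → Θ → ℝ} {θ : Θ} {ks k : Fin K} {α β : ℝ} {σ : ℝ≥0}
  {τ : ℕ → Finset (Fin K) → Fin K} {ν : Fin K → Measure ℝ}
  {Ω : Type*} [MeasurableSpace Ω] {P : Measure Ω} [IsProbabilityMeasure P]
  {X : Fin K → ℕ → Ω → ℝ} {G : ℕ → Fin K → Ω → ℝ} {κ : ℝ} {T : ℕ}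

lemma lintegral_tscPulls_le_of_log_le_four (hks : IsBestAt μ ks θ)
    (hgap : 0 < gap μ θ ks k) (hβ : 1 ≤ β) (hσ : 0 < σ) (hτ : IsTieBreaking τ)
    (hX : IsRewardTable P ν X) (hG : IsSamplingNoise P X G)
    (hsubG : ∀ l, HasSubgaussianMGF (fun r => r - μ l θ) (σ ^ 2) (ν l))
    (hκ : κ = β * σ ^ 2 / gap μ θ ks k ^ 2) (hT : T ≠ 0)
    (hlo : 2.19 ≤ Real.log T) (hhi : Real.log T ≤ 4) :
    ∫⁻ ω, (tscPulls μ α β σ τ (fun l m => X l m ω) (fun s l => G s l ω) T k : ENNReal) ∂P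
      ≤ ∑ t ∈ Finset.range T, P (badEvent μ θ α σ X t)
        + ENNReal.ofReal (4.5 * κ * Real.log T + (2.27 + 36.25 * κ + 17.7 * (κ * √κ))) := by
  have : (0 : ℝ) < σ := NNReal.coe_pos.2 hσ
  have hκ0 : 0 < κ := by rw [hκ]; positivity
  have hrsq : √(4.5 * Real.log T + 12) ^ 2 = 4.5 * Real.log T + 12 :=
    Real.sq_sqrt (by linarith)
  set r := √(4.5 * Real.log T + 12)
  have hr : 4.6748 ≤ r := Real.le_sqrt_of_sq_le (by norm_num; linarith)
  have hweight : Real.exp (-(0.3 ^ 2 * r ^ 2 / 2)) ≤ 0.37402 :=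
    exp_neg_le_of_expPartial_le (v := 0.983475) (by norm_num) (by rw [hrsq]; linarith)
      (by norm_num [expPartial, Finset.sum_range_succ, Nat.factorial])
  have htail₀ : gaussTail ((1 - 0.7 - 0.3) * r) ≤ ENNReal.ofReal 0.5 := by
    have hzero : (1 - 0.7 - 0.3 : ℝ) * r = 0 := by norm_num
    rw [hzero, gaussTail_zero]
    exact ENNReal.ofReal_le_ofReal (by norm_num)
  have htail₁ : gaussTail ((1 - 0.45 - 0.3) * r) ≤ ENNReal.ofReal 0.13296 :=
    gaussTail_le_ofReal (x₀ := 1.1687) (c := 0.50515) (by norm_num) (by linarith)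
      (gaussWeight_le_of_expPartial_le
        (by norm_num [expPartial, Finset.sum_range_succ, Nat.factorial]))
      (by norm_num)
  have hlast : T * gaussTail ((1 - 0.3 - 0.3) * r) ≤ ENNReal.ofReal 0.895 :=
    natCast_mul_gaussTail_le hT (x₀ := 1.8699) (c := 4.9545) (by norm_num) (by linarith)
      (exp_le_of_le_of_one_le_mul_expPartial (v := 1.6) (by norm_num)
        (by rw [mul_pow, hrsq]; linarith) (by norm_num)
        (by norm_num [expPartial, Finset.sum_range_succ, Nat.factorial]))
      (by norm_num)
  refine (lintegral_tscPulls_le_of_lines (α := α) hks hgap hβ hσ hτ hX hG hsubG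
    (a := fun | 0 => 0.7 | 1 => 0.45 | _ => 0.3)
    (p := fun | 0 => 1.84 | 1 => 2.65 | _ => 3.81)
    (q := fun | 0 => 1.91 | 1 => 1.4 | _ => 0.9)
    (g := fun | 0 => 0.5 | _ => 0.13296) (J := 2) hκ (by norm_num) hweight
    (by rintro (_ | _ | _) <;> norm_num) (by rintro (_ | _ | _) <;> norm_num)
    (fun
      | 0, _, hZ => oddsBound_inv_le_tangent_three_halves hZ
      | 1, _, hZ => oddsBound_inv_le_tangent_two hZ
      | _ + 2, _, hZ => oddsBound_inv_le_tangent_three hZ)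
    (fun
      | 0, _ => htail₀
      | 1, _ => htail₁) (by norm_num) hlast).trans
    (add_le_add_right (ENNReal.ofReal_le_ofReal ?_) _)
  have : 0 ≤ κ * √κ := by positivity
  simp only [Finset.sum_range_succ, Finset.sum_range_zero, hrsq]
  norm_num
  linarith

lemma lintegral_tscPulls_le_of_four_le_log_of_log_le_seven (hks : IsBestAt μ ks θ)
    (hgap : 0 < gap μ θ ks k) (hβ : 1 ≤ β) (hσ : 0 < σ) (hτ : IsTieBreaking τ)
    (hX : IsRewardTable P ν X) (hG : IsSamplingNoise P X G)
    (hsubG : ∀ l, HasSubgaussianMGF (fun r => r - μ l θ) (σ ^ 2) (ν l))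
    (hκ : κ = β * σ ^ 2 / gap μ θ ks k ^ 2) (hT : T ≠ 0)
    (hlo : 4 ≤ Real.log T) (hhi : Real.log T ≤ 7) :
    ∫⁻ ω, (tscPulls μ α β σ τ (fun l m => X l m ω) (fun s l => G s l ω) T k : ENNReal) ∂P
      ≤ ∑ t ∈ Finset.range T, P (badEvent μ θ α σ X t)
        + ENNReal.ofReal (4.5 * κ * Real.log T + (2.25 + 38.45 * κ + 12.1 * (κ * √κ))) := by
  have : (0 : ℝ) < σ := NNReal.coe_pos.2 hσ
  have hκ0 : 0 < κ := by rw [hκ]; positivity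
  have hrsq : √(4.5 * Real.log T + 10) ^ 2 = 4.5 * Real.log T + 10 :=
    Real.sq_sqrt (by linarith)
  set r := √(4.5 * Real.log T + 10)
  have hr : 5.2915 ≤ r := Real.le_sqrt_of_sq_le (by norm_num; linarith)
  have hweight : Real.exp (-(0.25 ^ 2 * r ^ 2 / 2)) ≤ 0.41688 :=
    exp_neg_le_of_expPartial_le (v := 0.875) (by norm_num) (by rw [hrsq]; linarith)
      (by norm_num [expPartial, Finset.sum_range_succ, Nat.factorial])
  have htail₀ : gaussTail ((1 - 0.55 - 0.25) * r) ≤ ENNReal.ofReal 0.1631 :=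
    gaussTail_le_ofReal (x₀ := 1.0583) (c := 0.57122) (by norm_num) (by linarith)
      (gaussWeight_le_of_expPartial_le
        (by norm_num [expPartial, Finset.sum_range_succ, Nat.factorial]))
      (by norm_num)
  have htail₁ : gaussTail ((1 - 0.4 - 0.25) * r) ≤ ENNReal.ofReal 0.0329 :=
    gaussTail_le_ofReal (x₀ := 1.852) (c := 0.1804) (by norm_num) (by linarith)
      (gaussWeight_le_of_expPartial_le
        (by norm_num [expPartial, Finset.sum_range_succ, Nat.factorial]))
      (by norm_num)
  have hlast : T * gaussTail ((1 - 0.25 - 0.25) * r) ≤ ENNReal.ofReal 0.8325 :=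
    natCast_mul_gaussTail_le hT (x₀ := 2.6457) (c := 6.132) (by norm_num) (by linarith)
      (exp_le_of_le_of_one_le_mul_expPartial (v := 1.8125) (by norm_num)
        (by rw [mul_pow, hrsq]; linarith) (by norm_num)
        (by norm_num [expPartial, Finset.sum_range_succ, Nat.factorial]))
      (by norm_num)
  refine (lintegral_tscPulls_le_of_lines (α := α) hks hgap hβ hσ hτ hX hG hsubG
    (a := fun | 0 => 0.55 | 1 => 0.4 | _ => 0.25)
    (p := fun | 0 => 2.65 | 1 => 3.81 | _ => 4.66)
    (q := fun | 0 => 1.4 | 1 => 0.9 | _ => 0.65)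
    (g := fun | 0 => 0.1631 | _ => 0.0329) (J := 2) hκ (by norm_num) hweight
    (by rintro (_ | _ | _) <;> norm_num) (by rintro (_ | _ | _) <;> norm_num)
    (fun
      | 0, _, hZ => oddsBound_inv_le_tangent_two hZ
      | 1, _, hZ => oddsBound_inv_le_tangent_three hZ
      | _ + 2, _, hZ => oddsBound_inv_le_tangent_four hZ)
    (fun
      | 0, _ => htail₀
      | 1, _ => htail₁) (by norm_num) hlast).trans
    (add_le_add_right (ENNReal.ofReal_le_ofReal ?_) _)
  have : 0 ≤ κ * √κ := by positivity
  simp only [Finset.sum_range_succ, Finset.sum_range_zero, hrsq]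
  norm_num
  linarith

lemma lintegral_tscPulls_le_of_seven_le_log (hks : IsBestAt μ ks θ)
    (hgap : 0 < gap μ θ ks k) (hβ : 1 ≤ β) (hσ : 0 < σ) (hτ : IsTieBreaking τ)
    (hX : IsRewardTable P ν X) (hG : IsSamplingNoise P X G)
    (hsubG : ∀ l, HasSubgaussianMGF (fun r => r - μ l θ) (σ ^ 2) (ν l))
    (hκ : κ = β * σ ^ 2 / gap μ θ ks k ^ 2) (hT : T ≠ 0)
    (hlo : 7 ≤ Real.log T) :
    ∫⁻ ω, (tscPulls μ α β σ τ (fun l m => X l m ω) (fun s l => G s l ω) T k : ENNReal) ∂P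
      ≤ ∑ t ∈ Finset.range T, P (badEvent μ θ α σ X t)
        + ENNReal.ofReal (4.5 * κ * Real.log T + (2.25 + 38.45 * κ + 12.1 * (κ * √κ))) := by
  have : (0 : ℝ) < σ := NNReal.coe_pos.2 hσ
  have hκ0 : 0 < κ := by rw [hκ]; positivity
  have hrsq : √(4.5 * Real.log T + 10) ^ 2 = 4.5 * Real.log T + 10 :=
    Real.sq_sqrt (by linarith)
  set r := √(4.5 * Real.log T + 10)
  have hr : 6.442 ≤ r := Real.le_sqrt_of_sq_le (by norm_num; linarith)
  have hweight : Real.exp (-(0.25 ^ 2 * r ^ 2 / 2)) ≤ 0.274 :=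
    exp_neg_le_of_expPartial_le (v := 1.296875) (by norm_num) (by rw [hrsq]; linarith)
      (by norm_num [expPartial, Finset.sum_range_succ, Nat.factorial])
  have htail₀ : gaussTail ((1 - 0.55 - 0.25) * r) ≤ ENNReal.ofReal 0.107 :=
    gaussTail_le_ofReal (x₀ := 1.288) (c := 0.438) (by norm_num) (by linarith)
      (gaussWeight_le_of_expPartial_le
        (by norm_num [expPartial, Finset.sum_range_succ, Nat.factorial]))
      (by norm_num)
  have htail₁ : gaussTail ((1 - 0.3 - 0.25) * r) ≤ ENNReal.ofReal 0.0022 :=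
    gaussTail_le_ofReal (by norm_num) (by linarith) gaussWeight_two_point_eight_nine_le
      (by norm_num)
  have hlast : T * gaussTail ((1 - (1 / 12) - 0.25) * r) ≤ ENNReal.ofReal 0.02 := by
    refine natCast_mul_gaussTail_le hT (x₀ := 4) (c := 0.15) (by norm_num) (by linarith) ?_
      (by norm_num)
    rw [← neg_sub]
    exact exp_neg_le_of_expPartial_le (v := 2) (by norm_num) (by rw [mul_pow, hrsq]; linarith)
      (by norm_num [expPartial, Finset.sum_range_succ, Nat.factorial])
  refine (lintegral_tscPulls_le_of_lines (α := α) hks hgap hβ hσ hτ hX hG hsubG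
    (a := fun | 0 => 0.55 | 1 => 0.3 | _ => (1 / 12))
    (p := fun | 0 => 3.81 | 1 => 3.81 | _ => 4.66)
    (q := fun | 0 => 0.9 | 1 => 0.9 | _ => 0.65)
    (g := fun | 0 => 0.107 | _ => 0.0022) (J := 2) hκ (by norm_num) hweight
    (by rintro (_ | _ | _) <;> norm_num) (by rintro (_ | _ | _) <;> norm_num)
    (fun
      | 0, _, hZ => oddsBound_inv_le_tangent_three hZ
      | 1, _, hZ => oddsBound_inv_le_tangent_three hZ
      | _ + 2, _, hZ => oddsBound_inv_le_tangent_four hZ)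
    (fun
      | 0, _ => htail₀
      | 1, _ => htail₁) (by norm_num) hlast).trans
    (add_le_add_right (ENNReal.ofReal_le_ofReal ?_) _)
  have : 0 ≤ κ * √κ := by positivity
  simp only [Finset.sum_range_succ, Finset.sum_range_zero, hrsq]
  norm_num
  linarith

lemma lintegral_tscPulls_le_of_four_le_log (hks : IsBestAt μ ks θ)
    (hgap : 0 < gap μ θ ks k) (hβ : 1 ≤ β) (hσ : 0 < σ) (hτ : IsTieBreaking τ)
    (hX : IsRewardTable P ν X) (hG : IsSamplingNoise P X G)
    (hsubG : ∀ l, HasSubgaussianMGF (fun r => r - μ l θ) (σ ^ 2) (ν l))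
    (hκ : κ = β * σ ^ 2 / gap μ θ ks k ^ 2) (hT : T ≠ 0)
    (hlo : 4 ≤ Real.log T) :
    ∫⁻ ω, (tscPulls μ α β σ τ (fun l m => X l m ω) (fun s l => G s l ω) T k : ENNReal) ∂P
      ≤ ∑ t ∈ Finset.range T, P (badEvent μ θ α σ X t)
        + ENNReal.ofReal (4.5 * κ * Real.log T + (2.25 + 38.45 * κ + 12.1 * (κ * √κ))) := by
  rcases le_total (Real.log T) 7 with hhi | hhi
  · exact lintegral_tscPulls_le_of_four_le_log_of_log_le_seven hks hgap hβ hσ hτ hX hG hsubG hκ hT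
      hlo hhi
  · exact lintegral_tscPulls_le_of_seven_le_log hks hgap hβ hσ hτ hX hG hsubG hκ hT hhi

end Horizons

section Slack

lemma mul_one_add_sub_log_le_exp {c : ℝ} (hc : 0 < c) (x : ℝ) :
    c * (1 + x - Real.log c) ≤ Real.exp x := by
  have htangent := Real.add_one_le_exp (x - Real.log c)
  rw [Real.exp_sub, Real.exp_log hc, le_div_iff₀ hc] at htangent
  linarith

lemma cubic_le_exp (y : ℝ) : 1 + y + y ^ 2 / 2 + y ^ 3 / 6 ≤ Real.exp y := by
  rcases le_total 0 y with hy | hy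
  · refine le_trans (le_of_eq ?_) (Real.sum_le_exp_of_nonneg hy 4)
    norm_num [Finset.sum_range_succ, Nat.factorial]
  · have hpartial := alternating_expPartial 4 (u := -y) (by linarith)
    norm_num [expPartial, Finset.sum_range_succ, Nat.factorial] at hpartial
    exact hpartial

lemma mul_cubic_le_exp_add {c x₀ : ℝ} (hc : 0 ≤ c) (hcx : c ≤ Real.exp x₀) (y : ℝ) :
    c * (1 + y + y ^ 2 / 2 + y ^ 3 / 6) ≤ Real.exp (y + x₀) := by
  rw [add_comm y x₀, Real.exp_add]
  exact (mul_le_mul_of_nonneg_left (cubic_le_exp y) hc).trans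
    (mul_le_mul_of_nonneg_right hcx (Real.exp_pos y).le)

lemma mul_sq_le_exp_add_nine_halves {x : ℝ} (hx : 0 ≤ x) :
    2.592 * x ^ 2 ≤ Real.exp x + 4.5 := by
  rcases le_total x 1.3 with hsmall | hlarge
  · nlinarith [Real.exp_pos x]
  · obtain ⟨y, rfl⟩ : ∃ y, x = y + 2.6 := ⟨x - 2.6, by ring⟩
    have hexp : 13.46 ≤ Real.exp 2.6 := by
      refine le_trans ?_ (Real.sum_le_exp_of_nonneg (by norm_num) 12)
      norm_num [Finset.sum_range_succ, Nat.factorial]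
    have hcubic := mul_cubic_le_exp_add (by norm_num) hexp y
    nlinarith [mul_nonneg (show 0 ≤ y + 1.3 by linarith) (sq_nonneg y), sq_nonneg (y - 0.01)]

lemma mul_sq_le_exp_add_twenty {x : ℝ} (hx : 0 ≤ x) : 4.05 * x ^ 2 ≤ Real.exp x + 20 := by
  rcases le_total x 2.2 with hsmall | hlarge
  · nlinarith [Real.exp_pos x]
  · obtain ⟨y, rfl⟩ : ∃ y, x = y + 3 := ⟨x - 3, by ring⟩
    have hexp : 20.08 ≤ Real.exp 3 := by
      refine le_trans ?_ (Real.sum_le_exp_of_nonneg (by norm_num) 13)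
      norm_num [Finset.sum_range_succ, Nat.factorial]
    have hcubic := mul_cubic_le_exp_add (by norm_num) hexp y
    nlinarith [mul_nonneg (show 0 ≤ y + 0.8 by linarith) (sq_nonneg y), sq_nonneg (y - 0.6)]

lemma mul_pow_six_le_exp {x : ℝ} (hx : 0 ≤ x) : 0.0086 * x ^ 6 ≤ Real.exp x := by
  have hsixth : 2.718 * (x / 6) ≤ Real.exp (x / 6) := by
    have htangent := Real.add_one_le_exp (x / 6 - 1)
    rw [Real.exp_sub, le_div_iff₀ (Real.exp_pos 1)] at htangent
    nlinarith [Real.exp_one_gt_d9]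
  have : 0 ≤ x ^ 6 := by positivity
  calc 0.0086 * x ^ 6 ≤ (2.718 * (x / 6)) ^ 6 := by
        rw [mul_pow, div_pow]
        norm_num
        linarith
    _ ≤ Real.exp (x / 6) ^ 6 := pow_le_pow_left₀ (by positivity) hsixth 6
    _ = Real.exp x := by rw [← Real.exp_nat_mul]; congr 1; push_cast; ring

lemma cube_le_exp_of_sq_le {w y : ℝ} (hy : 1 ≤ y) (hyw : y ^ 2 ≤ w) :
    32 * y ^ 3 ≤ Real.exp (11 * w) := by
  have hw : 0 ≤ w := (sq_nonneg y).trans hyw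
  have hquadratic := Real.quadratic_le_exp_of_nonneg (x := 11 * w) (by positivity)
  have hsq : y ^ 2 * y ^ 2 ≤ w * w := by gcongr
  have hcube : y ^ 3 ≤ y ^ 2 * y ^ 2 := by
    rw [← pow_add]
    exact pow_le_pow_right₀ hy (by norm_num)
  nlinarith

lemma cube_le_exp_add_two_mul_sq {s w y : ℝ} (hw : 0 < w) (hy : 0 ≤ y) (hsw : s * w = y ^ 2) :
    32 * y ^ 3 ≤ Real.exp (11 * w) + 2 * s ^ 2 := by
  obtain ⟨x, rfl⟩ : ∃ x, w = x / 11 := ⟨11 * w, by ring⟩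
  have hx : 0 < x := by linarith
  have hs : s ^ 2 * x ^ 2 = 121 * y ^ 4 := by
    linear_combination 121 * (s * (x / 11) + y ^ 2) * hsw
  rw [mul_div_cancel₀ x (by norm_num : (11 : ℝ) ≠ 0)]
  refine le_trans ?_ (add_le_add_left (mul_pow_six_le_exp hx.le) _)
  refine le_of_mul_le_mul_right ?_ (show 0 < x ^ 2 by positivity)
  -- With `u = x ^ 2`, AM-GM for `u ^ 4, c ^ 4, c ^ 4, c ^ 4`, where `c = 9.77 * y`:
  -- `u ^ 4 + 3 * c ^ 4 - 4 * c ^ 3 * u = (u - c) ^ 2 * (u ^ 2 + 2 * c * u + 3 * c ^ 2)`.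
  have hamgm : 0 ≤ (x ^ 2 - 9.77 * y) ^ 2 *
      ((x ^ 2) ^ 2 + 2 * 9.77 * (y * x ^ 2) + 3 * 9.77 ^ 2 * y ^ 2) := by positivity
  have : 0 ≤ x ^ 2 * y ^ 3 := by positivity
  have : 0 ≤ y ^ 4 := by positivity
  nlinarith

/-- The part of the TS-C regret bound which stays bounded as the horizon `T` grows, apart from the
additive constant and the confidence-set terms, for `w = β * σ ^ 2` and `s = 1 / Δ ^ 2`; the
sampling cost, a function of `s * w`, is absorbed by it. -/
noncomputable def tscSlack (β w s : ℝ) (T : ℕ) : ℝ :=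
  Real.exp (11 * w) + 2 * ∑ t ∈ Finset.Icc 1 T, (s / (t : ℝ)) ^ (2 * β)

variable {β w s : ℝ} {T : ℕ}

lemma exp_le_tscSlack (hs : 0 ≤ s) : Real.exp (11 * w) ≤ tscSlack β w s T := by
  have : 0 ≤ ∑ t ∈ Finset.Icc 1 T, (s / (t : ℝ)) ^ (2 * β) :=
    Finset.sum_nonneg fun t _ => by positivity
  unfold tscSlack
  linarith

lemma one_le_tscSlack (hs : 0 ≤ s) (hw : 0 ≤ w) : 1 ≤ tscSlack β w s T :=
  (Real.one_le_exp (by positivity)).trans (exp_le_tscSlack hs)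

lemma rpow_add_rpow_half_le_sum (hs : 0 ≤ s) (hT : 2 ≤ T) :
    s ^ (2 * β) + (s / 2) ^ (2 * β) ≤ ∑ t ∈ Finset.Icc 1 T, (s / (t : ℝ)) ^ (2 * β) := by
  have hsubset : ({1, 2} : Finset ℕ) ⊆ Finset.Icc 1 T := by
    intro t ht
    simp only [Finset.mem_insert, Finset.mem_singleton] at ht
    rw [Finset.mem_Icc]
    lia
  refine le_trans (le_of_eq ?_)
    (Finset.sum_le_sum_of_subset_of_nonneg hsubset fun t _ _ => by positivity)
  rw [Finset.sum_pair (by norm_num)]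
  norm_num

lemma sq_mul_one_add_log_le_rpow {u : ℝ} (hu : 0 < u) (β : ℝ) :
    u ^ 2 * (1 + (2 * β - 2) * Real.log u) ≤ u ^ (2 * β) := by
  calc u ^ 2 * (1 + (2 * β - 2) * Real.log u)
      ≤ u ^ 2 * Real.exp ((2 * β - 2) * Real.log u) := by
        gcongr
        linarith [Real.add_one_le_exp ((2 * β - 2) * Real.log u)]
    _ = u ^ (2 * β) := by
        rw [← Real.rpow_natCast, mul_comm _ (Real.log u), ← Real.rpow_def_of_pos hu,
          ← Real.rpow_add hu]
        congr 1
        push_cast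
        ring

lemma exp_add_two_mul_sq_le_tscSlack (hβ : 1 ≤ β) (hs : 1 ≤ s) (hT : 2 ≤ T) :
    Real.exp (11 * w) + 2 * s ^ 2 ≤ tscSlack β w s T := by
  have hsum := rpow_add_rpow_half_le_sum (β := β) (s := s) (by linarith) hT
  have hfirst : s ^ 2 ≤ s ^ (2 * β) := by
    rw [← Real.rpow_natCast]
    exact Real.rpow_le_rpow_of_exponent_le hs (by push_cast; linarith)
  have hsecond : 0 ≤ (s / 2) ^ (2 * β) := by positivity
  unfold tscSlack
  linarith

lemma exp_add_five_halves_mul_sq_le_tscSlack (hβ : 1 ≤ β) (hs : 1.15 ≤ s) (hT : 2 ≤ T) :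
    Real.exp (11 * w) + 2.5 * s ^ 2 ≤ tscSlack β w s T := by
  have hs0 : 0 < s := by linarith
  have hsum := rpow_add_rpow_half_le_sum (β := β) (s := s) hs0.le hT
  have hfirst := sq_mul_one_add_log_le_rpow hs0 β
  have hsecond := sq_mul_one_add_log_le_rpow (half_pos hs0) β
  rw [Real.log_div hs0.ne' two_ne_zero] at hsecond
  have hlog : Real.log 2 ≤ 5 * Real.log s := by
    have hpow : Real.log (s ^ 5) = 5 * Real.log s := by rw [Real.log_pow]; norm_num
    rw [← hpow]
    refine Real.log_le_log two_pos (le_trans ?_ (pow_le_pow_left₀ (by norm_num) hs 5))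
    norm_num
  have : 0 ≤ s ^ 2 * ((2 * β - 2) * (5 * Real.log s - Real.log 2)) :=
    mul_nonneg (by positivity) (mul_nonneg (by linarith) (by linarith))
  unfold tscSlack
  linarith

-- For `s ≤ 1.15` use a tangent line of `exp`; otherwise `s * w` is split by AM-GM into
-- multiples of `s ^ 2` and `w ^ 2`.
lemma mul_sub_le_tscSlack {A B : ℝ} (hβ : 1 ≤ β) (hw : 0 ≤ w) (hs : 0 ≤ s) (hT : 2 ≤ T)
    (hA : 0 < A) (hlog : 1.15 * A / 11 * (Real.log (1.15 * A / 11) - 1) ≤ B)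
    (hsq : ∀ x, 0 ≤ x → (A / 11) ^ 2 / 10 * x ^ 2 ≤ Real.exp x + B) :
    A * (s * w) - B ≤ tscSlack β w s T := by
  rcases le_total s 1.15 with hsmall | hlarge
  · have htangent := mul_one_add_sub_log_le_exp (c := 1.15 * A / 11) (by positivity) (11 * w)
    have hexp := exp_le_tscSlack (β := β) (w := w) (T := T) hs
    have hmul : A * (s * w) ≤ A * (1.15 * w) := by gcongr
    linarith
  · have hexp := hsq (11 * w) (by positivity)
    have hslack := exp_add_five_halves_mul_sq_le_tscSlack (w := w) hβ hlarge hT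
    nlinarith [sq_nonneg (5 * s - A * w)]

lemma fifty_six_mul_sub_le_tscSlack (hβ : 1 ≤ β) (hw : 0 ≤ w) (hs : 0 ≤ s) (hT : 2 ≤ T) :
    56 * (s * w) - 4.5 ≤ tscSlack β w s T := by
  refine mul_sub_le_tscSlack hβ hw hs hT (by norm_num) ?_ fun x hx => ?_
  · have : Real.log (1.15 * 56 / 11) ≤ 1.7685 := by
      refine (Real.log_le_iff_le_exp (by norm_num)).2
        (le_trans ?_ (Real.sum_le_exp_of_nonneg (by norm_num) 12))
      norm_num [Finset.sum_range_succ, Nat.factorial]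
    linarith
  · refine le_trans ?_ (mul_sq_le_exp_add_nine_halves hx)
    gcongr
    norm_num

lemma seventy_mul_sub_le_tscSlack (hβ : 1 ≤ β) (hw : 0 ≤ w) (hs : 0 ≤ s) (hT : 2 ≤ T) :
    70 * (s * w) - 20 ≤ tscSlack β w s T := by
  refine mul_sub_le_tscSlack hβ hw hs hT (by norm_num) ?_ fun x hx => ?_
  · have : Real.log (1.15 * 70 / 11) ≤ 2 := by
      refine (Real.log_le_iff_le_exp (by norm_num)).2
        (le_trans ?_ (Real.sum_le_exp_of_nonneg (by norm_num) 8))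
      norm_num [Finset.sum_range_succ, Nat.factorial]
    linarith
  · refine le_trans ?_ (mul_sq_le_exp_add_twenty hx)
    gcongr
    norm_num

lemma cube_le_tscSlack (hβ : 1 ≤ β) (hw : 0 ≤ w) (hs : 0 ≤ s) (hT : 2 ≤ T) {y : ℝ}
    (hy : 1 ≤ y) (hsw : s * w = y ^ 2) : 32 * y ^ 3 ≤ tscSlack β w s T := by
  rcases le_total s 1 with hsmall | hlarge
  · exact (cube_le_exp_of_sq_le hy (hsw ▸ mul_le_of_le_one_left hw hsmall)).trans
      (exp_le_tscSlack hs)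
  · have hw0 : 0 < w := hw.lt_of_ne fun h => by
      rw [← h, mul_zero] at hsw
      exact (pow_pos (zero_lt_one.trans_le hy) 2).ne hsw
    exact (cube_le_exp_add_two_mul_sq hw0 (by linarith) hsw).trans
      (exp_add_two_mul_sq_le_tscSlack hβ hlarge hT)

lemma sampling_cost_le_tscSlack_of_le_one (hβ : 1 ≤ β) (hw : 0 ≤ w) (hs : 0 ≤ s) (hT : 2 ≤ T)
    (hsw : s * w ≤ 1) :
    2.27 + 36.25 * (s * w) + 17.7 * (s * w * √(s * w)) ≤ 6 + tscSlack β w s T := by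
  have hone := one_le_tscSlack (β := β) (T := T) hs hw
  have hlinear := fifty_six_mul_sub_le_tscSlack hβ hw hs hT
  have hsq := Real.sq_sqrt (mul_nonneg hs hw)
  have hy := Real.sqrt_nonneg (s * w)
  set y := √(s * w)
  rw [← hsq] at hsw hlinear ⊢
  have hy1 : y ≤ 1 := by nlinarith
  rcases le_total y 0.313 with hlow | hhigh
  · nlinarith [mul_nonneg (mul_nonneg hy hy) (sub_nonneg.2 hlow), mul_nonneg hy (sub_nonneg.2 hlow)]
  · nlinarith [mul_nonneg (sub_nonneg.2 hhigh) (sub_nonneg.2 hy1),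
      mul_nonneg hy (mul_nonneg (sub_nonneg.2 hhigh) (sub_nonneg.2 hy1))]

lemma sampling_cost_le_tscSlack (hβ : 1 ≤ β) (hw : 0 ≤ w) (hs : 0 ≤ s) (hT : 2 ≤ T) :
    2.25 + 38.45 * (s * w) + 12.1 * (s * w * √(s * w)) ≤ 6 + tscSlack β w s T := by
  have hone := one_le_tscSlack (β := β) (T := T) hs hw
  have hlinear := fifty_six_mul_sub_le_tscSlack hβ hw hs hT
  have hsteep := seventy_mul_sub_le_tscSlack hβ hw hs hT
  have hsq := Real.sq_sqrt (mul_nonneg hs hw)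
  have hy := Real.sqrt_nonneg (s * w)
  have hcube := fun h => cube_le_tscSlack hβ hw hs hT (y := √(s * w)) h hsq.symm
  set y := √(s * w)
  rw [← hsq] at hlinear hsteep ⊢
  rcases le_total y 0.313 with hy₁ | hy₁
  · nlinarith [mul_nonneg (mul_nonneg hy hy) (sub_nonneg.2 hy₁), mul_nonneg hy (sub_nonneg.2 hy₁)]
  rcases le_total y 1.2 with hy₂ | hy₂
  · nlinarith [mul_nonneg (sub_nonneg.2 hy₁) (sub_nonneg.2 hy₂),
      mul_nonneg hy (mul_nonneg (sub_nonneg.2 hy₁) (sub_nonneg.2 hy₂))]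
  rcases le_total y 2 with hy₃ | hy₃
  · nlinarith [mul_nonneg (sub_nonneg.2 hy₂) (sub_nonneg.2 hy₃),
      mul_nonneg hy (mul_nonneg (sub_nonneg.2 hy₂) (sub_nonneg.2 hy₃))]
  · have := hcube (by linarith)
    nlinarith [mul_nonneg (sub_nonneg.2 hy₃) (sq_nonneg y)]

lemma exists_forall_tscSlack_le (hβ : 1 ≤ β) (w : ℝ) (hs : 0 ≤ s) :
    ∃ C : ℝ, ∀ T : ℕ, tscSlack β w s T ≤ C := by
  obtain ⟨C, hC⟩ := exists_forall_sum_Icc_rpow_le (s := -(2 * β)) (by linarith)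
  refine ⟨Real.exp (11 * w) + 2 * (s ^ (2 * β) * C), fun T => ?_⟩
  have hfactor : ∑ t ∈ Finset.Icc 1 T, (s / (t : ℝ)) ^ (2 * β)
      = s ^ (2 * β) * ∑ t ∈ Finset.Icc 1 T, (t : ℝ) ^ (-(2 * β)) := by
    rw [Finset.mul_sum]
    refine Finset.sum_congr rfl fun t _ => ?_
    rw [Real.div_rpow hs (Nat.cast_nonneg t), Real.rpow_neg (Nat.cast_nonneg t), div_eq_mul_inv]
  rw [tscSlack, hfactor]
  gcongr
  exact hC T

end Slack

section Regret

variable {K : ℕ} {Θ : Type*} {μ : Fin K → Θ → ℝ} {θ : Θ} {ks k : Fin K} {α β : ℝ} {σ : ℝ≥0}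
  {τ : ℕ → Finset (Fin K) → Fin K} {ν : Fin K → Measure ℝ}
  {Ω : Type*} [MeasurableSpace Ω] {P : Measure Ω} [IsProbabilityMeasure P]
  {X : Fin K → ℕ → Ω → ℝ} {G : ℕ → Fin K → Ω → ℝ}

lemma two_le_card_of_gap_pos (hgap : 0 < gap μ θ ks k) : 2 ≤ K := by
  have hne : ks ≠ k := by
    rintro rfl
    exact hgap.ne' (sub_self _)
  exact (Fintype.one_lt_card_iff.2 ⟨ks, k, hne⟩).trans_eq (Fintype.card_fin K)

lemma sum_confidence_nonneg (K : ℕ) (α : ℝ) (T : ℕ) :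
    0 ≤ ∑ t ∈ Finset.Icc 1 T, 2 * (K : ℝ) * (t : ℝ) ^ (1 - α) :=
  Finset.sum_nonneg fun _ _ => by positivity

lemma four_le_sum_confidence (hK : 2 ≤ K) (α : ℝ) {T : ℕ} (hT : 1 ≤ T) :
    4 ≤ ∑ t ∈ Finset.Icc 1 T, 2 * (K : ℝ) * (t : ℝ) ^ (1 - α) := by
  have hK' : (2 : ℝ) ≤ K := by exact_mod_cast hK
  have hfirst := Finset.single_le_sum (f := fun t : ℕ => 2 * (K : ℝ) * (t : ℝ) ^ (1 - α))
    (fun t _ => by positivity) (Finset.mem_Icc.2 ⟨le_rfl, hT⟩)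
  simp only [Nat.cast_one, Real.one_rpow] at hfirst
  linarith

lemma exists_forall_sum_confidence_le (hα : 2 < α) (K : ℕ) :
    ∃ C : ℝ, ∀ T : ℕ, ∑ t ∈ Finset.Icc 1 T, 2 * (K : ℝ) * (t : ℝ) ^ (1 - α) ≤ C := by
  obtain ⟨C, hC⟩ := exists_forall_sum_Icc_rpow_le (s := 1 - α) (by linarith)
  refine ⟨2 * K * C, fun T => ?_⟩
  rw [← Finset.mul_sum]
  gcongr
  exact hC T

-- The round `t = 1` contributes `2 * K ≥ 4` to the right-hand sum, but at most `1` to the left one.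
lemma sum_measure_badEvent_le_sub_three (hK : 2 ≤ K) (hσ : 0 < σ) (hα : 0 ≤ α)
    (hX : IsRewardTable P ν X)
    (hsubG : ∀ l, HasSubgaussianMGF (fun r => r - μ l θ) (σ ^ 2) (ν l)) {T : ℕ} (hT : 1 ≤ T) :
    ∑ t ∈ Finset.range T, P (badEvent μ θ α σ X t)
      ≤ ENNReal.ofReal (∑ t ∈ Finset.Icc 1 T, 2 * (K : ℝ) * (t : ℝ) ^ (1 - α) - 3) := by
  have hK' : (2 : ℝ) ≤ K := by exact_mod_cast hK
  have hsurplus : ∑ t ∈ Finset.Icc 1 T, (if t = 1 then (3 : ℝ) else 0) = 3 := by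
    rw [Finset.sum_ite_eq', if_pos (Finset.mem_Icc.2 ⟨le_rfl, hT⟩)]
  have hnonneg : ∀ t ∈ Finset.Icc 1 T,
      0 ≤ 2 * (K : ℝ) * (t : ℝ) ^ (1 - α) - if t = 1 then (3 : ℝ) else 0 := by
    intro t _
    split_ifs with h
    · simp only [h, Nat.cast_one, Real.one_rpow]; linarith
    · rw [sub_zero]; positivity
  rw [← hsurplus, ← Finset.sum_sub_distrib, ENNReal.ofReal_sum_of_nonneg hnonneg]
  refine (sum_range_measure_badEvent_le_sum_Icc T).trans (Finset.sum_le_sum fun t ht => ?_)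
  split_ifs with h
  · refine prob_le_one.trans (ENNReal.one_le_ofReal.2 ?_)
    simp only [h, Nat.cast_one, Real.one_rpow]
    linarith
  · rw [sub_zero]
    exact measure_badEvent_le hσ hα hX hsubG (Finset.mem_Icc.1 ht).1

lemma le_log_nine : 2.19 ≤ Real.log 9 :=
  (Real.le_log_iff_exp_le (by norm_num)).2 (exp_le_of_one_le_mul_expPartial (by norm_num)
    (by norm_num) (by norm_num [expPartial, Finset.sum_range_succ, Nat.factorial]))

lemma mul_le_one_of_tscSlack_lt {w s : ℝ} {T : ℕ} (hβ : 1 ≤ β) (hw : 0 ≤ w) (hs : 0 ≤ s)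
    (hlo : 2.19 ≤ Real.log T) (hhi : Real.log T ≤ 4)
    (hlt : 4.5 * (s * w) * Real.log T + tscSlack β w s T < T) : s * w ≤ 1 := by
  by_contra! hsw
  have hT : 2 ≤ T := by
    by_contra! hT
    interval_cases T <;> norm_num at hlo
  have hslack := fifty_six_mul_sub_le_tscSlack hβ hw hs hT
  have hTexp : (T : ℝ) ≤ Real.exp 4 := (Real.log_le_iff_le_exp (by positivity)).1 hhi
  have hexp : Real.exp 4 ≤ 55 := by
    have hpow : Real.exp 4 = Real.exp 1 ^ 4 := by rw [← Real.exp_nat_mul]; norm_num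
    rw [hpow]
    refine (pow_le_pow_left₀ (Real.exp_pos 1).le Real.exp_one_lt_d9.le 4).trans ?_
    norm_num
  have hmul : 4.5 * 1 * 2.19 ≤ 4.5 * (s * w) * Real.log T := by gcongr
  linarith

lemma lintegral_tscPulls_le_of_nine_le {w s : ℝ} (hks : IsBestAt μ ks θ)
    (hgap : 0 < gap μ θ ks k) (hβ : 1 ≤ β) (hσ : 0 < σ) (hτ : IsTieBreaking τ)
    (hX : IsRewardTable P ν X) (hG : IsSamplingNoise P X G)
    (hsubG : ∀ l, HasSubgaussianMGF (fun r => r - μ l θ) (σ ^ 2) (ν l))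
    (hw : w = β * σ ^ 2) (hs : s = 1 / gap μ θ ks k ^ 2) {T : ℕ} (hT : 9 ≤ T)
    (hlt : 4.5 * (s * w) * Real.log T + tscSlack β w s T < T) :
    ∫⁻ ω, (tscPulls μ α β σ τ (fun l m => X l m ω) (fun t l => G t l ω) T k : ENNReal) ∂P
      ≤ ∑ t ∈ Finset.range T, P (badEvent μ θ α σ X t)
        + ENNReal.ofReal (4.5 * (s * w) * Real.log T + (6 + tscSlack β w s T)) := by
  have hw0 : 0 ≤ w := by rw [hw]; positivity
  have hs0 : 0 ≤ s := by rw [hs]; positivity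
  have hκ : s * w = β * σ ^ 2 / gap μ θ ks k ^ 2 := by rw [hs, hw]; ring
  have hlo : 2.19 ≤ Real.log T := le_log_nine.trans
    (Real.log_le_log (by norm_num) (by exact_mod_cast hT))
  have hT0 : T ≠ 0 := by lia
  have hT2 : 2 ≤ T := by lia
  rcases le_total (Real.log T) 4 with hhi | hhi
  · refine (lintegral_tscPulls_le_of_log_le_four hks hgap hβ hσ hτ hX hG hsubG hκ hT0
      hlo hhi).trans ?_
    gcongr _ + ENNReal.ofReal (_ + ?_)
    exact sampling_cost_le_tscSlack_of_le_one hβ hw0 hs0 hT2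
      (mul_le_one_of_tscSlack_lt hβ hw0 hs0 hlo hhi hlt)
  · refine (lintegral_tscPulls_le_of_four_le_log hks hgap hβ hσ hτ hX hG hsubG hκ hT0
      hhi).trans ?_
    gcongr _ + ENNReal.ofReal (_ + ?_)
    exact sampling_cost_le_tscSlack hβ hw0 hs0 hT2

lemma lintegral_tscPulls_le_tscSlack {w s : ℝ} (hks : IsBestAt μ ks θ)
    (hgap : 0 < gap μ θ ks k) (hβ : 1 ≤ β) (hσ : 0 < σ) (hα : 0 ≤ α) (hτ : IsTieBreaking τ)
    (hX : IsRewardTable P ν X) (hG : IsSamplingNoise P X G)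
    (hsubG : ∀ l, HasSubgaussianMGF (fun r => r - μ l θ) (σ ^ 2) (ν l))
    (hw : w = β * σ ^ 2) (hs : s = 1 / gap μ θ ks k ^ 2) (T : ℕ) :
    ∫⁻ ω, (tscPulls μ α β σ τ (fun l m => X l m ω) (fun t l => G t l ω) T k : ENNReal) ∂P
      ≤ ENNReal.ofReal (4.5 * (s * w) * Real.log T + 3 + tscSlack β w s T
          + ∑ t ∈ Finset.Icc 1 T, 2 * (K : ℝ) * (t : ℝ) ^ (1 - α)) := by
  have hw0 : 0 ≤ w := by rw [hw]; positivity
  have hs0 : 0 ≤ s := by rw [hs]; positivity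
  have hslack := one_le_tscSlack (β := β) (T := T) hs0 hw0
  have hleading : 0 ≤ 4.5 * (s * w) * Real.log T := by positivity
  have hsum := sum_confidence_nonneg K α T
  set B := 4.5 * (s * w) * Real.log T + 3 + tscSlack β w s T
    + ∑ t ∈ Finset.Icc 1 T, 2 * (K : ℝ) * (t : ℝ) ^ (1 - α) with hB
  rcases le_or_gt (T : ℝ) B with hTB | hTB
  · calc _ ≤ ∫⁻ _, (T : ENNReal) ∂P :=
          lintegral_mono fun _ => Nat.cast_le.2 (pulls_le T k)
      _ = ENNReal.ofReal T := by
          rw [lintegral_const, measure_univ, mul_one, ENNReal.ofReal_natCast]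
      _ ≤ ENNReal.ofReal B := ENNReal.ofReal_le_ofReal hTB
  have hT1 : 1 ≤ T := by
    have : (0 : ℝ) < T := by linarith
    exact_mod_cast this
  have hK := two_le_card_of_gap_pos hgap
  have hfour := four_le_sum_confidence hK α hT1
  have hT9 : 9 ≤ T := by
    have : (8 : ℝ) < T := by linarith
    exact_mod_cast this
  calc _ ≤ _ := lintegral_tscPulls_le_of_nine_le (α := α) hks hgap hβ hσ hτ hX hG hsubG hw hs hT9
        (by linarith)
    _ ≤ _ := add_le_add_left (sum_measure_badEvent_le_sub_three hK hσ hα hX hsubG hT1) _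
    _ = ENNReal.ofReal B := by
        rw [← ENNReal.ofReal_add (by linarith) (by linarith), hB]
        congr 1
        ring

lemma integral_ucbcPulls_le (hks : IsBestAt μ ks θ) (hgap : 0 < gap μ θ ks k) (hσ : 0 < σ)
    (hα : 2 < α) (hτ : IsTieBreaking τ) (hX : IsRewardTable P ν X)
    (hsubG : ∀ l, HasSubgaussianMGF (fun r => r - μ l θ) (σ ^ 2) (ν l)) (T : ℕ) :
    ∫ ω, (ucbcPulls μ α σ τ (fun l m => X l m ω) T k : ℝ) ∂P
      ≤ 8 * α * (σ : ℝ) ^ 2 * Real.log T / gap μ θ ks k ^ 2 + 2 * α / (α - 2)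
        + ∑ t ∈ Finset.Icc 1 T, 2 * (K : ℝ) * (t : ℝ) ^ (1 - α) := by
  have := Real.log_natCast_nonneg T
  have := sum_confidence_nonneg K α T
  have hone : 1 ≤ 2 * α / (α - 2) := by
    rw [le_div_iff₀ (by linarith)]; linarith
  refine (integral_natCast_le (measurable_ucbcPulls hX T) (by positivity)
    (lintegral_ucbcPulls_le hks hgap hσ (by linarith) hτ hX hsubG T)).trans ?_
  gcongr

lemma isBigO_integral_ucbcPulls (hks : IsBestAt μ ks θ) (hgap : 0 < gap μ θ ks k) (hσ : 0 < σ)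
    (hα : 2 < α) (hτ : IsTieBreaking τ) (hX : IsRewardTable P ν X)
    (hsubG : ∀ l, HasSubgaussianMGF (fun r => r - μ l θ) (σ ^ 2) (ν l)) :
    (fun T : ℕ => ∫ ω, (ucbcPulls μ α σ τ (fun l m => X l m ω) T k : ℝ) ∂P)
      =O[atTop] (fun T : ℕ => Real.log T) := by
  obtain ⟨C, hC⟩ := exists_forall_sum_confidence_le hα K
  refine isBigO_log_of_le (a := 8 * α * (σ : ℝ) ^ 2 / gap μ θ ks k ^ 2)
    (b := 2 * α / (α - 2) + C) (fun T => integral_nonneg fun ω => Nat.cast_nonneg _) fun T => ?_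
  refine (integral_ucbcPulls_le hks hgap hσ hα hτ hX hsubG T).trans ?_
  rw [div_mul_eq_mul_div]
  linarith [hC T]

lemma integral_tscPulls_le (hks : IsBestAt μ ks θ) (hgap : 0 < gap μ θ ks k)
    (hβ : 1 ≤ β) (hσ : 0 < σ) (hα : 0 ≤ α) (hτ : IsTieBreaking τ) (hX : IsRewardTable P ν X)
    (hG : IsSamplingNoise P X G)
    (hsubG : ∀ l, HasSubgaussianMGF (fun r => r - μ l θ) (σ ^ 2) (ν l)) (T : ℕ) :
    ∫ ω, (tscPulls μ α β σ τ (fun l m => X l m ω) (fun t l => G t l ω) T k : ℝ) ∂P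
      ≤ 9 * β * (σ : ℝ) ^ 2 * Real.log T / (2 * gap μ θ ks k ^ 2) + 3
        + tscSlack β (β * σ ^ 2) (1 / gap μ θ ks k ^ 2) T
        + ∑ t ∈ Finset.Icc 1 T, 2 * (K : ℝ) * (t : ℝ) ^ (1 - α) := by
  have hw : 0 ≤ β * (σ : ℝ) ^ 2 := by positivity
  have hs : 0 ≤ 1 / gap μ θ ks k ^ 2 := by positivity
  have hslack := one_le_tscSlack (β := β) (T := T) hs hw
  have := sum_confidence_nonneg K α T
  have hleading : 4.5 * (1 / gap μ θ ks k ^ 2 * (β * (σ : ℝ) ^ 2)) * Real.log T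
      = 9 * β * (σ : ℝ) ^ 2 * Real.log T / (2 * gap μ θ ks k ^ 2) := by
    field_simp
    ring
  rw [← hleading]
  exact integral_natCast_le (measurable_tscPulls_comp hX hG T) (by positivity)
    (lintegral_tscPulls_le_tscSlack hks hgap hβ hσ hα hτ hX hG hsubG rfl rfl T)

lemma isBigO_integral_tscPulls (hks : IsBestAt μ ks θ) (hgap : 0 < gap μ θ ks k)
    (hβ : 1 ≤ β) (hσ : 0 < σ) (hα : 2 < α) (hτ : IsTieBreaking τ) (hX : IsRewardTable P ν X)
    (hG : IsSamplingNoise P X G)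
    (hsubG : ∀ l, HasSubgaussianMGF (fun r => r - μ l θ) (σ ^ 2) (ν l)) :
    (fun T : ℕ => ∫ ω,
        (tscPulls μ α β σ τ (fun l m => X l m ω) (fun t l => G t l ω) T k : ℝ) ∂P)
      =O[atTop] (fun T : ℕ => Real.log T) := by
  obtain ⟨C, hC⟩ := exists_forall_sum_confidence_le hα K
  obtain ⟨D, hD⟩ := exists_forall_tscSlack_le hβ (β * σ ^ 2)
    (show 0 ≤ 1 / gap μ θ ks k ^ 2 by positivity)
  refine isBigO_log_of_le (a := 9 * β * (σ : ℝ) ^ 2 / (2 * gap μ θ ks k ^ 2))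
    (b := 3 + D + C) (fun T => integral_nonneg fun ω => Nat.cast_nonneg _) fun T => ?_
  refine (integral_tscPulls_le hks hgap hβ hσ (by linarith) hτ hX hG hsubG T).trans ?_
  rw [div_mul_eq_mul_div]
  linarith [hC T, hD T]

lemma tscSlack_gap (β σ Δ : ℝ) (T : ℕ) :
    tscSlack β (β * σ ^ 2) (1 / Δ ^ 2) T = Real.exp (11 * β * σ ^ 2)
      + 2 * ∑ t ∈ Finset.Icc 1 T, (1 / ((t : ℝ) * Δ ^ 2)) ^ (2 * β) := by
  simp only [tscSlack, mul_assoc, div_div, mul_comm (Δ ^ 2)]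

end Regret

end StructuredBandit

open StructuredBandit in
theorem theorem3_general {K : ℕ} {Θ : Type*} (μ : Fin K → Θ → ℝ) (θstar : Θ)
    (kstar : Fin K) (hkstar : IsBestAt μ kstar θstar)
    (k : Fin K) (hsubopt : 0 < gap μ θstar kstar k)
    (σ : ℝ≥0) (hσ : 0 < σ) (α : ℝ) (hα : 2 < α)
    (τ : ℕ → Finset (Fin K) → Fin K) (hτ : IsTieBreaking τ)
    (ν : Fin K → Measure ℝ)
    (hsubG : ∀ l, HasSubgaussianMGF (fun r => r - μ l θstar) (σ ^ 2) (ν l))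
    {Ω : Type*} [MeasurableSpace Ω] (P : Measure Ω) [IsProbabilityMeasure P]
    (X : Fin K → ℕ → Ω → ℝ) (hX : IsRewardTable P ν X) :
    ((∀ T : ℕ,
        Integrable (fun ω => (ucbcPulls μ α σ τ (fun l m => X l m ω) T k : ℝ)) P ∧
        ∫ ω, (ucbcPulls μ α σ τ (fun l m => X l m ω) T k : ℝ) ∂P
          ≤ 8 * α * (σ : ℝ) ^ 2 * Real.log T / gap μ θstar kstar k ^ 2 + 2 * α / (α - 2)
            + ∑ t ∈ Finset.Icc 1 T, 2 * (K : ℝ) * (t : ℝ) ^ (1 - α)) ∧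
      (fun T : ℕ => ∫ ω, (ucbcPulls μ α σ τ (fun l m => X l m ω) T k : ℝ) ∂P)
        =O[atTop] (fun T : ℕ => Real.log T)) ∧
    (∀ β : ℝ, 1 ≤ β → ∀ G : ℕ → Fin K → Ω → ℝ, IsSamplingNoise P X G →
      (∀ T : ℕ,
        Integrable (fun ω =>
          (tscPulls μ α β σ τ (fun l m => X l m ω) (fun t l => G t l ω) T k : ℝ)) P ∧
        ∫ ω, (tscPulls μ α β σ τ (fun l m => X l m ω) (fun t l => G t l ω) T k : ℝ) ∂P
          ≤ 9 * β * (σ : ℝ) ^ 2 * Real.log T / (2 * gap μ θstar kstar k ^ 2) + 3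
            + Real.exp (11 * β * (σ : ℝ) ^ 2)
            + 2 * ∑ t ∈ Finset.Icc 1 T,
                (1 / ((t : ℝ) * gap μ θstar kstar k ^ 2)) ^ (2 * β)
            + ∑ t ∈ Finset.Icc 1 T, 2 * (K : ℝ) * (t : ℝ) ^ (1 - α)) ∧
      (fun T : ℕ =>
          ∫ ω, (tscPulls μ α β σ τ (fun l m => X l m ω) (fun t l => G t l ω) T k : ℝ) ∂P)
        =O[atTop] (fun T : ℕ => Real.log T)) := by
  have hα0 : 0 ≤ α := by linarith
  refine ⟨⟨fun T => ⟨?_, ?_⟩, ?_⟩, fun β hβ G hG => ⟨fun T => ⟨?_, ?_⟩, ?_⟩⟩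
  · exact integrable_natCast_of_le (measurable_ucbcPulls hX T) fun _ => pulls_le T k
  · exact integral_ucbcPulls_le hkstar hsubopt hσ hα hτ hX hsubG T
  · exact isBigO_integral_ucbcPulls hkstar hsubopt hσ hα hτ hX hsubG
  · exact integrable_natCast_of_le (measurable_tscPulls_comp hX hG T) fun _ => pulls_le T k
  · refine (integral_tscPulls_le hkstar hsubopt hβ hσ hα0 hτ hX hG hsubG T).trans_eq ?_
    rw [tscSlack_gap]
    ring
  · exact isBigO_integral_tscPulls hkstar hsubopt hβ hσ hα hτ hX hG hsubG

open StructuredBandit in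
theorem theorem3 {K : ℕ} {Θ : Type*} (μ : Fin K → Θ → ℝ) (θstar : Θ)
    (kstar : Fin K) (hkstar : IsBestAt μ kstar θstar)
    (k : Fin K) (hsubopt : 0 < gap μ θstar kstar k) (hcomp : IsCompetitive μ θstar kstar k)
    (σ : ℝ≥0) (hσ : 0 < σ) (α : ℝ) (hα : 2 < α)
    (τ : ℕ → Finset (Fin K) → Fin K) (hτ : IsTieBreaking τ)
    (ν : Fin K → Measure ℝ) [∀ l, IsProbabilityMeasure (ν l)]
    (hmean : ∀ l, ∫ r, r ∂(ν l) = μ l θstar)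
    (hsubG : ∀ l, HasSubgaussianMGF (fun r => r - μ l θstar) (σ ^ 2) (ν l))
    {Ω : Type*} [MeasurableSpace Ω] (P : Measure Ω) [IsProbabilityMeasure P]
    (X : Fin K → ℕ → Ω → ℝ) (hX : IsRewardTable P ν X) :
    ((∀ T : ℕ,
        Integrable (fun ω => (ucbcPulls μ α σ τ (fun l m => X l m ω) T k : ℝ)) P ∧
        ∫ ω, (ucbcPulls μ α σ τ (fun l m => X l m ω) T k : ℝ) ∂P
          ≤ 8 * α * (σ : ℝ) ^ 2 * Real.log T / gap μ θstar kstar k ^ 2 + 2 * α / (α - 2)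
            + ∑ t ∈ Finset.Icc 1 T, 2 * (K : ℝ) * (t : ℝ) ^ (1 - α)) ∧
      (fun T : ℕ => ∫ ω, (ucbcPulls μ α σ τ (fun l m => X l m ω) T k : ℝ) ∂P)
        =O[atTop] (fun T : ℕ => Real.log T)) ∧
    (∀ β : ℝ, 1 < β → ∀ G : ℕ → Fin K → Ω → ℝ, IsSamplingNoise P X G →
      (∀ T : ℕ,
        Integrable (fun ω =>
          (tscPulls μ α β σ τ (fun l m => X l m ω) (fun t l => G t l ω) T k : ℝ)) P ∧
        ∫ ω, (tscPulls μ α β σ τ (fun l m => X l m ω) (fun t l => G t l ω) T k : ℝ) ∂P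
          ≤ 9 * β * (σ : ℝ) ^ 2 * Real.log T / (2 * gap μ θstar kstar k ^ 2) + 3
            + Real.exp (11 * β * (σ : ℝ) ^ 2)
            + 2 * ∑ t ∈ Finset.Icc 1 T,
                (1 / ((t : ℝ) * gap μ θstar kstar k ^ 2)) ^ (2 * β)
            + ∑ t ∈ Finset.Icc 1 T, 2 * (K : ℝ) * (t : ℝ) ^ (1 - α)) ∧
      (fun T : ℕ =>
          ∫ ω, (tscPulls μ α β σ τ (fun l m => X l m ω) (fun t l => G t l ω) T k : ℝ) ∂P)
        =O[atTop] (fun T : ℕ => Real.log T)) :=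
  have h := theorem3_general μ θstar kstar hkstar k hsubopt σ hσ α hα τ hτ ν hsubG P X hX
  ⟨h.1, fun β hβ => h.2 β hβ.le⟩
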